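/- **Setup.** Let $\mathfrak m>0$, $T^+:=\mathbb R/\mathfrak m\mathbb Z\times(0,\pi)$, $\omega_1:=\mathfrak m$, $\omega_2:=2\pi i$, and let $\wp$ be the Weierstrass function of the lattice $\mathfrak m\mathbb Z+2\pi i\mathbb Z$. Write $z^{[+]}=z$, $z^{[-]}=\overline z$, $\partial^{[+]}_z=\partial_z$, $\partial^{[-]}_z=\partial_{\overline z}$. Let $G$ be the Green's function of $T^+$ with zero Dirichlet boundary conditions, $G(z_1,z_2)=-\frac1{2\pi}\log|z_2-z_1|+O(1)$ as $z_2\to z_1$. Let $\Omega\subset\mathbb R/\mathbb Z\times\mathbb R$ be a bounded doubly connected domain with non-contractible boundary components $\partial_\bot\Omega$ (bottom) and $\partial_\top\Omega$ (top), and let $\phi:T^+\to\Omega$ be a conformal isomorphism that sends the bottom boundary to the bottom boundary. A function on the double cover of $\Omega$ is called antiperiodic if it changes sign after one turn around the cylinder. For $\eta\in\mathbb C$ and $z_1$ in the double cover of $\Omega$ let $f^{[\eta]}(z_1,\cdot)$ be the antiperiodic solution, holomorphic in $\Omega\smallsetminus\{z_1\}$, of the boundary value problem: $f^{[\eta]}(z_1,z_2)=\frac1{\pi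 i}\frac{\overline\eta}{z_2-z_1}+O(1)$ as $z_2\to z_1$; $\operatorname{Re}f^{[\eta]}(z_1,\cdot)$ is continuous up to $\partial_\bot\Omega$ and vanishes there; near $\partial_\top\Omega$ the function $f^{[\eta]}(z_1,\cdot)$ has a primitive whose imaginary part is continuous up to $\partial_\top\Omega$ and vanishes there. Put $f^{[\pm+]}:=f^{[1]}\pm i f^{[i]}$, $f^{[\pm-]}:=\overline{f^{[\mp+]}}$ and $$\mathcal A_n(z_1,\dots,z_n):=\frac1{4^n}\sum_{s_1,\dots,s_n\in\{\pm\}}\det\big[\mathbf 1_{j\ne k}f^{[s_j,s_k]}(z_j,z_k)\big]_{j,k=1}^n\prod_{k=1}^n dz_k^{[s_k]}.$$ For $n=2,3$, the $n$-th top-boundary moment $M_n$ is the integral $\int\!\cdots\!\int\mathcal A_n$ along $n$ pairwise disjoint paths, each running inside $\Omega$ from $\partial_\bot\Omega$ to $\partial_\top\Omega$, the paths being the $\phi$-images of paths in $\overline{T^+}$ that are $C^1$ up to their ends. **Theorem.** There is a constant $c_{\mathfrak m}\in\mathbb R$, depending only on $\mathfrak m$, such that for all $s_1,s_2\in\{\pm\}$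 and all distinct $z_1,z_2\in T^+$ $$-4\pi\,\partial^{[s_1]}_{z_1}\partial^{[s_2]}_{z_2}G(z_1,z_2)=s_1s_2\big(\wp(z_2^{[s_2]}-z_1^{[s_1]})+c_{\mathfrak m}\big),$$ and the following holds for all $\Omega$, $\phi$ and $f^{[\eta]}$ as above. For $n=2,3$ the integral defining $M_n$ converges absolutely, is real, and does not depend on the choice of the paths, and $$M_3^2=-4\big(M_2+\wp(\tfrac12\omega_1)+c_{\mathfrak m}\big)\big(M_2+\wp(\tfrac12\omega_2)+c_{\mathfrak m}\big)\big(M_2+\wp(\tfrac12(\omega_1+\omega_2))+c_{\mathfrak m}\big).$$ Consequently, there is $\mu\in\mathbb R/\mathbb Z$ such that $$M_2=-\wp(z_\mu)-c_{\mathfrak m},\qquad M_3=\wp'(z_\mu),\qquad z_\mu:=(\tfrac12-\mu)\mathfrak m+\pi i.$$ -/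

import Mathlib

open Complex Set Filter Topology MeasureTheory

noncomputable section

namespace DimerCylinder

/-! Functions and sets on a cylinder `ℝ/ℓℤ × ℝ` are represented by their lifts to the universal
cover `ℂ`.  A sign `s ∈ {±}` is a `Bool`, with `true` for `+` and `false` for `-`. -/

/-- `s` as the number `1` or `-1`. -/
def sgn (s : Bool) : ℂ := if s then 1 else -1

/-- `z^[+] = z` and `z^[-]` is the complex conjugate of `z`. -/
def twist (s : Bool) (z : ℂ) : ℂ := if s then z else (starRingEnd ℂ) z

/-- Wirtinger derivatives: `∂_z` for `s = +` and `∂_{z̄}` for `s = -`. -/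
def wirtinger (s : Bool) (F : ℂ → ℂ) (z : ℂ) : ℂ :=
  (fderiv ℝ F z 1 - sgn s * I * fderiv ℝ F z I) / 2

/-- The strip `0 < Im z < π`, the universal cover of the straight cylinder
`T⁺ = ℝ/𝔪ℤ × (0, π)`. -/
def strip : Set ℂ := {z | 0 < z.im ∧ z.im < Real.pi}

/-- The pair of periods `ω₁ = 𝔪`, `ω₂ = 2πi`. -/
def periods (𝔪 : ℝ) (h𝔪 : 0 < 𝔪) : PeriodPair where
  ω₁ := (𝔪 : ℂ)
  ω₂ := 2 * (Real.pi : ℂ) * I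
  indep := by
    rw [LinearIndependent.pair_iff]
    intro a b h
    have h1 := congrArg Complex.re h
    have h2 := congrArg Complex.im h
    simp at h1 h2
    exact ⟨h1.resolve_right h𝔪.ne', h2⟩

/-! ### The Green's function of the straight cylinder -/

/-- `G` is the (positive) Green's function of the straight cylinder `T⁺`, with zero Dirichlet
boundary conditions and `G(z₁, z₂) = -(2π)⁻¹ log |z₂ - z₁| + O(1)`.  By the maximum principle
these conditions determine `G z₁` on the strip away from `z₁ + 𝔪ℤ`. -/
structure IsGreenFunction (𝔪 : ℝ) (G : ℂ → ℂ → ℝ) : Prop where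
  periodic : ∀ z₁ ∈ strip, ∀ z₂ ∈ strip, G z₁ (z₂ + 𝔪) = G z₁ z₂
  harmonic : ∀ z₁ ∈ strip, ∀ z₂ ∈ strip, (∀ k : ℤ, z₂ ≠ z₁ + k * 𝔪) →
    InnerProductSpace.HarmonicAt (G z₁) z₂
  singularity : ∀ z₁ ∈ strip,
    (fun z₂ => G z₁ z₂ + (2 * Real.pi)⁻¹ * Real.log ‖z₂ - z₁‖)
      =O[𝓝[≠] z₁] (fun _ => (1 : ℝ))
  boundary : ∀ z₁ ∈ strip, ∀ w : ℂ, (w.im = 0 ∨ w.im = Real.pi) →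
    Tendsto (G z₁) (𝓝[strip] w) (𝓝 0)

/-- `c` is the constant `c_𝔪` for which the second derivatives of the Green's function of `T⁺`
satisfy `-4π ∂^[s₁]_{z₁} ∂^[s₂]_{z₂} G(z₁, z₂) = s₁ s₂ (℘(z₂^[s₂] - z₁^[s₁]) + c)`. -/
def IsGreenConstant (𝔪 : ℝ) (h𝔪 : 0 < 𝔪) (c : ℝ) : Prop :=
  ∃ G : ℂ → ℂ → ℝ, IsGreenFunction 𝔪 G ∧
    ∀ s₁ s₂ : Bool, ∀ z₁ ∈ strip, ∀ z₂ ∈ strip, (∀ k : ℤ, z₂ ≠ z₁ + k * 𝔪) →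
      -4 * (Real.pi : ℂ) *
          wirtinger s₁ (fun w₁ => wirtinger s₂ (fun w₂ => (G w₁ w₂ : ℂ)) z₂) z₁ =
        sgn s₁ * sgn s₂ *
          ((periods 𝔪 h𝔪).weierstrassP (twist s₂ z₂ - twist s₁ z₁) + c)

/-! ### Cylindrical domains and their uniformization -/

/-- The (lift of the) component of the complement of a subset of `ℝ/ℤ × ℝ` that contains the lower
end of the cylinder.  The map `z ↦ exp(-2πiz)` identifies the cylinder with `ℂ \ {0}` and sends
its lower end to `0`. -/
def lowerSide (U : Set ℂ) : Set ℂ :=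
  {w | cexp (-(2 * Real.pi * I * w)) ∈
    connectedComponentIn ((fun z : ℂ => cexp (-(2 * Real.pi * I * z))) '' U)ᶜ 0}

/-- The component of the complement that contains the upper end of the cylinder, which
`z ↦ exp(2πiz)` sends to `0`. -/
def upperSide (U : Set ℂ) : Set ℂ :=
  {w | cexp (2 * Real.pi * I * w) ∈
    connectedComponentIn ((fun z : ℂ => cexp (2 * Real.pi * I * z)) '' U)ᶜ 0}

/-- `U ⊆ ℂ` is the lift of a bounded doubly connected domain in `ℝ/ℤ × ℝ` with non-contractible
boundary components: its complement in the cylinder consists of exactly two components, one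
containing the lower and one containing the upper end. -/
structure IsCylindricalDomain (U : Set ℂ) : Prop where
  isOpen : IsOpen U
  periodic : ∀ z : ℂ, z + 1 ∈ U ↔ z ∈ U
  connected : IsConnected ((fun z : ℂ => cexp (2 * Real.pi * I * z)) '' U)
  bounded : ∃ R : ℝ, ∀ z ∈ U, |z.im| ≤ R
  compl : Uᶜ = lowerSide U ∪ upperSide U
  disjoint : Disjoint (lowerSide U) (upperSide U)

/-- The bottom boundary component. -/
def bottomBoundary (U : Set ℂ) : Set ℂ := frontier U ∩ lowerSide U

/-- The top boundary component. -/
def topBoundary (U : Set ℂ) : Set ℂ := frontier U ∩ upperSide U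

/-- `φ` is (the lift of) a conformal isomorphism of `T⁺ = ℝ/𝔪ℤ × (0, π)` onto the cylindrical
domain; as `φ(z + 𝔪) = φ(z) + 1`, it sends the bottom boundary to the bottom boundary. -/
structure IsUniformization (𝔪 : ℝ) (U : Set ℂ) (φ : ℂ → ℂ) : Prop where
  holomorphic : DifferentiableOn ℂ φ strip
  bijective : BijOn φ strip U
  equivariant : ∀ z ∈ strip, φ (z + 𝔪) = φ z + 1

/-! ### The boundary value problem -/

/-- `F = f^[η](z₁, ·)` solves the boundary value problem with singularity at `z₁`.
Antiperiodic functions on the double cover of the domain are functions on `U` with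
`F(z + 1) = -F(z)`. -/
structure SolvesBVP (U : Set ℂ) (η z₁ : ℂ) (F : ℂ → ℂ) : Prop where
  antiperiodic : ∀ z ∈ U, F (z + 1) = -F z
  holomorphic : DifferentiableOn ℂ F {z ∈ U | ∀ k : ℤ, z ≠ z₁ + k}
  singularity :
    (fun z => F z - 1 / (Real.pi * I) * ((starRingEnd ℂ) η / (z - z₁)))
      =O[𝓝[≠] z₁] (fun _ => (1 : ℝ))
  bottom : ∀ w ∈ bottomBoundary U, Tendsto (fun z => (F z).re) (𝓝[U] w) (𝓝 0)
  top : ∃ (V : Set ℂ) (g : ℂ → ℂ), IsOpen V ∧ (∀ z, z + 1 ∈ V ↔ z ∈ V) ∧ topBoundary U ⊆ V ∧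
    (∀ z ∈ U ∩ V, HasDerivAt g (F z) z) ∧
    ∀ w ∈ topBoundary U, Tendsto (fun z => (g z).im) (𝓝[U] w) (𝓝 0)

/-- The functions `f^[±±]` built from `f^[η]`:
`f^[±+] = f^[1] ± i f^[i]`, and `f^[±-]` is the complex conjugate of `f^[∓+]`. -/
def fpm (f : ℂ → ℂ → ℂ → ℂ) (s₁ s₂ : Bool) (z₁ z₂ : ℂ) : ℂ :=
  match s₂ with
  | true => f 1 z₁ z₂ + sgn s₁ * I * f I z₁ z₂
  | false => (starRingEnd ℂ) (f 1 z₁ z₂ + sgn (!s₁) * I * f I z₁ z₂)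

/-! ### The forms `𝒜ₙ` and the top-boundary moments -/

/-- The form `𝒜ₙ = 4⁻ⁿ ∑_s det[𝟙_{j≠k} f^[s_j, s_k](z_j, z_k)] ∏ dz_k^[s_k]` at `(z₁, …, zₙ)`,
evaluated on the tangent vectors `v₁, …, vₙ` at `z₁, …, zₙ`. -/
def formA (f : ℂ → ℂ → ℂ → ℂ) (n : ℕ) (z v : Fin n → ℂ) : ℂ :=
  (1 / 4 ^ n) * ∑ s : Fin n → Bool,
    (Matrix.of fun j k : Fin n => if j = k then 0 else fpm f (s j) (s k) (z j) (z k)).det *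
      ∏ k, twist (s k) (v k)

/-- `n` paths in the closed cylinder from its bottom to its top boundary, that are `C¹` up to the
ends, run inside the cylinder, and do not intersect each other in the cylinder. -/
structure IsPathFamily (𝔪 : ℝ) (n : ℕ) (γ : Fin n → ℝ → ℂ) : Prop where
  smooth : ∀ k, ContDiffOn ℝ 1 (γ k) (Icc 0 1)
  start : ∀ k, (γ k 0).im = 0
  finish : ∀ k, (γ k 1).im = Real.pi
  inside : ∀ k, ∀ t ∈ Ioo (0 : ℝ) 1, γ k t ∈ strip
  disjoint : ∀ j k, j ≠ k → ∀ t ∈ Icc (0 : ℝ) 1, ∀ u ∈ Icc (0 : ℝ) 1, ∀ l : ℤ,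
    γ j t ≠ γ k u + l * 𝔪

/-- `M = Mₙ` is the value of `hₙ(z₁, …, zₙ) = ∫_{z₁⁰}^{z₁} ⋯ ∫_{zₙ⁰}^{zₙ} 𝒜ₙ` on the top boundary:
the form `𝒜ₙ` of the domain, pulled back to `T⁺` by `φ`, is absolutely integrable along any `n`
disjoint paths from the bottom boundary to the top boundary, and its integral is `M`. -/
def IsTopMoment (𝔪 : ℝ) (φ : ℂ → ℂ) (f : ℂ → ℂ → ℂ → ℂ) (n : ℕ) (M : ℝ) : Prop :=
  ∀ γ : Fin n → ℝ → ℂ, IsPathFamily 𝔪 n γ →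
    IntegrableOn (fun t : Fin n → ℝ => formA f n (fun k => φ (γ k (t k)))
      (fun k => deriv φ (γ k (t k)) * derivWithin (γ k) (Icc 0 1) (t k))) (Icc 0 1) ∧
    ∫ t in Icc (0 : Fin n → ℝ) 1, formA f n (fun k => φ (γ k (t k)))
      (fun k => deriv φ (γ k (t k)) * derivWithin (γ k) (Icc 0 1) (t k)) = (M : ℂ)

end DimerCylinder

end

/-! Let `Θ = theta m` be the odd theta function of the lattice `𝔪ℤ + 2πiℤ`, and let `K_s(u) = kron m
s u` be the Kronecker function `e^{u/2} Θ(u+s) Θ'(0) / (Θ(u) Θ(s))`. It has residue `1` at `0` and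
multipliers `-1` along `2πi` and `e^{𝔪/2+s}` along `𝔪`. The theorem holds because every kernel
`f^[η]`, for every domain, is a single `K_s` up to factors that cancel in `𝒜ₙ`.

Pull a solution `F` back by `φ`. Then `F ∘ φ` is antiperiodic and imaginary on the bottom line,
while `(F ∘ φ) φ'` is real on the top line; both extend analytically across these lines by
reflection. Suppose `κ` is zero-free, with `κ` real at the bottom, `κ φ'` real at the top and
`κ(w+𝔪) = e^{-a} κ(w)`. Division by `κ` leaves a problem in the straight strip with multiplier
`-e^a`. Fourier series show that its solution is unique (`eq_zero_of_mixed_boundary`), and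
`bvpKernel` solves it explicitly through `K_s(w - w₁)` and `K_s(w - w̄₁)`, where `s = a - 𝔪/2 + πi`.
Hence `f^[s₁,s₂]` is `K_s(w₂^[s₂] - w₁^[s₁])` times factors attached to the separate points
(`exists_isStripKernel`).

To construct `κ` (`SolvesBVP.exists_zeroFree`), take the solution with pole at `πi/2`.
Antiperiodicity and reality force a zero on each boundary line. An explicit theta quotient cancels
the pole and these two zeros. That nothing else vanishes is an argument principle
(`AnalyticPair.ne_zero`): the square is divided by theta products with its zeros, and the
nonvanishing quotient is real on both lines, so its argument does not change over a period on either
of them. Its multiplier would change between the lines in proportion to the number of zeros. This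
count needs a periodic logarithm of `φ'` (`exists_log_deriv`), which comes from a logarithm of a
two-point difference quotient; winding numbers show that its additive period is zero and that `φ`
matches bottom with bottom and top with top, although `φ` need not extend continuously.

In the determinants the one-point factors cancel. For `n = 2` the identity `K_s(u) K_s(-u) = ℘(s) -
℘(u)` splits `𝒜₂` into a constant multiple of `∏ Im dw_k` and the second derivatives of the Green's
function. The latter integrate to zero because `ζ = Θ'/Θ` has period `2πi`. For `n = 3` the sum over
the two 3-cycles is `-℘'(s)` (`kron_triple`), so `𝒜₃` is a constant multiple of `∏ Im dw_k`.
Therefore `M₂ = -℘(s) - c` and `M₃ = -℘'(s)`, where `ζ' = -(℘ + c)`. The cubic relation is the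
differential equation of `℘`, and `z_μ` is `-s` modulo `2πi`. -/

noncomputable section
namespace DimerCylinder

/-! ### The theta function of the lattice `mℤ + 2πiℤ` -/

/-- The product `∏ₙ (1 - e^{w - nm})`. -/
def halfProd (m : ℝ) (w : ℂ) : ℂ := ∏' n : ℕ, (1 + -cexp (w - n * m))

/-- The odd theta function with simple zeros at `mℤ + 2πiℤ`. -/
def theta (m : ℝ) (w : ℂ) : ℂ := cexp (-w / 2) * halfProd m w * halfProd m (-w - m)

section
variable {m : ℝ} (hm : 0 < m)
include hm

omit hm in
lemma norm_exp_sub_natCast_mul (w : ℂ) (n : ℕ) :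
    ‖cexp (w - n * m)‖ = Real.exp w.re * Real.exp (-m) ^ n := by
  rw [Complex.norm_exp, ← Real.exp_nat_mul, ← Real.exp_add]
  congr 1
  simp
  ring

lemma summable_exp_neg_pow : Summable fun n : ℕ => Real.exp (-m) ^ n :=
  summable_geometric_of_lt_one (Real.exp_pos _).le (by simpa using hm)

lemma summable_norm_halfProd (w : ℂ) : Summable fun n : ℕ => ‖-cexp (w - n * m)‖ := by
  simp only [norm_neg, norm_exp_sub_natCast_mul]
  exact (summable_exp_neg_pow hm).mul_left _

lemma differentiable_halfProd : Differentiable ℂ (halfProd m) := by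
  have key : HasProdLocallyUniformlyOn (fun (n : ℕ) (w : ℂ) => 1 + -cexp (w - n * m))
      (halfProd m) univ := by
    apply hasProdLocallyUniformlyOn_of_forall_compact isOpen_univ
    intro K _ hcK
    obtain ⟨R, hR⟩ := hcK.isBounded.exists_norm_le
    refine (((summable_exp_neg_pow hm).mul_left (Real.exp R))).hasProdUniformlyOn_nat_one_add
      hcK (.of_forall fun n x hx ↦ ?_) (fun _ ↦ by fun_prop)
    rw [norm_neg, norm_exp_sub_natCast_mul]
    gcongr
    exact (Complex.re_le_norm x).trans (hR x hx)
  have := key.differentiableOn (.of_forall fun _ ↦ by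
    simpa [Finset.prod_fn] using DifferentiableOn.finsetProd (fun _ _ ↦ by fun_prop)) isOpen_univ
  exact differentiableOn_univ.mp this

/-- Splitting off the factor `n = 0` shifts the remaining ones. Quasi-periodicity along `m`, oddness
and the location of the zeros all rest on this relation. -/
lemma halfProd_eq_mul (w : ℂ) : halfProd m w = (1 - cexp w) * halfProd m (w - m) := by
  have h1 : Multipliable fun n : ℕ => (1 + -cexp (w - (n + 1 : ℕ) * m)) := by
    have h := multipliable_one_add_of_summable (summable_norm_halfProd hm (w - m))
    have he : (fun n : ℕ => 1 + -cexp (w - (n + 1 : ℕ) * m)) =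
        fun n : ℕ => 1 + -cexp (w - m - n * m) := by
      funext n
      congr 3
      push_cast
      ring
    rw [he]
    exact h
  rw [halfProd, tprod_eq_zero_mul' (f := fun n : ℕ => 1 + -cexp (w - n * m)) h1, halfProd]
  congr 1
  · simp [sub_eq_add_neg]
  · refine tprod_congr fun n => ?_
    congr 3
    push_cast
    ring

/-- An absolutely convergent product vanishes only with one of its factors. Conversely, the
functional equation carries the zeros at `2πiℤ` to the right by multiples of `m`. -/
lemma halfProd_eq_zero_iff (w : ℂ) :
    halfProd m w = 0 ↔ ∃ n : ℕ, ∃ k : ℤ, w = n * m + k * (2 * Real.pi * I) := by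
  constructor
  · intro h
    by_contra! hne
    refine tprod_one_add_ne_zero_of_summable (f := fun n : ℕ => -cexp (w - n * m))
      (fun n h0 => ?_) (summable_norm_halfProd hm w) h
    have : cexp (w - n * m) = 1 := by linear_combination -h0
    obtain ⟨k, hk⟩ := Complex.exp_eq_one_iff.mp this
    exact hne n k (by linear_combination hk)
  · rintro ⟨n, k, rfl⟩
    induction n with
    | zero =>
      rw [halfProd_eq_mul hm, Complex.exp_eq_one_iff.mpr ⟨k, by simp⟩]
      simp
    | succ n ih =>
      rw [halfProd_eq_mul hm]
      have : ((n + 1 : ℕ) * m + k * (2 * Real.pi * I) - m : ℂ) =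
        n * m + k * (2 * Real.pi * I) := by push_cast; ring
      rw [this, ih, mul_zero]

omit hm in
lemma halfProd_conj (hm : 0 < m) (w : ℂ) :
    halfProd m ((starRingEnd ℂ) w) = (starRingEnd ℂ) (halfProd m w) := by
  have h := multipliable_one_add_of_summable (summable_norm_halfProd hm w)
  have := h.map_tprod (starRingEnd ℂ) Complex.continuous_conj
  rw [halfProd, halfProd, this]
  refine tprod_congr fun n => ?_
  simp [← Complex.exp_conj]

omit hm in
lemma halfProd_add_two_pi (w : ℂ) : halfProd m (w + 2 * Real.pi * I) = halfProd m w := by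
  refine tprod_congr fun n => ?_
  rw [show w + 2 * Real.pi * I - n * m = w - n * m + 2 * Real.pi * I by ring,
    Complex.exp_add, Complex.exp_two_pi_mul_I, mul_one]

lemma differentiable_theta : Differentiable ℂ (theta m) := by
  have h := differentiable_halfProd hm
  unfold theta
  fun_prop

/-- This form displays oddness: the first factor is odd, and `w ↦ -w` exchanges the other two. -/
lemma theta_eq (w : ℂ) : theta m w =
    (cexp (-w / 2) - cexp (w / 2)) * halfProd m (w - m) * halfProd m (-w - m) := by
  rw [theta, halfProd_eq_mul hm w, show w / 2 = -w / 2 + w by ring, Complex.exp_add]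
  ring

lemma theta_neg (w : ℂ) : theta m (-w) = -theta m w := by
  rw [theta_eq hm, theta_eq hm]
  simp only [neg_neg]
  ring

lemma theta_zero : theta m 0 = 0 := by
  have := theta_neg hm 0
  rw [neg_zero] at this
  linear_combination this / 2

lemma theta_conj (w : ℂ) : theta m ((starRingEnd ℂ) w) = (starRingEnd ℂ) (theta m w) := by
  rw [theta, theta, map_mul, map_mul, ← halfProd_conj hm, ← halfProd_conj hm, ← Complex.exp_conj]
  simp [map_ofNat]

omit hm in
lemma theta_add_two_pi (w : ℂ) : theta m (w + 2 * Real.pi * I) = -theta m w := by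
  rw [theta, theta, halfProd_add_two_pi,
    ← halfProd_add_two_pi (-(w + 2 * Real.pi * I) - m),
    show -(w + 2 * Real.pi * I) - m + 2 * Real.pi * I = -w - m by ring,
    show -(w + 2 * Real.pi * I) / 2 = -w / 2 + -(Real.pi * I) by ring, Complex.exp_add,
    Complex.exp_neg (Real.pi * I), Complex.exp_pi_mul_I]
  ring

lemma theta_add_period (w : ℂ) : theta m (w + m) = -cexp (w + m / 2) * theta m w := by
  have h1 := halfProd_eq_mul hm (w + m)
  have h2 := halfProd_eq_mul hm (-w - m)
  rw [add_sub_cancel_right] at h1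
  rw [theta, theta, h1, h2, show -(w + m) - m = -w - m - (m : ℂ) by ring,
    show (w + m / 2 : ℂ) = (w + m) + -(m / 2) by ring, Complex.exp_add (w + m),
    show -(w + m : ℂ) / 2 = -w / 2 + -(m / 2) by ring, Complex.exp_add (-w / 2),
    show -w - m = -(w + m : ℂ) by ring, Complex.exp_neg (w + m)]
  field_simp [Complex.exp_ne_zero]
  ring

omit hm in
lemma mem_periods_lattice (hm : 0 < m) {w : ℂ} :
    w ∈ (periods m hm).lattice ↔ ∃ j k : ℤ, w = j * m + k * (2 * Real.pi * I) := by
  rw [PeriodPair.mem_lattice]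
  simp only [periods, eq_comm]

lemma theta_eq_zero_iff {w : ℂ} : theta m w = 0 ↔ w ∈ (periods m hm).lattice := by
  rw [mem_periods_lattice]
  constructor
  · intro h
    rcases mul_eq_zero.mp h with h | h
    · rcases mul_eq_zero.mp h with h | h
      · exact absurd h (Complex.exp_ne_zero _)
      · obtain ⟨n, k, h⟩ := (halfProd_eq_zero_iff hm _).mp h
        exact ⟨n, k, by simpa using h⟩
    · obtain ⟨n, k, h⟩ := (halfProd_eq_zero_iff hm _).mp h
      refine ⟨-(n + 1), -k, ?_⟩
      push_cast
      linear_combination -h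
  · rintro ⟨j, k, rfl⟩
    rcases le_or_gt 0 j with hj | hj
    · lift j to ℕ using hj
      rw [theta, (halfProd_eq_zero_iff hm _).mpr ⟨j, k, by push_cast; rfl⟩]
      simp
    · obtain ⟨n, rfl⟩ : ∃ n : ℕ, j = -(n + 1) := ⟨(-j - 1).toNat, by omega⟩
      rw [theta, (halfProd_eq_zero_iff hm (-_ - _)).mpr ⟨n, -k, by push_cast; ring⟩]
      simp

/-- Only the first factor in `theta_eq` vanishes at `0`, with derivative `-1`; the others equal
`halfProd m (-m)`, and zeros of `halfProd` have nonnegative real part. -/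
lemma deriv_theta_zero_ne : deriv (theta m) 0 ≠ 0 := by
  have hd := differentiable_halfProd hm
  have h1 : HasDerivAt (fun w : ℂ => (cexp (-w / 2) - cexp (w / 2))) (-1) 0 := by
    have h1 : HasDerivAt (fun w : ℂ => cexp (-w / 2)) (cexp (-0 / 2) * (-1 / 2)) 0 :=
      (((hasDerivAt_id (0 : ℂ)).neg).div_const 2).cexp
    have h2 : HasDerivAt (fun w : ℂ => cexp (w / 2)) (cexp (0 / 2) * (1 / 2)) 0 :=
      (((hasDerivAt_id (0 : ℂ))).div_const 2).cexp
    have h3 := h1.sub h2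
    have h4 : cexp (-0 / 2) * (-1 / 2) - cexp (0 / 2) * (1 / 2) = -1 := by norm_num
    rw [h4] at h3
    exact h3
  have h2 : DifferentiableAt ℂ (fun w => halfProd m (w - m) * halfProd m (-w - m)) 0 := by
    fun_prop
  have h3 := h1.mul h2.hasDerivAt
  have h4 : theta m =
      (fun w : ℂ => (cexp (-w / 2) - cexp (w / 2))) *
        fun w => halfProd m (w - m) * halfProd m (-w - m) := by
    ext w
    simp [theta_eq hm, mul_assoc]
  rw [h4, h3.deriv]
  have h5 : halfProd m (-m : ℂ) ≠ 0 := by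
    intro h
    obtain ⟨n, k, h⟩ := (halfProd_eq_zero_iff hm _).mp h
    have := congrArg Complex.re h
    simp at this
    nlinarith [(Nat.cast_nonneg n : (0 : ℝ) ≤ n)]
  simpa using h5

/-- Only the shape of the multiplier matters: since its exponent is affine in `w`, the logarithmic
derivative changes by a constant. -/
lemma theta_add_lattice_eq {l : ℂ} (hl : l ∈ (periods m hm).lattice) :
    ∃ a b : ℂ, ∀ w, theta m (w + l) = cexp (a * w + b) * theta m w := by
  -- Signs are written as `cexp c`, so that all multipliers merge into one exponential.
  have hneg : ∃ c, cexp c = -1 := ⟨_, Complex.exp_pi_mul_I⟩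
  obtain ⟨c, hc⟩ := hneg
  obtain ⟨j, k, rfl⟩ := (mem_periods_lattice hm).mp hl
  have h1 : ∃ a b : ℂ, ∀ w, theta m (w + j * m) = cexp (a * w + b) * theta m w := by
    induction j using Int.induction_on with
    | zero => exact ⟨0, 0, by simp⟩
    | succ j ih =>
      obtain ⟨a, b, h⟩ := ih (by
        rw [mem_periods_lattice]; exact ⟨_, _, rfl⟩)
      refine ⟨a + 1, b + j * m + m / 2 + c, fun w => ?_⟩
      rw [show w + ((j + 1 : ℤ) : ℂ) * m = (w + ((j : ℤ) : ℂ) * m) + m by push_cast; ring,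
        theta_add_period hm, h, ← mul_assoc, ← neg_one_mul (cexp _), ← hc, ← Complex.exp_add,
        ← Complex.exp_add]
      push_cast
      ring_nf
    | pred j ih =>
      obtain ⟨a, b, h⟩ := ih (by
        rw [mem_periods_lattice]; exact ⟨_, _, rfl⟩)
      refine ⟨a - 1, b - (- j * m - m + m / 2) - c, fun w => ?_⟩
      have := theta_add_period hm (w + ((-j - 1 : ℤ) : ℂ) * m)
      rw [show w + ((-j - 1 : ℤ) : ℂ) * m + m = w + ((-j : ℤ) : ℂ) * m by push_cast; ring, h,
        ← neg_one_mul (cexp (_ + m / 2 : ℂ)), ← hc, ← Complex.exp_add] at this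
      have h2 : theta m (w + ((-j - 1 : ℤ) : ℂ) * m) =
        cexp (-(c + (w + ((-j - 1 : ℤ) : ℂ) * m + m / 2))) * (cexp (a * w + b) * theta m w) := by
        rw [this, ← mul_assoc, ← Complex.exp_add, neg_add_cancel, Complex.exp_zero, one_mul]
      rw [h2, ← mul_assoc, ← Complex.exp_add]
      push_cast
      ring_nf
  have h2 : ∃ b : ℂ, ∀ w, theta m (w + k * (2 * Real.pi * I)) = cexp b * theta m w := by
    induction k using Int.induction_on with
    | zero => exact ⟨0, by simp⟩
    | succ k ih =>
      obtain ⟨b, h⟩ := ih (by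
        rw [mem_periods_lattice]; exact ⟨_, _, rfl⟩)
      refine ⟨b + c, fun w => ?_⟩
      rw [show w + ((k + 1 : ℤ) : ℂ) * (2 * Real.pi * I) =
        (w + ((k : ℤ) : ℂ) * (2 * Real.pi * I)) + 2 * Real.pi * I by push_cast; ring,
        theta_add_two_pi, h, Complex.exp_add, hc]
      ring
    | pred k ih =>
      obtain ⟨b, h⟩ := ih (by
        rw [mem_periods_lattice]; exact ⟨_, _, rfl⟩)
      refine ⟨b + c, fun w => ?_⟩
      have := theta_add_two_pi (m := m) (w + ((-k - 1 : ℤ) : ℂ) * (2 * Real.pi * I))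
      rw [show w + ((-k - 1 : ℤ) : ℂ) * (2 * Real.pi * I) + 2 * Real.pi * I
        = w + ((-k : ℤ) : ℂ) * (2 * Real.pi * I) by push_cast; ring, h] at this
      rw [Complex.exp_add, hc]
      linear_combination this
  obtain ⟨a, b, h1⟩ := h1
  obtain ⟨b', h2⟩ := h2
  refine ⟨a, b + b', fun w => ?_⟩
  rw [← add_assoc, h2, h1, ← mul_assoc, ← Complex.exp_add]
  ring_nf

end

/-! ### Doubly periodic functions without poles -/

/-- `f` agrees near `z`, but not necessarily at `z`, with a function that is analytic at `z`. -/
def RemovableAt (f : ℂ → ℂ) (z : ℂ) : Prop := ∃ g, AnalyticAt ℂ g z ∧ f =ᶠ[𝓝[≠] z] g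

lemma _root_.AnalyticAt.removableAt {f : ℂ → ℂ} {z : ℂ} (h : AnalyticAt ℂ f z) :
    RemovableAt f z := ⟨f, h, EventuallyEq.rfl⟩

lemma tendsto_add_const_nhdsNE (z l : ℂ) : Tendsto (fun w => w + l) (𝓝[≠] z) (𝓝[≠] (z + l)) := by
  refine tendsto_nhdsWithin_of_tendsto_nhds_of_eventually_within _ ?_ ?_
  · exact ((continuous_id.add continuous_const).tendsto z).mono_left nhdsWithin_le_nhds
  · filter_upwards [self_mem_nhdsWithin] with w hw
    simpa using hw

lemma RemovableAt.translate {f : ℂ → ℂ} {z l : ℂ} (h : RemovableAt f z)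
    (hl : ∀ᶠ w in 𝓝[≠] z, f (w + l) = f w) : RemovableAt f (z + l) := by
  obtain ⟨g, hg, hfg⟩ := h
  refine ⟨fun w => g (w - l), ?_, ?_⟩
  · have : AnalyticAt ℂ (fun w : ℂ => w - l) (z + l) := by fun_prop
    exact AnalyticAt.fun_comp (by simpa using hg) this
  · have ht := tendsto_add_const_nhdsNE (z + l) (-l)
    rw [add_neg_cancel_right] at ht
    filter_upwards [ht.eventually hl, ht.eventually hfg] with w h1 h2
    rw [← sub_eq_add_neg, sub_add_cancel] at h1
    rw [h1, ← sub_eq_add_neg] at *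
    exact h2

/-- Liouville on the torus: the punctured limits of `f` form an entire lattice-periodic function,
which is bounded and hence constant. Values of `f` at isolated points play no role, so the arbitrary
values of elliptic functions at their poles do no harm. -/
lemma eq_const_of_periodic_of_removable (L : PeriodPair) {f : ℂ → ℂ}
    (hper : ∀ l ∈ L.lattice, ∀ z, ∀ᶠ w in 𝓝[≠] z, f (w + l) = f w)
    (hrem : ∀ z, RemovableAt f z) : ∃ C, ∀ z, ContinuousAt f z → f z = C := by
  choose g hg hfg using hrem
  set F : ℂ → ℂ := fun z => g z z
  have hlim : ∀ z, Tendsto f (𝓝[≠] z) (𝓝 (F z)) := fun z =>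
    ((hg z).continuousAt.tendsto.mono_left nhdsWithin_le_nhds).congr' (hfg z).symm
  have hF : ∀ z, F =ᶠ[𝓝 z] g z := by
    intro z
    have h1 : ∀ᶠ w in 𝓝[≠] z, F w = g z w := by
      filter_upwards [eventually_eventually_nhdsWithin.mpr (hfg z), self_mem_nhdsWithin,
        ((hg z).eventually_analyticAt.filter_mono nhdsWithin_le_nhds)] with w hw hne han
      have hfw : f =ᶠ[𝓝 w] g z := by
        rwa [IsOpen.nhdsWithin_eq isOpen_compl_singleton hne] at hw
      have h2 : Tendsto f (𝓝[≠] w) (𝓝 (g z w)) :=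
        (han.continuousAt.tendsto.congr' hfw.symm).mono_left nhdsWithin_le_nhds
      exact tendsto_nhds_unique (hlim w) h2
    rw [eventually_nhdsWithin_iff] at h1
    filter_upwards [h1] with w hw
    by_cases h : w = z
    · rw [h]
    · exact hw h
  have hFd : Differentiable ℂ F := fun z =>
    ((hg z).differentiableAt).congr_of_eventuallyEq (hF z)
  have hFper : ∀ z l, l ∈ L.lattice → F (z + l) = F z := by
    intro z l hl
    have h1 := (hlim (z + l)).comp (tendsto_add_const_nhdsNE z l)
    exact tendsto_nhds_unique (h1.congr' (hper l hl z)) (hlim z)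
  have hb := (IsZLattice.isCompact_range_of_periodic L.lattice F hFd.continuous hFper).isBounded
  refine ⟨F 0, fun z hz => ?_⟩
  rw [hFd.apply_eq_apply_of_bounded hb 0 z]
  exact tendsto_nhds_unique (hz.tendsto.mono_left nhdsWithin_le_nhds) (hlim z)

lemma analyticAt_dslope {f : ℂ → ℂ} {z : ℂ} (hf : AnalyticAt ℂ f z) :
    AnalyticAt ℂ (dslope f z) z := by
  obtain ⟨p, hp⟩ := hf
  exact ⟨_, hp.has_fpower_series_dslope_fslope⟩

lemma removableAt_div_sub {f g : ℂ → ℂ} {z : ℂ} (hf : AnalyticAt ℂ f z) (h0 : f z = 0)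
    (hfg : ∀ᶠ w in 𝓝[≠] z, g w = f w / (w - z)) : RemovableAt g z := by
  refine ⟨dslope f z, analyticAt_dslope hf, ?_⟩
  filter_upwards [hfg, self_mem_nhdsWithin] with w hw hne
  rw [hw, dslope_of_ne _ hne, slope_def_field, h0, sub_zero]

lemma isOpen_notMem_lattice (L : PeriodPair) : IsOpen {z : ℂ | z ∉ L.lattice} :=
  L.isClosed_lattice.isOpen_compl

lemma eventually_notMem_lattice (L : PeriodPair) (z : ℂ) : ∀ᶠ w in 𝓝[≠] z, w ∉ L.lattice := by
  have := L.compl_lattice_sdiff_singleton_mem_nhds z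
  filter_upwards [mem_nhdsWithin_of_mem_nhds this, self_mem_nhdsWithin] with w hw hne h
  exact hw ⟨h, hne⟩

/-! ### The Kronecker function -/

section
variable {m : ℝ} (hm : 0 < m)

/-- The Kronecker function with parameter `s`. -/
def kron (m : ℝ) (s u : ℂ) : ℂ :=
  cexp (u / 2) * theta m (u + s) * deriv (theta m) 0 / (theta m u * theta m s)

/-- The logarithmic derivative of the theta function. -/
def zetaFn (m : ℝ) (u : ℂ) : ℂ := deriv (theta m) u / theta m u

/-- The theta quotient is invariant; the sign comes from `cexp (u / 2)`. -/
lemma kron_add_two_pi (s u : ℂ) : kron m s (u + 2 * Real.pi * I) = -kron m s u := by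
  rw [kron, kron, theta_add_two_pi,
    show u + 2 * Real.pi * I + s = u + s + 2 * Real.pi * I by ring, theta_add_two_pi,
    show (u + 2 * Real.pi * I) / 2 = u / 2 + Real.pi * I by ring, Complex.exp_add,
    Complex.exp_pi_mul_I, neg_mul, div_neg]
  ring

include hm

/-- The theta quotient contributes `e^s` and the exponential `e^{m/2}`, so `s` tunes the multiplier
along `m`. -/
lemma kron_add_period (s u : ℂ) : kron m s (u + m) = cexp (m / 2 + s) * kron m s u := by
  have h : cexp (m / 2 + s) * cexp (u + m / 2) = cexp (m / 2) * cexp (u + s + m / 2) := by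
    rw [← Complex.exp_add, ← Complex.exp_add]
    ring_nf
  rw [kron, kron, theta_add_period hm, show u + m + s = u + s + (m : ℂ) by ring,
    theta_add_period hm, show (u + m : ℂ) / 2 = u / 2 + m / 2 by ring, Complex.exp_add (u / 2)]
  have h1 := Complex.exp_ne_zero (u + m / 2)
  rw [show -cexp (u + m / 2) * theta m u * theta m s =
    (-cexp (u + m / 2)) * (theta m u * theta m s) by ring, ← mul_div_assoc,
    div_mul_eq_div_div]
  congr 1
  rw [div_eq_iff (neg_ne_zero.mpr h1)]
  linear_combination (cexp (u / 2) * theta m (u + s) * deriv (theta m) 0) * h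

lemma zetaFn_add_lattice {l : ℂ} (hl : l ∈ (periods m hm).lattice) :
    ∃ a, ∀ u, theta m u ≠ 0 → zetaFn m (u + l) = a + zetaFn m u := by
  obtain ⟨a, b, h⟩ := theta_add_lattice_eq hm hl
  refine ⟨a, fun u hu => ?_⟩
  have h1 : HasDerivAt (fun v => theta m (v + l)) (deriv (theta m) (u + l)) u :=
    HasDerivAt.comp_add_const u l (differentiable_theta hm _).hasDerivAt
  have h2 : HasDerivAt (fun v => cexp (a * v + b) * theta m v)
    (cexp (a * u + b) * (a * 1) * theta m u + cexp (a * u + b) * deriv (theta m) u) u :=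
    ((((hasDerivAt_id u).const_mul a).add_const b).cexp).mul
      (differentiable_theta hm u).hasDerivAt
  simp only [h] at h1
  rw [zetaFn, zetaFn, h1.unique h2, h]
  have := Complex.exp_ne_zero (a * u + b)
  field_simp

/-- The theta multiplier along `2πi` is the constant `-1`, so there is no additive term. This
cancels the boundary terms at the top when the Green's function part of `𝒜₂` is integrated. -/
lemma zetaFn_add_two_pi (u : ℂ) : zetaFn m (u + 2 * Real.pi * I) = zetaFn m u := by
  have h1 : HasDerivAt (fun v => theta m (v + 2 * Real.pi * I))
      (deriv (theta m) (u + 2 * Real.pi * I)) u :=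
    HasDerivAt.comp_add_const u _ (differentiable_theta hm _).hasDerivAt
  simp only [theta_add_two_pi] at h1
  rw [zetaFn, zetaFn, theta_add_two_pi, h1.unique (differentiable_theta hm u).hasDerivAt.neg,
    neg_div_neg_eq]

lemma analyticAt_theta (u : ℂ) : AnalyticAt ℂ (theta m) u :=
  (differentiable_theta hm).analyticAt u

lemma analyticAt_zetaFn {u : ℂ} (hu : theta m u ≠ 0) : AnalyticAt ℂ (zetaFn m) u :=
  (analyticAt_theta hm u).deriv.div (analyticAt_theta hm u) hu

lemma theta_eq_mul_dslope (u : ℂ) : theta m u = u * dslope (theta m) 0 u := by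
  have := sub_smul_dslope (theta m) 0 u
  rw [theta_zero hm, sub_zero, sub_zero, smul_eq_mul] at this
  exact this.symm

lemma theta_ne_zero {u : ℂ} (hu : u ∉ (periods m hm).lattice) : theta m u ≠ 0 :=
  fun h => hu ((theta_eq_zero_iff hm).mp h)

lemma analyticAt_kron (s : ℂ) {u : ℂ} (hs : theta m s ≠ 0) (hu : theta m u ≠ 0) :
    AnalyticAt ℂ (kron m s) u := by
  have h1 : AnalyticAt ℂ (fun u => theta m (u + s)) u :=
    (analyticAt_theta hm _).fun_comp (by fun_prop)
  have h2 := analyticAt_theta hm u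
  unfold kron
  exact ((AnalyticAt.mul (by fun_prop) h1).mul analyticAt_const).div (h2.mul analyticAt_const)
    (mul_ne_zero hu hs)

/-- Near zero the Kronecker function is `A(u)/u` with `A` analytic and `A(0) = 1`. -/
lemma exists_kron_eq_div (s : ℂ) (hs : theta m s ≠ 0) :
    ∃ A : ℂ → ℂ, AnalyticAt ℂ A 0 ∧ A 0 = 1 ∧ ∀ u, u ≠ 0 → kron m s u = A u / u := by
  refine ⟨fun u => cexp (u / 2) * theta m (u + s) * deriv (theta m) 0 /
    (dslope (theta m) 0 u * theta m s), ?_, ?_, fun u hu => ?_⟩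
  · have h1 : AnalyticAt ℂ (fun u => theta m (u + s)) 0 :=
      (analyticAt_theta hm _).fun_comp (by fun_prop)
    have h2 := analyticAt_dslope (analyticAt_theta hm 0)
    refine ((AnalyticAt.mul (by fun_prop) h1).mul analyticAt_const).div (h2.mul analyticAt_const)
      (mul_ne_zero ?_ hs)
    rw [dslope_same]
    exact deriv_theta_zero_ne hm
  · have := deriv_theta_zero_ne hm
    simp only [dslope_same]
    rw [zero_add, zero_div, Complex.exp_zero]
    field_simp
  · rw [kron, theta_eq_mul_dslope hm u]
    field_simp

end

/-! ### Product identities for the Kronecker function. -/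

section
variable {m : ℝ} (hm : 0 < m)

lemma RemovableAt.comp_const_sub {f : ℂ → ℂ} {z : ℂ} (a : ℂ) (h : RemovableAt f z) :
    RemovableAt (fun w => f (a - w)) (a - z) := by
  obtain ⟨g, hg, hfg⟩ := h
  refine ⟨fun w => g (a - w), ?_, ?_⟩
  · have : AnalyticAt ℂ (fun w : ℂ => a - w) (a - z) := by fun_prop
    exact AnalyticAt.fun_comp (by simpa using hg) this
  · have ht : Tendsto (fun w => a - w) (𝓝[≠] (a - z)) (𝓝[≠] z) := by
      refine tendsto_nhdsWithin_of_tendsto_nhds_of_eventually_within _ ?_ ?_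
      · have : Tendsto (fun w => a - w) (𝓝 (a - z)) (𝓝 (a - (a - z))) :=
          (continuous_const.sub continuous_id).tendsto _
        rw [sub_sub_cancel] at this
        exact this.mono_left nhdsWithin_le_nhds
      · filter_upwards [self_mem_nhdsWithin] with w hw h
        apply hw
        rw [mem_singleton_iff] at h ⊢
        rw [← h]
        ring
    exact ht.eventually hfg

include hm

lemma periodic_lattice_of_generators {f : ℂ → ℂ} (h1 : ∀ u, f (u + m) = f u)
    (h2 : ∀ u, f (u + 2 * Real.pi * I) = f u) {l : ℂ} (hl : l ∈ (periods m hm).lattice) (u : ℂ) :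
    f (u + l) = f u := by
  obtain ⟨j, k, rfl⟩ := (mem_periods_lattice hm).mp hl
  have p1 : Function.Periodic f (m : ℂ) := h1
  have p2 : Function.Periodic f (2 * Real.pi * I : ℂ) := h2
  rw [← add_assoc, p2.int_mul k, p1.int_mul j]

omit hm in
lemma kron_sub_two_pi (s u : ℂ) : kron m s (u - 2 * Real.pi * I) = -kron m s u := by
  have := kron_add_two_pi (m := m) s (u - 2 * Real.pi * I)
  rw [sub_add_cancel] at this
  rw [this, neg_neg]

lemma kron_sub_period (s u : ℂ) : cexp (m / 2 + s) * kron m s (u - m) = kron m s u := by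
  have := kron_add_period hm s (u - m)
  rwa [sub_add_cancel, eq_comm] at this

lemma kron_neg_self (s : ℂ) : kron m s (-s) = 0 := by
  rw [kron, neg_add_cancel, theta_zero hm]
  simp

lemma weierstrassP_add_lattice {l : ℂ} (hl : l ∈ (periods m hm).lattice) (u : ℂ) :
    (periods m hm).weierstrassP (u + l) = (periods m hm).weierstrassP u :=
  (periods m hm).weierstrassP_add_coe u ⟨l, hl⟩

lemma weierstrassP_eq_near_zero {u : ℂ} :
    (periods m hm).weierstrassP u =
      (periods m hm).weierstrassPExcept 0 u + 1 / u ^ 2 := by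
  have := (periods m hm).weierstrassPExcept_def ⟨0, zero_mem _⟩ u
  simp only at this
  rw [this]
  simp

lemma analyticAt_weierstrassP {u : ℂ} (hu : u ∉ (periods m hm).lattice) :
    AnalyticAt ℂ (periods m hm).weierstrassP u :=
  (periods m hm).analyticOnNhd_weierstrassP _ hu

lemma neg_notMem {u : ℂ} (hu : u ∉ (periods m hm).lattice) : -u ∉ (periods m hm).lattice := by
  simpa using hu

/-- The multipliers at `u` and `-u` are inverse to each other, so the product is elliptic. It is
even with principal part `-1/u²`, hence its sum with `℘(u)` is constant; the value is read off at `u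
= s`, where `kron m s (-s) = 0`. -/
lemma kron_mul_kron_neg {s u : ℂ} (hs : s ∉ (periods m hm).lattice)
    (hu : u ∉ (periods m hm).lattice) :
    kron m s u * kron m s (-u) =
      (periods m hm).weierstrassP s - (periods m hm).weierstrassP u := by
  have hs' := theta_ne_zero hm hs
  set f : ℂ → ℂ := fun u => kron m s u * kron m s (-u) + (periods m hm).weierstrassP u with hf
  have han : ∀ u, u ∉ (periods m hm).lattice → AnalyticAt ℂ f u := by
    intro u hu
    have h1 := analyticAt_kron hm s hs' (theta_ne_zero hm hu)
    have h2 := analyticAt_kron hm s hs' (theta_ne_zero hm (neg_notMem hm hu))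
    have h3 : AnalyticAt ℂ (fun u => kron m s (-u)) u := h2.fun_comp (by fun_prop)
    exact (h1.mul h3).add (analyticAt_weierstrassP hm hu)
  have hper : ∀ l ∈ (periods m hm).lattice, ∀ z, f (z + l) = f z := by
    intro l hl z
    refine periodic_lattice_of_generators hm (fun u => ?_) (fun u => ?_) hl z
    · simp only [hf]
      rw [weierstrassP_add_lattice hm (mem_periods_lattice hm |>.mpr ⟨1, 0, by simp⟩),
        kron_add_period hm, ← kron_sub_period hm s (-u), neg_add, ← sub_eq_add_neg]
      ring
    · simp only [hf]
      rw [weierstrassP_add_lattice hm (mem_periods_lattice hm |>.mpr ⟨0, 1, by simp⟩),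
        kron_add_two_pi, neg_add, ← sub_eq_add_neg, kron_sub_two_pi]
      ring
  have hrem0 : RemovableAt f 0 := by
    obtain ⟨A, hA, hA0, hAu⟩ := exists_kron_eq_div hm s hs'
    set N : ℂ → ℂ := fun u => 1 - A u * A (-u) with hN
    have hAn : AnalyticAt ℂ (fun u => A (-u)) 0 :=
      AnalyticAt.fun_comp (by simpa using hA) (by fun_prop)
    have hNa : AnalyticAt ℂ N 0 := analyticAt_const.sub (hA.mul hAn)
    have hN0 : N 0 = 0 := by simp [hN, hA0]
    -- `N` is even, so after division by `u²` no simple pole remains.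
    have hNd : deriv N 0 = 0 := by
      have h1 : (fun u => N (-u)) = N := by
        funext u
        simp only [hN, neg_neg]
        ring
      have h2 := deriv_comp_neg N 0
      rw [h1, neg_zero] at h2
      linear_combination h2 / 2
    have h1 := analyticAt_dslope hNa
    have h2 := analyticAt_dslope h1
    have h3 : AnalyticAt ℂ ((periods m hm).weierstrassPExcept 0) 0 :=
      (periods m hm).analyticAt_weierstrassPExcept 0
    refine ⟨_, h2.add h3, ?_⟩
    filter_upwards [self_mem_nhdsWithin] with u hu
    have hu0 : u ≠ 0 := hu
    simp only [hf, Pi.add_apply]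
    rw [dslope_of_ne _ hu0, slope_def_field, dslope_same, hNd, dslope_of_ne _ hu0,
      slope_def_field, hN0, hAu u hu0, hAu (-u) (neg_ne_zero.mpr hu0),
      weierstrassP_eq_near_zero hm]
    simp only [hN]
    field_simp
    ring
  have hrem : ∀ z, RemovableAt f z := by
    intro z
    by_cases hz : z ∈ (periods m hm).lattice
    · have := hrem0.translate (l := z) (.of_forall fun w => hper z hz w)
      rwa [zero_add] at this
    · exact (han z hz).removableAt
  obtain ⟨C, hC⟩ := eq_const_of_periodic_of_removable (periods m hm)
    (fun l hl z => .of_forall fun w => hper l hl w) hrem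
  have h1 := hC u (han u hu).continuousAt
  have h2 := hC s (han s hs).continuousAt
  simp only [hf] at h1 h2
  rw [kron_neg_self hm, mul_zero, zero_add] at h2
  rw [h2, ← h1]
  ring

/-- Differentiate the product formula in `u` at `u = s`: one factor vanishes there, so a single term
survives. -/
lemma derivWeierstrassP_eq_kron {s : ℂ} (hs : s ∉ (periods m hm).lattice) :
    (periods m hm).derivWeierstrassP s = kron m s s * deriv (kron m s) (-s) := by
  have hs' := theta_ne_zero hm hs
  have h1 := (analyticAt_kron hm s hs' hs').differentiableAt.hasDerivAt
  have h2 := (analyticAt_kron hm s hs'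
    (theta_ne_zero hm (neg_notMem hm hs))).differentiableAt.hasDerivAt
  have h3 : HasDerivAt (fun u => kron m s (-u)) (deriv (kron m s) (-s) * -1) s :=
    h2.comp s (hasDerivAt_neg s)
  have h4 := (h1.mul h3).const_sub ((periods m hm).weierstrassP s)
  have h5 : (periods m hm).weierstrassP =ᶠ[𝓝 s]
      fun u => (periods m hm).weierstrassP s - (kron m s * fun u => kron m s (-u)) u := by
    filter_upwards [(isOpen_notMem_lattice (periods m hm)).mem_nhds hs] with u hu
    simp only [Pi.mul_apply]
    rw [kron_mul_kron_neg hm hs hu]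
    ring
  rw [← PeriodPair.deriv_weierstrassP, h5.deriv_eq, h4.deriv, kron_neg_self hm]
  ring

/-- In each product the arguments sum to zero, so both are elliptic in `x`, and the poles at `0` and
`-y` cancel between them. The sum is therefore constant in `x`, and by symmetry in `y`; the constant
is found by moving `y` to `-s` and letting `x` tend to `0`. -/
lemma kron_triple {s x y : ℂ} (hs : s ∉ (periods m hm).lattice)
    (hx : x ∉ (periods m hm).lattice) (hy : y ∉ (periods m hm).lattice)
    (hxy : x + y ∉ (periods m hm).lattice) :
    kron m s x * kron m s y * kron m s (-x - y) + kron m s (-x) * kron m s (-y) * kron m s (x + y)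
      = -(periods m hm).derivWeierstrassP s := by
  have hs' := theta_ne_zero hm hs
  have hk : ∀ u, u ∉ (periods m hm).lattice → AnalyticAt ℂ (kron m s) u := fun u hu =>
    analyticAt_kron hm s hs' (theta_ne_zero hm hu)
  set T : ℂ → ℂ → ℂ := fun y x => kron m s x * kron m s y * kron m s (-x - y) +
    kron m s (-x) * kron m s (-y) * kron m s (x + y) with hT
  have han : ∀ y, ∀ x, x ∉ (periods m hm).lattice → x + y ∉ (periods m hm).lattice →
      AnalyticAt ℂ (T y) x := by
    intro y x hx hxy
    have h1 := hk x hx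
    have h2 : AnalyticAt ℂ (fun x => kron m s (-x)) x := (hk _ (neg_notMem hm hx)).fun_comp
      (by fun_prop)
    have h3 : AnalyticAt ℂ (fun x => kron m s (x + y)) x :=
      AnalyticAt.fun_comp (g := kron m s) (f := fun x => x + y) (hk _ hxy) (by fun_prop)
    have h4 : AnalyticAt ℂ (fun x => kron m s (-x - y)) x :=
      AnalyticAt.fun_comp (hk _ (by rw [← neg_add']; exact neg_notMem hm hxy)) (by fun_prop)
    exact ((h1.mul analyticAt_const).mul h4).add ((h2.mul analyticAt_const).mul h3)
  have hconst : ∀ y, y ∉ (periods m hm).lattice → ∃ C, ∀ x, x ∉ (periods m hm).lattice →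
      x + y ∉ (periods m hm).lattice → T y x = C := by
    intro y hy
    have hper : ∀ l ∈ (periods m hm).lattice, ∀ z, T y (z + l) = T y z := by
      intro l hl z
      refine periodic_lattice_of_generators hm (fun u => ?_) (fun u => ?_) hl z
      · simp only [hT]
        have e1 := kron_sub_period hm s (-u)
        have e2 := kron_sub_period hm s (-u - y)
        rw [kron_add_period hm, show u + m + y = u + y + m by ring, kron_add_period hm,
          show -(u + m) = -u - (m : ℂ) by ring, show -u - m - y = -u - y - (m : ℂ) by ring,
          ← e1, ← e2]
        ring
      · simp only [hT]
        rw [kron_add_two_pi, show u + 2 * Real.pi * I + y = u + y + 2 * Real.pi * I by ring,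
          kron_add_two_pi, show -(u + 2 * Real.pi * I) = -u - 2 * Real.pi * I by ring,
          show -u - 2 * Real.pi * I - y = -u - y - 2 * Real.pi * I by ring,
          kron_sub_two_pi, kron_sub_two_pi]
        ring
    have hrem0 : RemovableAt (T y) 0 := by
      obtain ⟨A, hA, hA0, hAu⟩ := exists_kron_eq_div hm s hs'
      have hAn : AnalyticAt ℂ (fun u => A (-u)) 0 :=
        AnalyticAt.fun_comp (by simpa using hA) (by fun_prop)
      have h3 : AnalyticAt ℂ (fun x => kron m s (x + y)) 0 :=
        AnalyticAt.fun_comp (hk _ (by simpa using hy)) (by fun_prop)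
      have h4 : AnalyticAt ℂ (fun x => kron m s (-x - y)) 0 :=
        AnalyticAt.fun_comp (hk _ (by simpa using hy)) (by fun_prop)
      refine removableAt_div_sub
        (f := fun x => A x * kron m s y * kron m s (-x - y) -
          A (-x) * kron m s (-y) * kron m s (x + y))
        (((hA.mul analyticAt_const).mul h4).sub ((hAn.mul analyticAt_const).mul h3)) ?_ ?_
      · simp [hA0, mul_comm]
      · filter_upwards [self_mem_nhdsWithin] with u hu
        have hu0 : u ≠ 0 := hu
        simp only [hT]
        rw [hAu u hu0, hAu (-u) (neg_ne_zero.mpr hu0)]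
        field_simp
        ring
    -- The involution `x ↦ -y - x` fixes `T y` and carries the pole candidate `0` to `-y`.
    have hremy : RemovableAt (T y) (-y) := by
      have h := hrem0.comp_const_sub (-y)
      have he : (fun w => T y (-y - w)) = T y := by
        funext w
        simp only [hT]
        rw [show -(-y - w) - y = w by ring, show -y - w + y = -w by ring,
          show -(-y - w) = w + y by ring, show -w - y = -y - w by ring]
        ring
      rwa [he, sub_zero] at h
    have hrem : ∀ z, RemovableAt (T y) z := by
      intro z
      by_cases hz : z ∈ (periods m hm).lattice
      · have := hrem0.translate (l := z) (.of_forall fun w => hper z hz w)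
        rwa [zero_add] at this
      by_cases hzy : z + y ∈ (periods m hm).lattice
      · have := hremy.translate (l := z + y) (.of_forall fun w => hper _ hzy w)
        rwa [show -y + (z + y) = z by ring] at this
      · exact (han y z hz hzy).removableAt
    obtain ⟨C, hC⟩ := eq_const_of_periodic_of_removable (periods m hm)
      (fun l hl z => .of_forall fun w => hper l hl w) hrem
    exact ⟨C, fun x hx hxy => hC x (han y x hx hxy).continuousAt⟩
  have hsymm : ∀ x y, T y x = T x y := by
    intro x y
    simp only [hT]
    rw [show -x - y = -y - x by ring, add_comm x y]
    ring
  -- At second argument `-s` the first product vanishes, as `kron m s (-s) = 0`.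
  have hval : ∀ x, x ∉ (periods m hm).lattice → x - s ∉ (periods m hm).lattice →
      ∀ y, y ∉ (periods m hm).lattice → x + y ∉ (periods m hm).lattice →
      T x y = kron m s s * kron m s (-x) * kron m s (x - s) := by
    intro x hx hxs y hy hxy
    obtain ⟨C, hC⟩ := hconst x hx
    rw [hC y hy (by rwa [add_comm]), ← hC (-s) (neg_notMem hm hs) (by
      rwa [show -s + x = x - s by ring])]
    simp only [hT]
    rw [kron_neg_self hm, neg_neg, show -s + x = x - s by ring]
    ring
  obtain ⟨C, hC⟩ := hconst y hy
  have hev : ∀ᶠ v in 𝓝[≠] (0 : ℂ), kron m s s * kron m s (-v) * kron m s (v - s) = C := by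
    have e1 : ∀ᶠ v in 𝓝[≠] (0 : ℂ), v + y ∉ (periods m hm).lattice := by
      have : Tendsto (fun v : ℂ => v + y) (𝓝 0) (𝓝 (0 + y)) :=
        (continuous_id.add continuous_const).tendsto 0
      rw [zero_add] at this
      exact (this.eventually ((isOpen_notMem_lattice _).mem_nhds hy)).filter_mono
        nhdsWithin_le_nhds
    have e2 : ∀ᶠ v in 𝓝[≠] (0 : ℂ), v - s ∉ (periods m hm).lattice := by
      have : Tendsto (fun v : ℂ => v - s) (𝓝 0) (𝓝 (0 - s)) :=
        (continuous_id.sub continuous_const).tendsto 0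
      rw [zero_sub] at this
      exact (this.eventually ((isOpen_notMem_lattice _).mem_nhds
        (neg_notMem hm hs))).filter_mono nhdsWithin_le_nhds
    filter_upwards [e1, e2, eventually_notMem_lattice (periods m hm) 0] with v h1 h2 h3
    rw [← hval v h3 h2 y hy h1, ← hsymm, hC v h3 h1]
  -- The pole of `kron m s (-v)`, of residue `-1`, meets the zero of `kron m s (v - s)`; the limit
  -- is `-kron m s s * deriv (kron m s) (-s)`.
  have hlim : Tendsto (fun v => kron m s s * kron m s (-v) * kron m s (v - s)) (𝓝[≠] (0 : ℂ))
      (𝓝 (-(periods m hm).derivWeierstrassP s)) := by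
    obtain ⟨A, hA, hA0, hAu⟩ := exists_kron_eq_div hm s hs'
    have hAn : Tendsto (fun u => A (-u)) (𝓝[≠] (0 : ℂ)) (𝓝 1) := by
      have : ContinuousAt (fun u => A (-u)) 0 :=
        ContinuousAt.comp (by simpa using hA.continuousAt) continuous_neg.continuousAt
      have := this.tendsto.mono_left (nhdsWithin_le_nhds (s := {0}ᶜ))
      simpa [hA0] using this
    have hd : HasDerivAt (fun v => kron m s (v - s)) (deriv (kron m s) (-s)) 0 := by
      have := (hk (-s) (neg_notMem hm hs)).differentiableAt.hasDerivAt
      refine HasDerivAt.comp_sub_const (0 : ℂ) s ?_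
      rwa [zero_sub]
    have hsl := hasDerivAt_iff_tendsto_slope.mp hd
    have h1 := ((hAn.mul hsl).const_mul (-kron m s s))
    rw [derivWeierstrassP_eq_kron hm hs]
    rw [one_mul, neg_mul] at h1
    refine h1.congr' ?_
    filter_upwards [self_mem_nhdsWithin] with v hv
    have hv0 : v ≠ 0 := hv
    rw [slope_def_field, zero_sub, kron_neg_self hm, hAu (-v) (neg_ne_zero.mpr hv0)]
    field_simp
    ring
  have hC' := tendsto_nhds_unique (tendsto_const_nhds.congr' (EventuallyEq.symm hev)) hlim
  have := hC x hx hxy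
  simp only [hT] at this
  rw [this, hC']

/-! ### Half-periods and the cubic equation -/

/-- By the product formula the difference is a quotient of exponentials and theta values, none of
which vanishes. -/
lemma weierstrassP_ne {u s : ℂ} (hs : s ∉ (periods m hm).lattice)
    (hu : u ∉ (periods m hm).lattice) (h1 : u + s ∉ (periods m hm).lattice)
    (h2 : s - u ∉ (periods m hm).lattice) :
    (periods m hm).weierstrassP s ≠ (periods m hm).weierstrassP u := by
  rw [← sub_ne_zero, ← kron_mul_kron_neg hm hs hu]
  have hd := deriv_theta_zero_ne hm
  have t1 := theta_ne_zero hm h1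
  have t2 := theta_ne_zero hm h2
  have t3 := theta_ne_zero hm hs
  have t4 := theta_ne_zero hm hu
  have t5 := theta_ne_zero hm (neg_notMem hm hu)
  rw [kron, kron, neg_add_eq_sub]
  have := Complex.exp_ne_zero (u / 2)
  have := Complex.exp_ne_zero (-u / 2)
  positivity

/-- `℘'` is odd, and `h` and `-h` agree modulo the lattice. -/
lemma derivWeierstrassP_half {h : ℂ} (h2 : h + h ∈ (periods m hm).lattice) :
    (periods m hm).derivWeierstrassP h = 0 := by
  have h1 := (periods m hm).derivWeierstrassP_add_coe (-h) ⟨_, h2⟩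
  rw [show -h + ((⟨h + h, h2⟩ : (periods m hm).lattice) : ℂ) = h by simp,
    PeriodPair.derivWeierstrassP_neg] at h1
  linear_combination h1 / 2

lemma half_notMem {j k : ℤ} (h : ¬ (Even j ∧ Even k)) :
    (j * m + k * (2 * Real.pi * I)) / 2 ∉ (periods m hm).lattice := by
  rw [mem_periods_lattice]
  rintro ⟨a, b, hab⟩
  have h1 := congrArg Complex.re hab
  have h2 := congrArg Complex.im hab
  simp at h1 h2
  have hpi := Real.pi_pos
  have h3 : (j : ℝ) = 2 * a := by
    have : ((j : ℝ) - 2 * a) * m = 0 := by linarith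
    rcases mul_eq_zero.mp this with h | h
    · linarith
    · exact absurd h hm.ne'
  have h4 : (k : ℝ) = 2 * b := by
    have : ((k : ℝ) - 2 * b) * Real.pi = 0 := by linarith
    rcases mul_eq_zero.mp this with h | h
    · linarith
    · exact absurd h hpi.ne'
  exact h ⟨⟨a, by exact_mod_cast (by linarith : (j : ℝ) = a + a)⟩,
    ⟨b, by exact_mod_cast (by linarith : (k : ℝ) = b + b)⟩⟩

/-- The values of `℘` at the three half-periods are distinct roots of `4p³ - g₂p - g₃`, so Vieta's
formulas factor the cubic. -/
lemma derivWeierstrassP_sq_eq_prod {u : ℂ} (hu : u ∉ (periods m hm).lattice) :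
    (periods m hm).derivWeierstrassP u ^ 2 =
      4 * ((periods m hm).weierstrassP u - (periods m hm).weierstrassP ((m : ℂ) / 2)) *
      ((periods m hm).weierstrassP u - (periods m hm).weierstrassP (2 * (Real.pi : ℂ) * I / 2)) *
      ((periods m hm).weierstrassP u -
        (periods m hm).weierstrassP (((m : ℂ) + 2 * (Real.pi : ℂ) * I) / 2)) := by
  have a1 : (m : ℂ) / 2 ∉ (periods m hm).lattice := by
    simpa using half_notMem hm (j := 1) (k := 0) (by decide)
  have a2 : 2 * (Real.pi : ℂ) * I / 2 ∉ (periods m hm).lattice := by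
    simpa using half_notMem hm (j := 0) (k := 1) (by decide)
  have a3 : ((m : ℂ) + 2 * (Real.pi : ℂ) * I) / 2 ∉ (periods m hm).lattice := by
    simpa using half_notMem hm (j := 1) (k := 1) (by decide)
  have m1 : (m : ℂ) ∈ (periods m hm).lattice := (mem_periods_lattice hm).mpr ⟨1, 0, by simp⟩
  have m2 : 2 * (Real.pi : ℂ) * I ∈ (periods m hm).lattice :=
    (mem_periods_lattice hm).mpr ⟨0, 1, by simp⟩
  have n12 : (periods m hm).weierstrassP ((m : ℂ) / 2) ≠
      (periods m hm).weierstrassP (2 * (Real.pi : ℂ) * I / 2) := by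
    refine weierstrassP_ne hm a1 a2 ?_ ?_
    · rwa [show 2 * (Real.pi : ℂ) * I / 2 + m / 2 = (m + 2 * (Real.pi : ℂ) * I) / 2 by ring]
    · have := half_notMem hm (j := 1) (k := -1) (by decide)
      push_cast at this
      rwa [show (m : ℂ) / 2 - 2 * (Real.pi : ℂ) * I / 2 =
        (1 * m + -1 * (2 * (Real.pi : ℂ) * I)) / 2 by ring]
  have n13 : (periods m hm).weierstrassP ((m : ℂ) / 2) ≠
      (periods m hm).weierstrassP (((m : ℂ) + 2 * (Real.pi : ℂ) * I) / 2) := by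
    refine weierstrassP_ne hm a1 a3 ?_ ?_
    · have := half_notMem hm (j := 2) (k := 1) (by decide)
      push_cast at this
      rwa [show ((m : ℂ) + 2 * (Real.pi : ℂ) * I) / 2 + m / 2 =
        (2 * m + 1 * (2 * (Real.pi : ℂ) * I)) / 2 by ring]
    · have := half_notMem hm (j := 0) (k := -1) (by decide)
      push_cast at this
      rwa [show (m : ℂ) / 2 - ((m : ℂ) + 2 * (Real.pi : ℂ) * I) / 2 =
        (0 * m + -1 * (2 * (Real.pi : ℂ) * I)) / 2 by ring]
  have n23 : (periods m hm).weierstrassP (2 * (Real.pi : ℂ) * I / 2) ≠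
      (periods m hm).weierstrassP (((m : ℂ) + 2 * (Real.pi : ℂ) * I) / 2) := by
    refine weierstrassP_ne hm a2 a3 ?_ ?_
    · have := half_notMem hm (j := 1) (k := 2) (by decide)
      push_cast at this
      rwa [show ((m : ℂ) + 2 * (Real.pi : ℂ) * I) / 2 + 2 * (Real.pi : ℂ) * I / 2 =
        (1 * m + 2 * (2 * (Real.pi : ℂ) * I)) / 2 by ring]
    · have := half_notMem hm (j := -1) (k := 0) (by decide)
      push_cast at this
      rwa [show 2 * (Real.pi : ℂ) * I / 2 - ((m : ℂ) + 2 * (Real.pi : ℂ) * I) / 2 =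
        (-1 * m + 0 * (2 * (Real.pi : ℂ) * I)) / 2 by ring]
  have z1 := derivWeierstrassP_half hm (h := (m : ℂ) / 2) (by rwa [add_halves])
  have z2 := derivWeierstrassP_half hm (h := 2 * (Real.pi : ℂ) * I / 2) (by rwa [add_halves])
  have z3 := derivWeierstrassP_half hm (h := ((m : ℂ) + 2 * (Real.pi : ℂ) * I) / 2)
    (by rw [add_halves]; exact add_mem m1 m2)
  have q1 := (periods m hm).derivWeierstrassP_sq _ a1
  have q2 := (periods m hm).derivWeierstrassP_sq _ a2
  have q3 := (periods m hm).derivWeierstrassP_sq _ a3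
  have q := (periods m hm).derivWeierstrassP_sq _ hu
  rw [z1] at q1
  rw [z2] at q2
  rw [z3] at q3
  rw [q]
  generalize (periods m hm).weierstrassP ((m : ℂ) / 2) = e₁ at *
  generalize (periods m hm).weierstrassP (2 * (Real.pi : ℂ) * I / 2) = e₂ at *
  generalize (periods m hm).weierstrassP (((m : ℂ) + 2 * (Real.pi : ℂ) * I) / 2) = e₃ at *
  generalize (periods m hm).weierstrassP u = p at *
  generalize (periods m hm).g₂ = g at *
  generalize (periods m hm).g₃ = g' at *
  -- Subtract the equations of two roots and divide by the difference of the roots.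
  have r1 : 4 * (e₁ ^ 2 + e₁ * e₂ + e₂ ^ 2) = g := by
    refine mul_left_cancel₀ (sub_ne_zero.mpr n12) ?_
    linear_combination q2 - q1
  have r2 : 4 * (e₁ ^ 2 + e₁ * e₃ + e₃ ^ 2) = g := by
    refine mul_left_cancel₀ (sub_ne_zero.mpr n13) ?_
    linear_combination q3 - q1
  have r3 : e₁ + e₂ + e₃ = 0 := by
    refine mul_left_cancel₀ (sub_ne_zero.mpr n23) ?_
    linear_combination (r1 - r2) / 4
  have r4 : e₃ = -e₁ - e₂ := by linear_combination r3
  subst r4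
  linear_combination p * r1 - q1 - e₁ * r1

end

local notation "conj" => starRingEnd ℂ

section
variable {m : ℝ} (hm : 0 < m)
include hm

/-! ### Complex conjugation -/

lemma conj_mem_lattice {l : ℂ} (hl : l ∈ (periods m hm).lattice) :
    conj l ∈ (periods m hm).lattice := by
  obtain ⟨j, k, rfl⟩ := (mem_periods_lattice hm).mp hl
  refine (mem_periods_lattice hm).mpr ⟨j, -k, ?_⟩
  simp [map_ofNat]

/-- Complex conjugation on the lattice. -/
def latticeConj : (periods m hm).lattice ≃ (periods m hm).lattice where
  toFun l := ⟨conj (l : ℂ), conj_mem_lattice hm l.2⟩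
  invFun l := ⟨conj (l : ℂ), conj_mem_lattice hm l.2⟩
  left_inv l := by simp
  right_inv l := by simp

lemma weierstrassP_conj (u : ℂ) :
    (periods m hm).weierstrassP (conj u) = conj ((periods m hm).weierstrassP u) := by
  rw [PeriodPair.weierstrassP, PeriodPair.weierstrassP, Complex.conj_tsum,
    ← (latticeConj hm).tsum_eq]
  refine tsum_congr fun l => ?_
  simp [latticeConj]

lemma derivWeierstrassP_conj (u : ℂ) :
    (periods m hm).derivWeierstrassP (conj u) = conj ((periods m hm).derivWeierstrassP u) := by
  rw [PeriodPair.derivWeierstrassP, PeriodPair.derivWeierstrassP, map_neg, Complex.conj_tsum,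
    ← (latticeConj hm).tsum_eq]
  congr 1
  refine tsum_congr fun l => ?_
  simp [latticeConj, map_ofNat]

lemma deriv_theta_conj (u : ℂ) : deriv (theta m) (conj u) = conj (deriv (theta m) u) := by
  have h := ((differentiable_theta hm u).hasDerivAt).conj_conj
  have he : (⇑conj ∘ theta m ∘ ⇑conj) = theta m := by
    funext w
    simp [theta_conj hm]
  rw [he] at h
  exact h.deriv

lemma zetaFn_conj (u : ℂ) : zetaFn m (conj u) = conj (zetaFn m u) := by
  rw [zetaFn, zetaFn, deriv_theta_conj hm, theta_conj hm, map_div₀]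

lemma deriv_zetaFn_conj {u : ℂ} (hu : theta m u ≠ 0) :
    deriv (zetaFn m) (conj u) = conj (deriv (zetaFn m) u) := by
  have h := ((analyticAt_zetaFn hm hu).differentiableAt.hasDerivAt).conj_conj
  have he : (⇑conj ∘ zetaFn m ∘ ⇑conj) = zetaFn m := by
    funext w
    simp [zetaFn_conj hm]
  rw [he] at h
  exact h.deriv

/-- The parameter `x + πi` of the Kronecker function, whose multipliers are real. -/
lemma kron_conj (x : ℝ) (u : ℂ) :
    kron m (x + Real.pi * I) (conj u) = conj (kron m (x + Real.pi * I) u) := by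
  -- Conjugation turns `πi` into `-πi`; the shift by `2πi` costs one sign in the numerator and one
  -- in the denominator of `kron`.
  have h : ∀ v : ℂ, conj (theta m (v + (x + Real.pi * I))) =
      -theta m (conj v + (x + Real.pi * I)) := by
    intro v
    rw [← theta_conj hm, map_add, map_add, map_mul, Complex.conj_I, Complex.conj_ofReal,
      Complex.conj_ofReal, eq_comm, neg_eq_iff_eq_neg, ← theta_add_two_pi]
    congr 1
    ring
  have h0 := h 0
  rw [map_zero, zero_add] at h0
  rw [kron, kron, map_div₀, map_mul, map_mul, map_mul, h u, h0, theta_conj hm,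
    ← Complex.exp_conj, ← deriv_theta_conj hm]
  simp only [map_div₀, map_ofNat, map_zero]
  rw [mul_neg, mul_neg, neg_mul, neg_div_neg_eq]

/-! ### The constant of the Green's function -/

/-- `ζ` changes by constants along periods, so `ζ'` is elliptic; its double pole, from the simple
zero of theta, is opposite to that of `℘`. The constant is real by conjugation symmetry at the real
point `m/2`. -/
lemma exists_deriv_zetaFn_eq : ∃ c : ℝ, ∀ u, u ∉ (periods m hm).lattice →
    deriv (zetaFn m) u = -((periods m hm).weierstrassP u + c) := by
  set f : ℂ → ℂ := fun u => deriv (zetaFn m) u + (periods m hm).weierstrassP u with hf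
  have han : ∀ u, u ∉ (periods m hm).lattice → AnalyticAt ℂ f u := fun u hu =>
    (analyticAt_zetaFn hm (theta_ne_zero hm hu)).deriv.add (analyticAt_weierstrassP hm hu)
  have hper : ∀ l ∈ (periods m hm).lattice, ∀ z, ∀ᶠ w in 𝓝[≠] z, f (w + l) = f w := by
    intro l hl z
    obtain ⟨a, ha⟩ := zetaFn_add_lattice hm hl
    filter_upwards [eventually_notMem_lattice (periods m hm) z] with w hw
    simp only [hf]
    rw [weierstrassP_add_lattice hm hl]
    congr 1
    have h1 : (fun u => zetaFn m (u + l)) =ᶠ[𝓝 w] fun u => a + zetaFn m u := by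
      filter_upwards [(isOpen_notMem_lattice (periods m hm)).mem_nhds hw] with u hu
      exact ha u (theta_ne_zero hm hu)
    rw [← deriv_comp_add_const, h1.deriv_eq, deriv_const_add]
  have hrem0 : RemovableAt f 0 := by
    have h1 := analyticAt_dslope (analyticAt_theta hm 0)
    have hne : dslope (theta m) 0 0 ≠ 0 := by
      rw [dslope_same]
      exact deriv_theta_zero_ne hm
    have h2 := (h1.deriv.div h1 hne).deriv
    have h3 : AnalyticAt ℂ ((periods m hm).weierstrassPExcept 0) 0 :=
      (periods m hm).analyticAt_weierstrassPExcept 0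
    refine ⟨_, h2.add h3, ?_⟩
    have hev : ∀ᶠ w in 𝓝 (0 : ℂ), AnalyticAt ℂ (dslope (theta m) 0) w ∧
        dslope (theta m) 0 w ≠ 0 :=
      h1.eventually_analyticAt.and (h1.continuousAt.eventually_ne hne)
    have hz : ∀ᶠ w in 𝓝[≠] (0 : ℂ), zetaFn m =ᶠ[𝓝 w]
        fun u => u⁻¹ + (deriv (dslope (theta m) 0) / dslope (theta m) 0) u := by
      filter_upwards [(eventually_eventually_nhds.mpr hev).filter_mono nhdsWithin_le_nhds,
        self_mem_nhdsWithin] with w hw hne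
      filter_upwards [hw, isOpen_compl_singleton.mem_nhds hne] with u hu hu0
      have hu0' : u ≠ 0 := hu0
      have hd : HasDerivAt (theta m)
          (1 * dslope (theta m) 0 u + u * deriv (dslope (theta m) 0) u) u := by
        have h := (hasDerivAt_id u).mul hu.1.differentiableAt.hasDerivAt
        refine h.congr_of_eventuallyEq (.of_forall fun v => ?_)
        exact theta_eq_mul_dslope hm v
      rw [zetaFn, hd.deriv, theta_eq_mul_dslope hm u, Pi.div_apply]
      have := hu.2
      field_simp
    filter_upwards [hz, self_mem_nhdsWithin,
      hev.filter_mono nhdsWithin_le_nhds] with w hw hne hw2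
    have hw0 : w ≠ 0 := hne
    simp only [hf, Pi.add_apply]
    have hd : DifferentiableAt ℂ (deriv (dslope (theta m) 0) / dslope (theta m) 0) w :=
      (hw2.1.deriv.div hw2.1 hw2.2).differentiableAt
    rw [hw.deriv_eq, deriv_fun_add (differentiableAt_inv hw0) hd, deriv_inv,
      weierstrassP_eq_near_zero hm]
    field_simp
    ring
  have hrem : ∀ z, RemovableAt f z := by
    intro z
    by_cases hz : z ∈ (periods m hm).lattice
    · have := hrem0.translate (l := z) (hper z hz 0)
      rwa [zero_add] at this
    · exact (han z hz).removableAt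
  obtain ⟨C, hC⟩ := eq_const_of_periodic_of_removable (periods m hm) hper hrem
  have hreal : conj C = C := by
    have hu : ((m / 2 : ℝ) : ℂ) ∉ (periods m hm).lattice := by
      simpa using half_notMem hm (j := 1) (k := 0) (by decide)
    have h1 := hC _ (han _ hu).continuousAt
    rw [← h1]
    simp only [hf]
    rw [map_add, ← weierstrassP_conj hm, ← deriv_zetaFn_conj hm (theta_ne_zero hm hu),
      Complex.conj_ofReal]
  obtain ⟨r, hr⟩ := Complex.conj_eq_iff_real.mp hreal
  refine ⟨-r, fun u hu => ?_⟩
  have h1 := hC _ (han _ hu).continuousAt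
  simp only [hf] at h1
  push_cast
  rw [← hr]
  linear_combination h1

/-! ### The Green's function -/

lemma notMem_of_im {u : ℂ} (h0 : u.im ≠ 0) (h1 : -(2 * Real.pi) < u.im)
    (h2 : u.im < 2 * Real.pi) : u ∉ (periods m hm).lattice := by
  rw [mem_periods_lattice]
  rintro ⟨j, k, rfl⟩
  have hpi := Real.pi_pos
  simp at h0 h1 h2
  have h3 : (-1 : ℝ) < k := by nlinarith
  have h4 : (k : ℝ) < 1 := by nlinarith
  have h5 : -1 < k := by exact_mod_cast h3
  have h6 : k < 1 := by exact_mod_cast h4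
  exact h0 (by omega)

lemma notMem_of_ne {u : ℂ} (h0 : ∀ k : ℤ, u ≠ k * m) (h1 : -(2 * Real.pi) < u.im)
    (h2 : u.im < 2 * Real.pi) : u ∉ (periods m hm).lattice := by
  intro h
  by_cases hu : u.im = 0
  · obtain ⟨j, k, rfl⟩ := (mem_periods_lattice hm).mp h
    simp at hu
    exact h0 j (by simp [hu])
  · exact notMem_of_im hm hu h1 h2 h

-- Near `z` the function `log ‖f‖` is, up to a constant, the real part of the principal logarithm of
-- `f / f(z)`, which is close to `1`; no global branch is needed.
omit hm in
lemma hasFDerivAt_log_norm {f : ℂ → ℂ} {f' z : ℂ} (hf : HasDerivAt f f' z) (h0 : f z ≠ 0) :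
    HasFDerivAt (fun w => Real.log ‖f w‖)
      (Complex.reCLM.comp
        ((ContinuousLinearMap.toSpanSingleton ℂ (f' / f z)).restrictScalars ℝ)) z := by
  have h1 : HasDerivAt (fun w => Complex.log ((f z)⁻¹ * f w)) (f' / f z) z := by
    have h := (hf.const_mul (f z)⁻¹).clog (by simp [h0])
    convert h using 1
    field_simp
  have h2 := (Complex.reCLM.hasFDerivAt (x := Complex.log ((f z)⁻¹ * f z))).comp z
    (h1.hasFDerivAt.restrictScalars ℝ)
  refine (h2.add_const (Real.log ‖f z‖)).congr_of_eventuallyEq ?_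
  filter_upwards [hf.continuousAt.eventually_ne h0] with w hw
  simp only [Function.comp_apply, Complex.reCLM_apply, Complex.log_re, norm_mul, norm_inv]
  rw [Real.log_mul (by simpa using h0) (by simpa using hw), Real.log_inv]
  ring

omit hm in
lemma wirtinger_ofReal {u : ℂ → ℝ} {a z : ℂ}
    (h : HasFDerivAt u (Complex.reCLM.comp
        ((ContinuousLinearMap.toSpanSingleton ℂ a).restrictScalars ℝ)) z) (s : Bool) :
    wirtinger s (fun w => (u w : ℂ)) z = twist s a / 2 := by
  have h1 := (Complex.ofRealCLM.hasFDerivAt (x := u z)).comp z h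
  have h2 : fderiv ℝ (fun w => (u w : ℂ)) z = _ := h1.fderiv
  rw [wirtinger, h2]
  apply Complex.ext <;> cases s <;> simp [sgn, twist]

/-- The Green's function of the straight cylinder with Dirichlet boundary conditions. -/
def greenFn (m : ℝ) (z₁ z₂ : ℂ) : ℝ :=
  -(2 * Real.pi)⁻¹ * Real.log ‖theta m (z₂ - z₁) / theta m (z₂ - conj z₁)‖

lemma theta_sub_ne_zero {z₁ z₂ : ℂ} (h₁ : z₁ ∈ strip) (h₂ : 0 ≤ z₂.im) (h₂' : z₂.im ≤ Real.pi)
    (h : ∀ k : ℤ, z₂ ≠ z₁ + k * m) : theta m (z₂ - z₁) ≠ 0 := by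
  have hpi := Real.pi_pos
  refine theta_ne_zero hm (notMem_of_ne hm (fun k hk => h k (by linear_combination hk)) ?_ ?_) <;>
  · have := h₁.1
    have := h₁.2
    simp
    linarith

lemma theta_sub_conj_ne_zero {z₁ z₂ : ℂ} (h₁ : z₁ ∈ strip) (h₂ : 0 ≤ z₂.im)
    (h₂' : z₂.im ≤ Real.pi) : theta m (z₂ - conj z₁) ≠ 0 := by
  have hpi := Real.pi_pos
  have := h₁.1
  have := h₁.2
  refine theta_ne_zero hm (notMem_of_im hm ?_ ?_ ?_)
  · simp
    linarith
  · simp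
    linarith
  · simp
    linarith

lemma hasDerivAt_theta_sub (a z : ℂ) :
    HasDerivAt (fun w => theta m (w - a)) (deriv (theta m) (z - a)) z :=
  HasDerivAt.comp_sub_const z a (differentiable_theta hm _).hasDerivAt

lemma hasFDerivAt_greenFn {z₁ z₂ : ℂ} (h1 : theta m (z₂ - z₁) ≠ 0)
    (h2 : theta m (z₂ - conj z₁) ≠ 0) :
    HasFDerivAt (greenFn m z₁) (Complex.reCLM.comp
      ((ContinuousLinearMap.toSpanSingleton ℂ (-(2 * Real.pi : ℂ)⁻¹ *
        (zetaFn m (z₂ - z₁) - zetaFn m (z₂ - conj z₁)))).restrictScalars ℝ)) z₂ := by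
  have k := (hasFDerivAt_log_norm ((hasDerivAt_theta_sub hm z₁ z₂).div
    (hasDerivAt_theta_sub hm (conj z₁) z₂) h2) (div_ne_zero h1 h2)).const_mul (-(2 * Real.pi)⁻¹)
  refine k.congr_fderiv ?_
  ext v
  simp only [zetaFn, FunLike.coe_smul, Pi.smul_apply, Pi.div_apply,
    ContinuousLinearMap.comp_apply, ContinuousLinearMap.coe_restrictScalars',
    ContinuousLinearMap.toSpanSingleton_apply, Complex.reCLM_apply, smul_eq_mul]
  rw [← Complex.re_ofReal_mul]
  congr 1
  push_cast
  field_simp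

/-- Method of images. The period multiplies numerator and denominator by exponentials of equal
modulus, since `z₁` and its conjugate share their real part. On both boundary lines `z₂ - z̄₁` is
the conjugate of `z₂ - z₁` modulo `2πi`, so the quotient has modulus `1`. -/
lemma isGreenFunction_greenFn : IsGreenFunction m (greenFn m) where
  periodic z₁ h₁ z₂ h₂ := by
    have h1 : ‖cexp (z₂ - z₁ + m / 2)‖ = ‖cexp (z₂ - conj z₁ + m / 2)‖ := by
      rw [Complex.norm_exp, Complex.norm_exp]
      simp
    have h2 : ‖cexp (z₂ - conj z₁ + m / 2)‖ ≠ 0 := by simp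
    rw [greenFn, greenFn, add_sub_right_comm, add_sub_right_comm, theta_add_period hm,
      theta_add_period hm, norm_div, norm_div, norm_mul, norm_mul, norm_neg, norm_neg, h1,
      mul_div_mul_left _ _ h2]
  harmonic z₁ h₁ z₂ h₂ h := by
    have k1 : AnalyticAt ℂ (fun w => theta m (w - z₁)) z₂ :=
      AnalyticAt.fun_comp (analyticAt_theta hm _) (by fun_prop)
    have k2 : AnalyticAt ℂ (fun w => theta m (w - conj z₁)) z₂ :=
      AnalyticAt.fun_comp (analyticAt_theta hm _) (by fun_prop)
    have e1 := theta_sub_ne_zero hm h₁ h₂.1.le h₂.2.le h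
    have e2 := theta_sub_conj_ne_zero hm h₁ h₂.1.le h₂.2.le
    exact ((k1.div k2 e2).harmonicAt_log_norm (div_ne_zero e1 e2)).const_smul
      (c := -(2 * Real.pi)⁻¹)
  singularity z₁ h₁ := by
    have hd : dslope (theta m) 0 (z₁ - z₁) ≠ 0 := by
      rw [sub_self, dslope_same]
      exact deriv_theta_zero_ne hm
    have c1 : ContinuousAt (fun z => dslope (theta m) 0 (z - z₁)) z₁ := by
      have := (analyticAt_dslope (analyticAt_theta hm 0)).continuousAt
      exact ContinuousAt.comp (g := dslope (theta m) 0) (by simpa using this) (by fun_prop)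
    have c2 : ContinuousAt (fun z => theta m (z - conj z₁)) z₁ :=
      ((differentiable_theta hm).continuous.comp (by fun_prop)).continuousAt
    have h2 := theta_sub_conj_ne_zero hm h₁ h₁.1.le h₁.2.le
    have c3 : ContinuousAt (fun z => -(2 * Real.pi)⁻¹ *
        (Real.log ‖dslope (theta m) 0 (z - z₁)‖ - Real.log ‖theta m (z - conj z₁)‖)) z₁ :=
      ((c1.norm.log (by simpa using hd)).sub (c2.norm.log (by simpa using h2))).const_mul _
    refine ((c3.tendsto.isBigO_one ℝ).mono nhdsWithin_le_nhds).congr' ?_ EventuallyEq.rfl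
    filter_upwards [self_mem_nhdsWithin,
      (c1.eventually_ne hd).filter_mono nhdsWithin_le_nhds,
      (c2.eventually_ne h2).filter_mono nhdsWithin_le_nhds] with z hz hz2 hz3
    have hz0 : z - z₁ ≠ 0 := sub_ne_zero.mpr hz
    rw [greenFn, theta_eq_mul_dslope hm (z - z₁), norm_div, Real.log_div
      (norm_ne_zero_iff.mpr (mul_ne_zero hz0 hz2)) (norm_ne_zero_iff.mpr hz3), norm_mul,
      Real.log_mul (by simpa using hz0) (by simpa using hz2)]
    ring
  boundary z₁ h₁ w hw := by
    have hpi := Real.pi_pos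
    have i1 := h₁.1
    have i2 := h₁.2
    have hw' : 0 ≤ w.im ∧ w.im ≤ Real.pi := by
      rcases hw with hw | hw <;> rw [hw] <;> constructor <;> linarith
    have h1 := theta_sub_ne_zero hm h₁ hw'.1 hw'.2 (fun k hk => by
      rw [hk] at hw
      simp at hw
      rcases hw with hw | hw <;> linarith)
    have h2 := theta_sub_conj_ne_zero hm h₁ hw'.1 hw'.2
    have c0 := (hasFDerivAt_greenFn hm h1 h2).continuousAt
    have hval : greenFn m z₁ w = 0 := by
      have : ‖theta m (w - conj z₁)‖ = ‖theta m (w - z₁)‖ := by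
        rw [← Complex.norm_conj (theta m (w - z₁)), ← theta_conj hm, map_sub]
        rcases hw with hw | hw
        · rw [Complex.conj_eq_iff_im.mpr hw]
        · have : conj w + 2 * Real.pi * I = w := by
            apply Complex.ext <;> simp [hw]
            ring
          conv_lhs => rw [← this]
          rw [show conj w + 2 * Real.pi * I - conj z₁ = conj w - conj z₁ + 2 * Real.pi * I by ring,
            theta_add_two_pi, norm_neg]
      rw [greenFn, norm_div, this, div_self (norm_ne_zero_iff.mpr h1), Real.log_one, mul_zero]
    have := c0.tendsto
    rw [hval] at this
    exact this.mono_left nhdsWithin_le_nhds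

/-- Differentiation in `z₂` gives a difference of two `ζ` values, one holomorphic and one
antiholomorphic in `z₁`. The derivative in `z₁` selects one of them and yields `ζ' = -(℘ + c)`. -/
lemma isGreenConstant_of_deriv_zetaFn {c : ℝ} (hc : ∀ u, u ∉ (periods m hm).lattice →
    deriv (zetaFn m) u = -((periods m hm).weierstrassP u + c)) : IsGreenConstant m hm c := by
  refine ⟨greenFn m, isGreenFunction_greenFn hm, fun s₁ s₂ z₁ h₁ z₂ h₂ h => ?_⟩
  have hpi := Real.pi_pos
  have hA : twist s₂ z₂ - z₁ ∉ (periods m hm).lattice := by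
    cases s₂
    · refine notMem_of_im hm ?_ ?_ ?_ <;> simp [twist] <;> linarith [h₁.1, h₁.2, h₂.1, h₂.2]
    · exact fun hh => theta_sub_ne_zero hm h₁ h₂.1.le h₂.2.le h ((theta_eq_zero_iff hm).mpr hh)
  have hB : twist s₂ z₂ - conj z₁ ∉ (periods m hm).lattice := by
    cases s₂
    · have := conj_mem_lattice hm (l := twist false z₂ - conj z₁)
      intro hh
      have h3 := this hh
      simp only [twist, Bool.false_eq_true, if_false, map_sub, Complex.conj_conj] at h3
      exact theta_sub_ne_zero hm h₁ h₂.1.le h₂.2.le h ((theta_eq_zero_iff hm).mpr h3)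
    · refine notMem_of_im hm ?_ ?_ ?_ <;> simp [twist] <;> linarith [h₁.1, h₁.2, h₂.1, h₂.2]
  -- For `s₂ = -` conjugation exchanges the two `ζ` terms, which produces `sgn s₂`.
  have inner : (fun w₁ => wirtinger s₂ (fun w₂ => (greenFn m w₁ w₂ : ℂ)) z₂) =ᶠ[𝓝 z₁]
      fun w₁ => -(4 * Real.pi : ℂ)⁻¹ * sgn s₂ *
        (zetaFn m (twist s₂ z₂ - w₁) - zetaFn m (twist s₂ z₂ - conj w₁)) := by
    have c1 : ContinuousAt (fun w₁ => theta m (z₂ - w₁)) z₁ :=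
      ((differentiable_theta hm).continuous.comp (by fun_prop)).continuousAt
    have c2 : ContinuousAt (fun w₁ => theta m (z₂ - conj w₁)) z₁ :=
      ((differentiable_theta hm).continuous.comp
        (continuous_const.sub Complex.continuous_conj)).continuousAt
    filter_upwards [c1.eventually_ne (theta_sub_ne_zero hm h₁ h₂.1.le h₂.2.le h),
      c2.eventually_ne (theta_sub_conj_ne_zero hm h₁ h₂.1.le h₂.2.le)] with w₁ e1 e2
    rw [wirtinger_ofReal (hasFDerivAt_greenFn hm e1 e2)]
    cases s₂
    · simp only [twist, sgn, Bool.false_eq_true, if_false, map_mul, map_neg, map_inv₀, map_sub,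
        ← zetaFn_conj hm, Complex.conj_conj, Complex.conj_ofReal, map_ofNat]
      field_simp
      ring
    · simp only [twist, sgn, if_true]
      field_simp
      ring
  have d1 := (analyticAt_zetaFn hm (theta_ne_zero hm hA)).differentiableAt.hasDerivAt
  have d2 := (analyticAt_zetaFn hm (theta_ne_zero hm hB)).differentiableAt.hasDerivAt
  have f1 : HasFDerivAt (fun w : ℂ => twist s₂ z₂ - w)
      (-(ContinuousLinearMap.id ℝ ℂ)) z₁ := (hasFDerivAt_id z₁).const_sub _
  have f2 : HasFDerivAt (fun w : ℂ => twist s₂ z₂ - conj w)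
      (-(Complex.conjCLE : ℂ →L[ℝ] ℂ)) z₁ :=
    (Complex.conjCLE : ℂ →L[ℝ] ℂ).hasFDerivAt.const_sub _
  have g1 := (d1.hasFDerivAt.restrictScalars ℝ).comp z₁ f1
  have g2 := (d2.hasFDerivAt.restrictScalars ℝ).comp z₁ f2
  have g3 := (g1.sub g2).const_mul (-(4 * Real.pi : ℂ)⁻¹ * sgn s₂)
  have g4 := (inner.fderiv_eq (𝕜 := ℝ)).trans g3.fderiv
  rw [wirtinger, g4]
  have hpi' : (Real.pi : ℂ) ≠ 0 := by exact_mod_cast hpi.ne'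
  simp only [FunLike.coe_smul, FunLike.coe_sub, Pi.smul_apply,
    Pi.sub_apply, ContinuousLinearMap.comp_apply, ContinuousLinearMap.coe_restrictScalars',
    ContinuousLinearMap.toSpanSingleton_apply, smul_eq_mul, FunLike.coe_neg, Pi.neg_apply,
    ContinuousLinearMap.id_apply, ContinuousLinearEquiv.coe_coe, Complex.conjCLE_apply, map_one,
    Complex.conj_I]
  have hI : I * I = -1 := Complex.I_mul_I
  have hq : -4 * (Real.pi : ℂ) * (-(4 * (Real.pi : ℂ))⁻¹ * sgn s₂) = sgn s₂ := by
    field_simp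
  generalize -(4 * (Real.pi : ℂ))⁻¹ * sgn s₂ = q at hq
  cases s₁
  · have ht : twist false z₁ = conj z₁ := rfl
    have hs : sgn false = -1 := rfl
    rw [hc _ hB, ht, hs]
    generalize deriv (zetaFn m) (twist s₂ z₂ - z₁) = D
    generalize (periods m hm).weierstrassP (twist s₂ z₂ - conj z₁) = p
    linear_combination -(p + c) * hq + 2 * Real.pi * q * (D - (p + c)) * hI
  · have ht : twist true z₁ = z₁ := rfl
    have hs : sgn true = 1 := rfl
    rw [hc _ hA, ht, hs]
    generalize deriv (zetaFn m) (twist s₂ z₂ - conj z₁) = D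
    generalize (periods m hm).weierstrassP (twist s₂ z₂ - z₁) = p
    linear_combination (p + c) * hq - 2 * Real.pi * q * (D - (p + c)) * hI

end

/-! ### Fourier coefficients of periodic functions on a strip -/

/-- The exponential `e^{2πinz/P}`. -/
def expMode (P : ℝ) (n : ℤ) (z : ℂ) : ℂ := cexp (2 * Real.pi * I * n * z / P)

/-- The `n`-th Fourier coefficient of `f` on the line of height `y`, normalized to be
independent of `y` when `f` is holomorphic. -/
def stripCoeff (P : ℝ) (f : ℂ → ℂ) (n : ℤ) (y : ℝ) : ℂ :=
  ∫ x in (0 : ℝ)..P, f (x + y * I) * expMode P (-n) (x + y * I)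

lemma expMode_add (P : ℝ) (n : ℤ) (z w : ℂ) :
    expMode P n (z + w) = expMode P n z * expMode P n w := by
  rw [expMode, expMode, expMode, ← Complex.exp_add]
  congr 1
  ring

lemma expMode_neg_mul (P : ℝ) (n : ℤ) (z : ℂ) : expMode P (-n) z * expMode P n z = 1 := by
  rw [expMode, expMode, ← Complex.exp_add, ← Complex.exp_zero]
  congr 1
  push_cast
  ring

lemma expMode_period {P : ℝ} (hP : 0 < P) (n : ℤ) (z : ℂ) :
    expMode P n (z + P) = expMode P n z := by
  have hP' : (P : ℂ) ≠ 0 := by exact_mod_cast hP.ne'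
  rw [expMode_add]
  have : expMode P n P = 1 := by
    rw [expMode, Complex.exp_eq_one_iff]
    exact ⟨n, by field_simp⟩
  rw [this, mul_one]

lemma differentiable_expMode (P : ℝ) (n : ℤ) : Differentiable ℂ (expMode P n) := by
  unfold expMode
  fun_prop

lemma expMode_conj (P : ℝ) (n : ℤ) (z : ℂ) : conj (expMode P n z) = expMode P (-n) (conj z) := by
  rw [expMode, expMode, ← Complex.exp_conj]
  congr 1
  simp [map_ofNat]

lemma norm_expMode (P : ℝ) (n : ℤ) (z : ℂ) :
    ‖expMode P n z‖ = Real.exp (-(2 * Real.pi * n * z.im / P)) := by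
  rw [expMode, Complex.norm_exp]
  congr 1
  rw [Complex.div_ofReal_re]
  simp
  ring

lemma stripCoeff_eq {P : ℝ} (f : ℂ → ℂ) (n : ℤ) (y : ℝ) :
    stripCoeff P f n y =
      (∫ x in (0 : ℝ)..P, f (x + y * I) * expMode P (-n) x) * expMode P (-n) (y * I) := by
  rw [stripCoeff, ← intervalIntegral.integral_mul_const]
  simp only [expMode_add, mul_assoc]

/-- The integral over a period of a holomorphic periodic function does not depend on the height. -/
lemma integral_period_eq {P : ℝ} {f : ℂ → ℂ} {y₁ y₂ : ℝ} (hy : y₁ ≤ y₂)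
    (hc : ContinuousOn f {z | y₁ ≤ z.im ∧ z.im ≤ y₂})
    (hd : ∀ z : ℂ, y₁ < z.im → z.im < y₂ → DifferentiableAt ℂ f z)
    (hper : ∀ z : ℂ, y₁ ≤ z.im → z.im ≤ y₂ → f (z + P) = f z) :
    ∫ x in (0 : ℝ)..P, f (x + y₁ * I) = ∫ x in (0 : ℝ)..P, f (x + y₂ * I) := by
  have h := Complex.integral_boundary_rect_eq_zero_of_continuousOn_of_differentiableOn f
    (y₁ * I) (P + y₂ * I) ?_ ?_
  · simp only [mul_re, ofReal_re, I_re, mul_zero, ofReal_im, I_im, mul_one, sub_self, add_re,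
      add_zero, mul_im, zero_add, add_im] at h
    -- The vertical sides of the rectangle cancel by periodicity.
    have h2 : ∫ y : ℝ in y₁..y₂, f (P + y * I) = ∫ y : ℝ in y₁..y₂, f ((0 : ℝ) + y * I) := by
      refine intervalIntegral.integral_congr fun y hy' => ?_
      rw [uIcc_of_le hy] at hy'
      rw [← hper ((0 : ℝ) + y * I) (by simpa using hy'.1) (by simpa using hy'.2)]
      congr 1
      push_cast
      ring
    rw [h2] at h
    linear_combination h
  · refine hc.mono fun z hz => ?_
    have := hz.2
    simp [uIcc_of_le hy] at this
    exact this
  · intro z hz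
    have := hz.2
    simp [hy] at this
    exact (hd z this.1 this.2).differentiableWithinAt

lemma stripCoeff_const {P : ℝ} (hP : 0 < P) {f : ℂ → ℂ} {y₁ y₂ : ℝ} (hy : y₁ ≤ y₂)
    (hc : ContinuousOn f {z | y₁ ≤ z.im ∧ z.im ≤ y₂})
    (hd : ∀ z : ℂ, y₁ < z.im → z.im < y₂ → DifferentiableAt ℂ f z)
    (hper : ∀ z : ℂ, y₁ ≤ z.im → z.im ≤ y₂ → f (z + P) = f z) (n : ℤ) :
    stripCoeff P f n y₁ = stripCoeff P f n y₂ := by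
  refine integral_period_eq (f := fun z => f z * expMode P (-n) z) hy ?_ ?_ ?_
  · exact hc.mul (differentiable_expMode P (-n)).continuous.continuousOn
  · exact fun z h1 h2 => (hd z h1 h2).mul (differentiable_expMode P (-n) z)
  · intro z h1 h2
    rw [hper z h1 h2, expMode_period hP]

lemma hasSum_fourier_of_summable {P : ℝ} (hP : 0 < P) {g : ℝ → ℂ} (hg : Continuous g)
    (hper : ∀ x, g (x + P) = g x)
    (hs : Summable fun n : ℤ => ∫ x in (0 : ℝ)..P, g x * expMode P (-n) x) (x : ℝ) :
    HasSum (fun n : ℤ => (P : ℂ)⁻¹ * (∫ x in (0 : ℝ)..P, g x * expMode P (-n) x) * expMode P n x)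
      (g x) := by
  have : Fact (0 < P) := ⟨hP⟩
  have hp : Function.Periodic g P := hper
  let F : C(AddCircle P, ℂ) := ⟨hp.lift, continuous_coinduced_dom.mpr hg⟩
  have hF : ∀ x : ℝ, F x = g x := fun x => hp.lift_coe x
  have hco : ∀ n : ℤ, fourierCoeff F n =
      (P : ℂ)⁻¹ * ∫ x in (0 : ℝ)..P, g x * expMode P (-n) x := by
    intro n
    rw [fourierCoeff_eq_intervalIntegral F n 0, zero_add, Complex.real_smul]
    congr 1
    · push_cast
      rw [one_div]
    · refine intervalIntegral.integral_congr fun x _ => ?_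
      rw [hF, fourier_coe_apply, smul_eq_mul, mul_comm, expMode]
  have h := has_pointwise_sum_fourier_series_of_summable (f := F) (by
    rw [show fourierCoeff F = _ from funext hco]
    exact hs.mul_left _) (x : AddCircle P)
  rw [hF] at h
  refine h.congr_fun ?_ |> fun h => h
  intro n
  rw [hco, fourier_coe_apply, smul_eq_mul, expMode]

lemma continuous_line (y : ℝ) : Continuous fun x : ℝ => (x + y * I : ℂ) := by fun_prop

/-- A periodic holomorphic function on `0 < Im z < δ` whose real part vanishes at the bottom
extends across the bottom, by reflection. -/
lemma exists_extension_of_re_tendsto {P δ : ℝ} (hP : 0 < P) (hδ : 0 < δ) {f : ℂ → ℂ}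
    (hd : ∀ z : ℂ, 0 < z.im → z.im < δ → DifferentiableAt ℂ f z)
    (hper : ∀ z : ℂ, 0 < z.im → z.im < δ → f (z + P) = f z)
    (hre : ∀ ε > 0, ∃ η > 0, ∀ z : ℂ, 0 < z.im → z.im < η → |(f z).re| < ε) :
    ∃ g : ℂ → ℂ, DifferentiableOn ℂ g {z | |z.im| < δ / 2} ∧
      (∀ z : ℂ, 0 < z.im → z.im < δ / 2 → g z = f z) ∧
      ∀ z : ℂ, g (conj z) = -conj (g z) := by
  have hpi := Real.pi_pos
  have hcont : ∀ y, 0 < y → y < δ → Continuous fun x : ℝ => f (x + y * I) := by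
    intro y h1 h2
    rw [continuous_iff_continuousAt]
    intro x
    exact ContinuousAt.comp (g := f) (hd _ (by simpa using h1) (by simpa using h2)).continuousAt
      (continuous_line y).continuousAt
  set c : ℤ → ℂ := fun n => stripCoeff P f n (3 * δ / 4) with hc
  have hconst : ∀ n y, 0 < y → y < δ → stripCoeff P f n y = c n := by
    intro n y h1 h2
    have key : ∀ y₁ y₂ : ℝ, 0 < y₁ → y₂ < δ → y₁ ≤ y₂ →
        stripCoeff P f n y₁ = stripCoeff P f n y₂ := by
      intro y₁ y₂ h1 h2 h
      refine stripCoeff_const hP h (fun z hz => ?_) (fun z h3 h4 => ?_) (fun z h3 h4 => ?_) n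
      · exact (hd z (h1.trans_le hz.1) (hz.2.trans_lt h2)).continuousAt.continuousWithinAt
      · exact hd z (h1.trans h3) (h4.trans h2)
      · exact hper z (h1.trans_le h3) (h4.trans_lt h2)
    rcases le_total y (3 * δ / 4) with h | h
    · exact key _ _ h1 (by linarith) h
    · exact (key _ _ (by linarith) h2 h).symm
  have hline : ∀ n y, 0 < y → y < δ →
      ∫ x in (0 : ℝ)..P, f (x + y * I) * expMode P (-n) x = c n * expMode P n (y * I) := by
    intro n y h1 h2
    rw [← hconst n y h1 h2, stripCoeff_eq, mul_assoc, expMode_neg_mul, mul_one]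
  -- On the line of height `y`, the `n`-th coefficient of `f + conj f` tends to `c n + conj (c
  -- (-n))` as `y → 0`, and it is bounded by the supremum of `2 |Re f|` times `P`, which tends to
  -- `0`.
  have hsym : ∀ n, c n = -conj (c (-n)) := by
    intro n
    rw [← add_eq_zero_iff_eq_neg, ← norm_eq_zero]
    refine le_antisymm ?_ (norm_nonneg _)
    refine le_of_forall_pos_le_add fun ε hε => ?_
    obtain ⟨η, hη, hre⟩ := hre (ε / (2 * P)) (by positivity)
    have hlim : Tendsto (fun y : ℝ => ‖c n * expMode P n (y * I) +
        conj (c (-n)) * expMode P (-n) (y * I)‖) (𝓝[>] 0) (𝓝 ‖c n + conj (c (-n))‖) := by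
      have h1 : Continuous fun y : ℝ => ‖c n * expMode P n (y * I) +
          conj (c (-n)) * expMode P (-n) (y * I)‖ := by
        have e1 := (differentiable_expMode P n).continuous
        have e2 := (differentiable_expMode P (-n)).continuous
        fun_prop
      have h2 := (h1.tendsto 0).mono_left (nhdsWithin_le_nhds (s := Ioi 0))
      simpa [expMode] using h2
    refine le_of_tendsto hlim ?_
    filter_upwards [Ioo_mem_nhdsGT (lt_min hη hδ)] with y hy
    have h1 : 0 < y := hy.1
    have h2 : y < δ := hy.2.trans_le (min_le_right _ _)
    have h3 : y < η := hy.2.trans_le (min_le_left _ _)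
    have e1 := hline n y h1 h2
    have e2 := congrArg conj (hline (-n) y h1 h2)
    rw [← intervalIntegral.intervalIntegral_conj, map_mul, expMode_conj, neg_neg, map_mul, Complex.conj_I,
      Complex.conj_ofReal] at e2
    have e3 : expMode P n (y * -I) = expMode P (-n) (y * I) := by
      rw [expMode, expMode]
      congr 1
      push_cast
      ring
    rw [e3] at e2
    rw [← e1, ← e2, ← intervalIntegral.integral_add]
    · have h4 : ‖∫ x in (0 : ℝ)..P, (f (x + y * I) * expMode P (-n) x +
          conj (f (x + y * I) * expMode P n x))‖ ≤ (ε / P) * |P - 0| := by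
        refine intervalIntegral.norm_integral_le_of_norm_le_const fun x _ => ?_
        rw [map_mul, expMode_conj, Complex.conj_ofReal, ← add_mul, norm_mul, norm_expMode,
          Complex.add_conj]
        simp only [ofReal_im, mul_zero, zero_div, neg_zero, Real.exp_zero, mul_one, Complex.norm_real,
          Real.norm_eq_abs, abs_mul, abs_two]
        have := hre (x + y * I) (by simpa using h1) (by simpa using h3)
        have h5 : 2 * (ε / (2 * P)) = ε / P := by field_simp
        linarith
      rw [sub_zero, abs_of_pos hP, div_mul_cancel₀ _ hP.ne'] at h4
      simpa using h4
    · have h4 : Continuous fun x : ℝ => f (x + y * I) * expMode P (-n) x :=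
        (hcont y h1 h2).mul ((differentiable_expMode P (-n)).continuous.comp continuous_ofReal)
      exact h4.intervalIntegrable 0 P
    · have h4 : Continuous fun x : ℝ => conj (f (x + y * I) * expMode P n x) :=
        continuous_conj.comp ((hcont y h1 h2).mul
          ((differentiable_expMode P n).continuous.comp continuous_ofReal))
      exact Continuous.intervalIntegrable (μ := volume) h4 0 P
  -- For `n ≤ 0` the integral at height `3δ/4` decays exponentially, and `hsym` transfers the bound
  -- to `n > 0`. The margin between `3δ/4` and `δ/2` gives the rate `πδ/(2P)` in `u`, so the series
  -- converges on both sides of the real line.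
  obtain ⟨M, hM⟩ : ∃ M, ∀ n, ‖c n‖ ≤ M * Real.exp (-(2 * Real.pi * |(n : ℝ)| * (3 * δ / 4) / P)) := by
    obtain ⟨M, hM⟩ := (isCompact_Icc (a := (0 : ℝ)) (b := P)).exists_bound_of_continuousOn
      (hcont (3 * δ / 4) (by linarith) (by linarith)).continuousOn
    have hneg : ∀ n : ℤ, n ≤ 0 →
        ‖c n‖ ≤ M * P * Real.exp (-(2 * Real.pi * |(n : ℝ)| * (3 * δ / 4) / P)) := by
      intro n hn
      have hn' : (n : ℝ) ≤ 0 := by exact_mod_cast hn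
      have h4 : ‖c n‖ ≤ (M * Real.exp (-(2 * Real.pi * |(n : ℝ)| * (3 * δ / 4) / P))) * |P - 0| := by
        refine intervalIntegral.norm_integral_le_of_norm_le_const fun x hx => ?_
        rw [uIoc_of_le hP.le] at hx
        rw [norm_mul, norm_expMode]
        have e : -(2 * Real.pi * ((-n : ℤ) : ℝ) * ((x : ℂ) + (3 * δ / 4 : ℝ) * I).im / P) =
            -(2 * Real.pi * |(n : ℝ)| * (3 * δ / 4) / P) := by
          rw [abs_of_nonpos hn']
          push_cast
          simp
        rw [e]
        gcongr
        exact hM x ⟨hx.1.le, hx.2⟩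
      rw [sub_zero, abs_of_pos hP] at h4
      linarith
    refine ⟨M * P, fun n => ?_⟩
    rcases le_total n 0 with hn | hn
    · exact hneg n hn
    · rw [hsym n, norm_neg, Complex.norm_conj]
      have := hneg (-n) (by omega)
      simpa using this
  have hM0 : 0 ≤ M := by
    have := (norm_nonneg _).trans (hM 0)
    simpa using this
  set u : ℤ → ℝ := fun n => M * Real.exp (-(Real.pi * δ / (2 * P))) ^ n.natAbs with hu
  have hus : Summable u := by
    refine Summable.mul_left _ ?_
    have hg : Summable fun n : ℕ => Real.exp (-(Real.pi * δ / (2 * P))) ^ n :=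
      summable_geometric_of_lt_one (Real.exp_pos _).le (by
        rw [Real.exp_lt_one_iff]
        have : 0 < Real.pi * δ / (2 * P) := by positivity
        linarith)
    refine Summable.of_nat_of_neg ?_ ?_ <;> simpa using hg
  have hbound : ∀ (n : ℤ) (z : ℂ), |z.im| < δ / 2 → ‖c n * expMode P n z‖ ≤ u n := by
    intro n z hz
    rw [norm_mul, norm_expMode]
    refine (mul_le_mul_of_nonneg_right (hM n) (Real.exp_pos _).le).trans ?_
    rw [mul_assoc, ← Real.exp_add, hu]
    simp only
    rw [← Real.exp_nat_mul]
    gcongr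
    have h1 : ((n.natAbs : ℕ) : ℝ) = |(n : ℝ)| := by
      rw [Nat.cast_natAbs, Int.cast_abs]
    rw [h1]
    have h2 : -((n : ℝ) * z.im) ≤ |(n : ℝ)| * (δ / 2) := by
      refine (neg_le_abs _).trans ?_
      rw [abs_mul]
      gcongr
    have h3 : -(2 * Real.pi * |(n : ℝ)| * (3 * δ / 4) / P) + -(2 * Real.pi * n * z.im / P) =
      2 * Real.pi / P * (-(|(n : ℝ)| * (3 * δ / 4)) + -((n : ℝ) * z.im)) := by ring
    have h4 : |(n : ℝ)| * -(Real.pi * δ / (2 * P)) =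
      2 * Real.pi / P * (-(|(n : ℝ)| * (3 * δ / 4)) + |(n : ℝ)| * (δ / 2)) := by
      field_simp
      ring
    rw [h3, h4]
    gcongr
  refine ⟨fun z => (P : ℂ)⁻¹ * ∑' n : ℤ, c n * expMode P n z, ?_, ?_, ?_⟩
  · refine DifferentiableOn.const_mul ?_ _
    refine differentiableOn_tsum_of_summable_norm hus (fun n => ?_) ?_ (fun n z hz => hbound n z hz)
    · exact ((differentiable_expMode P n).const_mul _).differentiableOn
    · exact isOpen_lt (continuous_abs.comp continuous_im) continuous_const
  · intro z h1 h2
    have h3 : z.im < δ := by linarith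
    have hsum : Summable fun n : ℤ => ∫ x in (0 : ℝ)..P, f (x + z.im * I) * expMode P (-n) x := by
      simp only [hline _ _ h1 h3]
      refine Summable.of_norm_bounded hus fun n => hbound n _ ?_
      simpa [abs_of_pos h1] using h2
    have h := hasSum_fourier_of_summable hP (hcont z.im h1 h3) (fun x => by
      have := hper (x + z.im * I) (by simpa using h1) (by simpa using h3)
      rw [← this]
      congr 1
      push_cast
      ring) hsum z.re
    rw [Complex.re_add_im] at h
    show (P : ℂ)⁻¹ * ∑' n : ℤ, c n * expMode P n z = f z
    rw [← h.tsum_eq, ← tsum_mul_left]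
    refine tsum_congr fun n => ?_
    rw [hline n _ h1 h3]
    conv_lhs => rw [← Complex.re_add_im z, expMode_add]
    ring
  · intro z
    show (P : ℂ)⁻¹ * ∑' n : ℤ, c n * expMode P n (conj z) =
      -conj ((P : ℂ)⁻¹ * ∑' n : ℤ, c n * expMode P n z)
    rw [map_mul, Complex.conj_tsum, map_inv₀, Complex.conj_ofReal, ← mul_neg, ← tsum_neg,
      ← (Equiv.neg ℤ).tsum_eq]
    congr 1
    refine tsum_congr fun n => ?_
    rw [Equiv.neg_apply, map_mul, expMode_conj, hsym (-n), neg_neg]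
    ring

/-- If `f` is real or imaginary on a line, its coefficients of index `n` and `-n` there are
conjugate up to sign. -/
lemma norm_stripCoeff_neg (P : ℝ) {f : ℂ → ℂ} {y : ℝ} {ε : ℝ} (hε : |ε| = 1)
    (hf : ∀ x : ℝ, conj (f (x + y * I)) = ε * f (x + y * I)) (n : ℤ) :
    ‖∫ x in (0 : ℝ)..P, f (x + y * I) * expMode P (- -n) x‖ =
      ‖∫ x in (0 : ℝ)..P, f (x + y * I) * expMode P (-n) x‖ := by
  rw [← Complex.norm_conj, ← intervalIntegral.intervalIntegral_conj]
  have : ∀ x : ℝ, conj (f (x + y * I) * expMode P (- -n) x) =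
      ε * (f (x + y * I) * expMode P (-n) x) := by
    intro x
    rw [map_mul, expMode_conj, hf, Complex.conj_ofReal, neg_neg]
    ring
  simp only [this, intervalIntegral.integral_const_mul, norm_mul, Complex.norm_real,
    Real.norm_eq_abs, hε, one_mul]

/-- A multiplicatively quasiperiodic function on the closed strip with negative multiplier that is
imaginary at the bottom and real at the top vanishes. -/
lemma eq_zero_of_mixed_boundary {m : ℝ} (hm : 0 < m) (a : ℝ) {D : ℂ → ℂ}
    (hc : ContinuousOn D {z | 0 ≤ z.im ∧ z.im ≤ Real.pi})
    (hd : ∀ z : ℂ, 0 < z.im → z.im < Real.pi → DifferentiableAt ℂ D z)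
    (hper : ∀ z : ℂ, 0 ≤ z.im → z.im ≤ Real.pi → D (z + m) = -cexp a * D z)
    (hbot : ∀ x : ℝ, (D x).re = 0) (htop : ∀ x : ℝ, (D (x + Real.pi * I)).im = 0) (z : ℂ)
    (h0 : 0 ≤ z.im) (h1 : z.im ≤ Real.pi) : D z = 0 := by
  have hpi := Real.pi_pos
  have hm' : (m : ℂ) ≠ 0 := by exact_mod_cast hm.ne'
  have hP : 0 < 2 * m := by linarith
  -- The exponential absorbs `e^a`, so `g` is antiperiodic under `m` and has period `2m`.
  set g : ℂ → ℂ := fun z => D z * cexp (-(a * z / m)) with hg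
  have hed : Differentiable ℂ fun z : ℂ => cexp (-(a * z / m)) := by fun_prop
  have gc : ContinuousOn g {z | 0 ≤ z.im ∧ z.im ≤ Real.pi} := hc.mul hed.continuous.continuousOn
  have gd : ∀ z : ℂ, 0 < z.im → z.im < Real.pi → DifferentiableAt ℂ g z :=
    fun z h2 h3 => (hd z h2 h3).mul (hed z)
  have ganti : ∀ z : ℂ, 0 ≤ z.im → z.im ≤ Real.pi → g (z + m) = -g z := by
    intro z h2 h3
    simp only [hg]
    rw [hper z h2 h3]
    have : -(a * (z + m) / m : ℂ) = -(a * z / m) - a := by field_simp; ring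
    rw [this, Complex.exp_sub]
    field_simp [Complex.exp_ne_zero]
  have gper : ∀ z : ℂ, 0 ≤ z.im → z.im ≤ Real.pi → g (z + (2 * m : ℝ)) = g z := by
    intro z h2 h3
    have : z + (2 * m : ℝ) = z + m + m := by push_cast; ring
    rw [this, ganti _ (by simpa using h2) (by simpa using h3), ganti z h2 h3, neg_neg]
  have gline : ∀ y, 0 ≤ y → y ≤ Real.pi → Continuous fun x : ℝ => g (x + y * I) := by
    intro y h2 h3
    exact gc.comp_continuous (continuous_line y) fun x => by simp [h2, h3]
  have hconst : ∀ n y, 0 ≤ y → y ≤ Real.pi → stripCoeff (2 * m) g n 0 = stripCoeff (2 * m) g n y := by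
    intro n y h2 h3
    refine stripCoeff_const hP h2 (gc.mono fun z hz => ⟨hz.1, hz.2.trans h3⟩)
      (fun z h4 h5 => gd z h4 (h5.trans_le h3)) (fun z h4 h5 => gper z h4 (h5.trans h3)) n
  have hb : ∀ x : ℝ, conj (g (x + (0 : ℝ) * I)) = ((-1 : ℝ) : ℂ) * g (x + (0 : ℝ) * I) := by
    intro x
    have h2 : conj (D x) = -D x := by
      apply Complex.ext <;> simp [hbot x]
    simp only [hg]
    rw [map_mul, ← Complex.exp_conj]
    simp [h2]
  have ht : ∀ x : ℝ, conj (D (x + Real.pi * I) * cexp (-(a * x / m))) =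
      ((1 : ℝ) : ℂ) * (D (x + Real.pi * I) * cexp (-(a * x / m))) := by
    intro x
    have h2 : conj (D (x + Real.pi * I)) = D (x + Real.pi * I) := by
      apply Complex.ext <;> simp [htop x]
    rw [map_mul, ← Complex.exp_conj, h2]
    simp
  have htn : ∀ n : ℤ, ‖∫ x in (0 : ℝ)..(2 * m), g (x + Real.pi * I) * expMode (2 * m) (-n) x‖ =
      ‖∫ x in (0 : ℝ)..(2 * m), (fun w : ℂ => D w * cexp (-(a * (w - Real.pi * I) / m)))
        (x + Real.pi * I) * expMode (2 * m) (-n) x‖ := by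
    intro n
    have h2 : ∀ x : ℝ, g (x + Real.pi * I) * expMode (2 * m) (-n) x =
        cexp ((-(a * Real.pi / m) : ℝ) * I) *
        ((fun w : ℂ => D w * cexp (-(a * (w - Real.pi * I) / m))) (x + Real.pi * I) *
          expMode (2 * m) (-n) x) := by
      intro x
      simp only [hg]
      have : -(a * (x + Real.pi * I) / m : ℂ) =
        (-(a * Real.pi / m) : ℝ) * I + -(a * (x + Real.pi * I - Real.pi * I) / m) := by
        push_cast
        field_simp
        ring
      rw [this, Complex.exp_add]
      ring
    simp only [h2]
    rw [intervalIntegral.integral_const_mul, norm_mul, Complex.norm_exp_ofReal_mul_I, one_mul]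
  have hsym0 : ∀ n : ℤ, ‖stripCoeff (2 * m) g (-n) 0‖ = ‖stripCoeff (2 * m) g n 0‖ := by
    intro n
    rw [stripCoeff_eq, stripCoeff_eq, norm_mul, norm_mul,
      norm_stripCoeff_neg (2 * m) (by simp) hb n]
    simp [expMode]
  -- Antiperiodicity kills the mode `n = 0`. For `n ≠ 0` the bottom line equates the moduli of the
  -- coefficients of index `n` and `-n`, while the top line equates them after weighting by
  -- different exponentials; so both vanish.
  have hzero : ∀ n : ℤ, stripCoeff (2 * m) g n 0 = 0 := by
    intro n
    by_cases hn : n = 0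
    · subst hn
      have h2 : Continuous fun x : ℝ => g (x + (0 : ℝ) * I) := gline 0 le_rfl hpi.le
      have h3 : stripCoeff (2 * m) g 0 0 = ∫ x in (0 : ℝ)..(2 * m), g (x + (0 : ℝ) * I) := by
        simp [stripCoeff, expMode]
      have h4 : ∫ x in m..(2 * m), g (x + (0 : ℝ) * I) = -∫ x in (0 : ℝ)..m, g (x + (0 : ℝ) * I) := by
        rw [← intervalIntegral.integral_neg]
        have h5 := intervalIntegral.integral_comp_add_right (a := 0) (b := m)
          (fun x : ℝ => g (x + (0 : ℝ) * I)) m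
        rw [zero_add, ← two_mul] at h5
        rw [← h5]
        refine intervalIntegral.integral_congr fun x _ => ?_
        show g ((x + m : ℝ) + (0 : ℝ) * I) = -g (x + (0 : ℝ) * I)
        rw [← ganti _ (by simp) (by simpa using hpi.le)]
        congr 1
        push_cast
        ring
      rw [h3, ← intervalIntegral.integral_add_adjacent_intervals (h2.intervalIntegrable 0 m)
        (h2.intervalIntegrable m (2 * m)), h4, add_neg_cancel]
    · have h2 := hsym0 n
      rw [hconst _ Real.pi hpi.le le_rfl, hconst _ Real.pi hpi.le le_rfl, stripCoeff_eq,
        stripCoeff_eq, norm_mul, norm_mul, htn, htn, norm_stripCoeff_neg (2 * m)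
        (f := fun w : ℂ => D w * cexp (-(a * (w - Real.pi * I) / m))) (y := Real.pi) (ε := 1)
        (by simp) (fun x => by simpa only [add_sub_cancel_right] using ht x) n, norm_expMode, norm_expMode] at h2
      rw [hconst _ Real.pi hpi.le le_rfl, stripCoeff_eq, ← norm_eq_zero, norm_mul, htn]
      rcases mul_eq_mul_left_iff.mp h2 with h3 | h3
      · rw [Real.exp_eq_exp] at h3
        exfalso
        have h4 : (n : ℝ) * (2 * Real.pi * Real.pi / m) = 0 := by
          have : 2 * Real.pi * (((- -n : ℤ)) : ℝ) * ((Real.pi : ℂ) * I).im / (2 * m) =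
            2 * Real.pi * (((-n : ℤ)) : ℝ) * ((Real.pi : ℂ) * I).im / (2 * m) := by linarith
          simp only [mul_im, ofReal_re, I_im, mul_one, ofReal_im, I_re, mul_zero, add_zero,
            neg_neg] at this
          push_cast at this
          field_simp at this ⊢
          linarith
        rcases mul_eq_zero.mp h4 with h5 | h5
        · exact hn (by exact_mod_cast h5)
        · have : 0 < 2 * Real.pi * Real.pi / m := by positivity
          linarith
      · rw [h3, zero_mul]
  have hline : ∀ n, ∫ x in (0 : ℝ)..(2 * m), g (x + z.im * I) * expMode (2 * m) (-n) x = 0 := by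
    intro n
    have h2 := hzero n
    rw [hconst n z.im h0 h1, stripCoeff_eq] at h2
    exact (mul_eq_zero.mp h2).resolve_right (Complex.exp_ne_zero _)
  have h2 := hasSum_fourier_of_summable hP (gline z.im h0 h1) (fun x => by
    rw [← gper (x + z.im * I) (by simpa using h0) (by simpa using h1)]
    congr 1
    push_cast
    ring) (by simpa only [hline] using summable_zero) z.re
  simp only [hline, mul_zero, zero_mul, Complex.re_add_im] at h2
  have h3 : g z = 0 := (hasSum_zero.unique h2).symm
  exact (mul_eq_zero.mp h3).resolve_right (Complex.exp_ne_zero _)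

/-! ### Injective holomorphic functions -/

/-- At a critical point `f - f(z)` is the `n`-th power of a local coordinate with `n ≥ 2`, so points
whose coordinates differ by an `n`-th root of unity have the same image. -/
lemma deriv_ne_zero_of_injOn {S : Set ℂ} (hS : IsOpen S) {f : ℂ → ℂ} (hd : DifferentiableOn ℂ f S)
    (hi : InjOn f S) {z : ℂ} (hz : z ∈ S) : deriv f z ≠ 0 := by
  intro h0
  have hfa : AnalyticAt ℂ f z := hd.analyticAt (hS.mem_nhds hz)
  have hFa : AnalyticAt ℂ (fun w => f w - f z) z := hfa.sub analyticAt_const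
  have hne : ¬∀ᶠ w in 𝓝 z, f w - f z = 0 := by
    intro h
    have h1 : ∀ᶠ w in 𝓝[≠] z, w = z := by
      filter_upwards [h.filter_mono nhdsWithin_le_nhds,
        mem_nhdsWithin_of_mem_nhds (hS.mem_nhds hz)] with w h1 h2
      exact hi h2 hz (sub_eq_zero.mp h1)
    obtain ⟨w, h2, h3⟩ := (h1.and self_mem_nhdsWithin).exists
    exact h3 h2
  obtain ⟨n, g, hg, hg0, he⟩ := hFa.exists_eventuallyEq_pow_smul_nonzero_iff.mpr hne
  have hn0 : n ≠ 0 := by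
    rintro rfl
    have := he.self_of_nhds
    simp at this
    exact hg0 this.symm
  have hn1 : n ≠ 1 := by
    rintro rfl
    have h1 : HasDerivAt (fun w => (w - z) ^ 1 • g w) (g z) z := by
      have h2 := ((hasDerivAt_id z).sub_const z).mul hg.differentiableAt.hasDerivAt
      simp only [id, sub_self, zero_mul, add_zero, one_mul] at h2
      refine h2.congr_of_eventuallyEq (.of_forall fun w => ?_)
      simp
    have h2 : HasDerivAt f (g z) z := by
      have := (h1.congr_of_eventuallyEq he).add_const (f z)
      simpa using this
    exact hg0 (h2.deriv.symm.trans h0)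
  obtain ⟨r, hr⟩ := IsAlgClosed.exists_pow_nat_eq (g z) (Nat.pos_of_ne_zero hn0)
  have hr0 : r ≠ 0 := by
    rintro rfl
    rw [zero_pow hn0] at hr
    exact hg0 hr.symm
  -- A holomorphic `n`-th root of `g` near `z`: the principal branch applies to `g w / g z`, and `r`
  -- is a root of `g z`.
  set k : ℂ → ℂ := fun w => r * cexp (Complex.log (g w / g z) / n) with hk
  have hka : AnalyticAt ℂ k z := by
    refine analyticAt_const.mul (AnalyticAt.cexp' (AnalyticAt.fun_div (AnalyticAt.clog
      (hg.fun_div analyticAt_const hg0) ?_) analyticAt_const (by exact_mod_cast hn0)))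
    rw [div_self hg0]
    exact one_mem_slitPlane
  have hkz : k z = r := by simp [hk, div_self hg0]
  have hkn : ∀ᶠ w in 𝓝 z, k w ^ n = g w := by
    filter_upwards [hg.continuousAt.eventually_ne hg0] with w hw
    have hn' : (n : ℂ) ≠ 0 := by exact_mod_cast hn0
    simp only [hk]
    rw [mul_pow, ← Complex.exp_nat_mul, mul_div_cancel₀ _ hn',
      Complex.exp_log (div_ne_zero hw hg0), hr, mul_div_cancel₀ _ hg0]
  have hh : HasStrictDerivAt (fun w => (w - z) * k w) r z := by
    have h1 : HasStrictDerivAt (fun w : ℂ => w - z) 1 z := (hasStrictDerivAt_id z).sub_const z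
    simpa [hkz] using h1.fun_mul hka.hasStrictDerivAt
  have hmap := hh.map_nhds_eq hr0
  simp only [sub_self, zero_mul] at hmap
  set N : Set ℂ := {w | w ∈ S ∧ f w - f z = ((w - z) * k w) ^ n} with hN
  have hNz : N ∈ 𝓝 z := by
    filter_upwards [hS.mem_nhds hz, he, hkn] with w h1 h2 h3
    exact ⟨h1, by rw [h2, mul_pow, h3, smul_eq_mul]⟩
  have himg : (fun w => (w - z) * k w) '' N ∈ 𝓝 (0 : ℂ) := by
    rw [← hmap]
    exact image_mem_map hNz
  set ζ := cexp (2 * Real.pi * I / n) with hζ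
  have hprim := Complex.isPrimitiveRoot_exp n hn0
  have hζ1 : ζ ≠ 1 := hprim.ne_one (by omega)
  have hζn : ζ ^ n = 1 := hprim.pow_eq_one
  have hmul : Tendsto (fun v : ℂ => ζ * v) (𝓝 0) (𝓝 0) := by
    simpa using (continuous_const_mul ζ).tendsto 0
  have hev : ∀ᶠ v in 𝓝[≠] (0 : ℂ), v ∈ (fun w => (w - z) * k w) '' N ∧
      ζ * v ∈ (fun w => (w - z) * k w) '' N := by
    refine Filter.Eventually.filter_mono nhdsWithin_le_nhds ?_
    filter_upwards [himg, hmul himg] with v h1 h2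
    exact ⟨h1, h2⟩
  obtain ⟨v, ⟨⟨w₁, hw₁, rfl⟩, ⟨w₂, hw₂, hv⟩⟩, hv0⟩ := (hev.and self_mem_nhdsWithin).exists
  have : f w₁ = f w₂ := by
    have h1 := hw₁.2
    have h2 := hw₂.2
    simp only at hv
    rw [hv, mul_pow, hζn, one_mul, ← h1] at h2
    exact (sub_left_inj.mp h2).symm
  have h3 := hi hw₁.1 hw₂.1 this
  subst h3
  simp only at hv
  have h4 : (ζ - 1) * ((w₁ - z) * k w₁) = 0 := by linear_combination -hv
  rcases mul_eq_zero.mp h4 with h5 | h5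
  · exact hζ1 (sub_eq_zero.mp h5)
  · exact hv0 h5

/-! ### Winding numbers -/

/-- Such a `d` takes values in the countable set `2πiℤ`, hence is constant on connected sets. Every
comparison of two logarithms uses this. -/
lemma eq_of_exp_eq_one {X : Type*} [TopologicalSpace X] {S : Set X} (hS : IsPreconnected S)
    {d : X → ℂ} (hd : ContinuousOn d S) (he : ∀ x ∈ S, cexp (d x) = 1) {x y : X} (hx : x ∈ S)
    (hy : y ∈ S) : d x = d y := by
  have h1 : (d '' S).Countable := by
    refine (countable_range fun n : ℤ => (n * (2 * Real.pi * I) : ℂ)).mono ?_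
    rintro _ ⟨x, hx, rfl⟩
    obtain ⟨n, hn⟩ := Complex.exp_eq_one_iff.mp (he x hx)
    exact ⟨n, hn.symm⟩
  exact (h1.isTotallyDisconnected (d '' S) subset_rfl (hS.image d hd)) (mem_image_of_mem d hx)
    (mem_image_of_mem d hy)

/-- The closed curve `u`, parametrized by a period `P`, has winding number `n` about `0`. -/
def HasWinding (P : ℝ) (u : ℝ → ℂ) (n : ℤ) : Prop :=
  ∃ ℓ : ℝ → ℂ, Continuous ℓ ∧ (∀ x, cexp (ℓ x) = u x) ∧ ∀ x, ℓ (x + P) = ℓ x + n * (2 * Real.pi * I)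

namespace HasWinding

variable {P : ℝ} {u v : ℝ → ℂ} {n k : ℤ}

lemma unique (h₁ : HasWinding P u n) (h₂ : HasWinding P u k) : n = k := by
  obtain ⟨ℓ, hc, he, hp⟩ := h₁
  obtain ⟨ℓ', hc', he', hp'⟩ := h₂
  have h := eq_of_exp_eq_one isPreconnected_univ (d := fun x => ℓ x - ℓ' x)
    (hc.sub hc').continuousOn (fun x _ => by
      rw [Complex.exp_sub, he, he', div_self]
      rw [← he]
      exact Complex.exp_ne_zero _) (mem_univ (0 + P)) (mem_univ 0)
  simp only [hp, hp'] at h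
  have h2 : ((n : ℂ) - k) * (2 * Real.pi * I) = 0 := by linear_combination h
  have h3 := (mul_eq_zero.mp h2).resolve_right Complex.two_pi_I_ne_zero
  exact_mod_cast sub_eq_zero.mp h3

lemma mul (h₁ : HasWinding P u n) (h₂ : HasWinding P v k) :
    HasWinding P (fun x => u x * v x) (n + k) := by
  obtain ⟨ℓ, hc, he, hp⟩ := h₁
  obtain ⟨ℓ', hc', he', hp'⟩ := h₂
  refine ⟨fun x => ℓ x + ℓ' x, hc.add hc', fun x => by rw [Complex.exp_add, he, he'], fun x => ?_⟩
  simp only [hp, hp']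
  push_cast
  ring

lemma inv (h₁ : HasWinding P u n) : HasWinding P (fun x => (u x)⁻¹) (-n) := by
  obtain ⟨ℓ, hc, he, hp⟩ := h₁
  refine ⟨fun x => -ℓ x, hc.neg, fun x => by rw [Complex.exp_neg, he], fun x => ?_⟩
  simp only [hp]
  push_cast
  ring

lemma const (P : ℝ) {c : ℂ} (hc : c ≠ 0) : HasWinding P (fun _ => c) 0 :=
  ⟨fun _ => Complex.log c, continuous_const, fun _ => Complex.exp_log hc, fun _ => by simp⟩

lemma of_norm_sub_one_lt (hc : Continuous v) (hp : ∀ x, v (x + P) = v x) (h : ∀ x, ‖v x - 1‖ < 1) :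
    HasWinding P v 0 := by
  have hs : ∀ x, v x ∈ slitPlane := fun x => by
    refine mem_slitPlane_of_norm_lt_one (z := v x - 1) (h x) |> fun h => ?_
    simpa using h
  exact ⟨fun x => Complex.log (v x), hc.clog hs,
    fun x => Complex.exp_log (slitPlane_ne_zero (hs x)), fun x => by simp [hp]⟩

end HasWinding

/-- Winding numbers about nearby points agree. -/
lemma eventually_hasWinding_sub_iff {P : ℝ} (hP : 0 < P) {u : ℝ → ℂ} (hc : Continuous u)
    (hp : ∀ x, u (x + P) = u x) {p : ℂ} (hne : ∀ x, u x ≠ p) :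
    ∀ᶠ q in 𝓝 p, ∀ n, HasWinding P (fun x => u x - p) n ↔ HasWinding P (fun x => u x - q) n := by
  obtain ⟨x₀, -, hx₀⟩ := (isCompact_Icc (a := (0 : ℝ)) (b := P)).exists_isMinOn
    ⟨0, le_rfl, hP.le⟩ (f := fun x => ‖u x - p‖) (by fun_prop)
  have hmin : ∀ x, ‖u x₀ - p‖ ≤ ‖u x - p‖ := by
    intro x
    have hper : Function.Periodic u P := hp
    obtain ⟨y, hy, hxy⟩ := hper.exists_mem_Ico₀ hP x
    rw [hxy]
    exact hx₀ ⟨hy.1, hy.2.le⟩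
  have hpos : 0 < ‖u x₀ - p‖ := norm_pos_iff.mpr (sub_ne_zero.mpr (hne x₀))
  filter_upwards [Metric.ball_mem_nhds p hpos] with q hq
  rw [Metric.mem_ball, dist_eq_norm] at hq
  have hne' : ∀ x, u x - p ≠ 0 := fun x => sub_ne_zero.mpr (hne x)
  -- If `q` is closer to `p` than the curve is, the quotient stays within distance `1` of `1` and
  -- does not wind.
  have hw : HasWinding P (fun x => (u x - q) / (u x - p)) 0 := by
    refine HasWinding.of_norm_sub_one_lt ((hc.sub continuous_const).div
      (hc.sub continuous_const) hne') (fun x => by rw [hp]) fun x => ?_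
    have : (u x - q) / (u x - p) - 1 = -(q - p) / (u x - p) := by
      field_simp [hne' x]
      ring
    rw [this, norm_div, norm_neg, div_lt_one (norm_pos_iff.mpr (hne' x))]
    exact hq.trans_le (hmin x)
  have hq0 : ∀ x, u x - q ≠ 0 := by
    obtain ⟨ℓ, -, he, -⟩ := hw
    intro x h
    have := he x
    simp only [h, zero_div] at this
    exact Complex.exp_ne_zero _ this
  intro n
  constructor
  · intro h
    have := h.mul hw
    rw [add_zero] at this
    convert this using 2 with x
    field_simp [hne' x]
  · intro h
    have := h.mul hw.inv
    rw [neg_zero, add_zero] at this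
    convert this using 2 with x
    field_simp [hne' x, hq0 x]

/-- The winding number is constant on connected sets that do not meet the curve. -/
lemma hasWinding_sub_iff_of_isPreconnected {P : ℝ} (hP : 0 < P) {u : ℝ → ℂ} (hc : Continuous u)
    (hp : ∀ x, u (x + P) = u x) {C : Set ℂ} (hC : IsPreconnected C) (hne : ∀ x, u x ∉ C) {p q : ℂ}
    (hpC : p ∈ C) (hqC : q ∈ C) (n : ℤ) :
    HasWinding P (fun x => u x - p) n ↔ HasWinding P (fun x => u x - q) n := by
  refine IsPreconnected.induction₂' hC (fun p q => ∀ n, HasWinding P (fun x => u x - p) n ↔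
    HasWinding P (fun x => u x - q) n) (fun x hx => ?_) (fun x y z _ _ _ h1 h2 n =>
      (h1 n).trans (h2 n)) hpC hqC n
  filter_upwards [(eventually_hasWinding_sub_iff hP hc hp
    (fun y h => hne y (h ▸ hx))).filter_mono nhdsWithin_le_nhds] with y hy
  exact ⟨hy, fun n => (hy n).symm⟩

/-! ### A logarithm of the difference quotient of a conformal map -/

lemma isOpen_strip : IsOpen strip :=
  (isOpen_lt continuous_const continuous_im).inter (isOpen_lt continuous_im continuous_const)

lemma convex_strip : Convex ℝ strip := (convex_halfSpace_im_gt 0).inter (convex_halfSpace_im_lt _)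

lemma add_ofReal_mem_strip {z : ℂ} (hz : z ∈ strip) (x : ℝ) : z + x ∈ strip := by
  simpa [strip] using hz

lemma add_int_mul_mem_strip {m : ℝ} {z : ℂ} (hz : z ∈ strip) (k : ℤ) : z + k * m ∈ strip := by
  simpa using add_ofReal_mem_strip hz (k * m)

lemma IsUniformization.add_int_mul {m : ℝ} {U : Set ℂ} {φ : ℂ → ℂ} (hφ : IsUniformization m U φ)
    {z : ℂ} (hz : z ∈ strip) (k : ℤ) : φ (z + k * m) = φ z + k := by
  induction k using Int.induction_on with
  | zero => simp
  | succ n ih =>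
    have := hφ.equivariant (z + n * m) (by simpa using add_int_mul_mem_strip (m := m) hz n)
    push_cast at ih ⊢
    rw [← add_assoc, ← ih, ← this]
    congr 1
    ring
  | pred n ih =>
    have := hφ.equivariant (z + (-n - 1 : ℤ) * m) (add_int_mul_mem_strip hz _)
    have h2 : z + (-n - 1 : ℤ) * m + m = z + (-n : ℤ) * m := by push_cast; ring
    rw [h2, ih] at this
    push_cast at this ⊢
    linear_combination -this

lemma IsUniformization.deriv_ne_zero {m : ℝ} {U : Set ℂ} {φ : ℂ → ℂ}
    (hφ : IsUniformization m U φ) {z : ℂ} (hz : z ∈ strip) : deriv φ z ≠ 0 :=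
  deriv_ne_zero_of_injOn isOpen_strip hφ.holomorphic hφ.bijective.injOn hz

lemma IsUniformization.analyticAt {m : ℝ} {U : Set ℂ} {φ : ℂ → ℂ}
    (hφ : IsUniformization m U φ) {z : ℂ} (hz : z ∈ strip) : AnalyticAt ℂ φ z :=
  hφ.holomorphic.analyticAt (isOpen_strip.mem_nhds hz)

lemma IsUniformization.deriv_add_period {m : ℝ} {U : Set ℂ} {φ : ℂ → ℂ}
    (hφ : IsUniformization m U φ) {z : ℂ} (hz : z ∈ strip) : deriv φ (z + m) = deriv φ z := by
  rw [← deriv_comp_add_const]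
  have : (fun x => φ (x + m)) =ᶠ[𝓝 z] fun x => φ x + 1 := by
    filter_upwards [isOpen_strip.mem_nhds hz] with w hw using hφ.equivariant w hw
  rw [this.deriv_eq, deriv_add_const]

lemma exp_two_pi_mul_eq_iff {z w : ℂ} :
    cexp (2 * Real.pi * I * z) = cexp (2 * Real.pi * I * w) ↔ ∃ k : ℤ, z = w + k := by
  rw [Complex.exp_eq_exp_iff_exists_int]
  refine exists_congr fun k => ?_
  constructor
  · intro h
    have h2 : (2 * Real.pi * I) * (z - (w + k)) = 0 := by linear_combination h
    exact sub_eq_zero.mp ((mul_eq_zero.mp h2).resolve_left Complex.two_pi_I_ne_zero)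
  · rintro rfl
    ring

/-- Divided differences of an analytic function are jointly continuous on the diagonal. -/
lemma continuousAt_dslope_diag {f : ℂ → ℂ} {z : ℂ} (hf : AnalyticAt ℂ f z) :
    ContinuousAt (fun p : ℂ × ℂ => dslope f p.1 p.2) (z, z) := by
  have hs := hf.hasStrictDerivAt
  replace hs := hs.isLittleO
  rw [Metric.continuousAt_iff']
  intro ε hε
  have hd := Metric.continuousAt_iff'.mp hf.deriv.continuousAt ε hε
  have hd' : ∀ᶠ p : ℂ × ℂ in 𝓝 (z, z), dist (deriv f p.1) (deriv f z) < ε :=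
    (continuous_fst.tendsto (z, z)).eventually hd
  filter_upwards [hd', hs.def (half_pos hε)] with p h1 h2
  simp only [dslope_same]
  by_cases h : p.2 = p.1
  · rw [h, dslope_same]
    exact h1
  · have hne : p.1 - p.2 ≠ 0 := sub_ne_zero.mpr fun h' => h h'.symm
    rw [dslope_of_ne _ h, slope_def_field, dist_eq_norm]
    have e : (f p.2 - f p.1) / (p.2 - p.1) - deriv f z =
        (f p.1 - f p.2 - (p.1 - p.2) • deriv f z) / (p.1 - p.2) := by
      have : p.2 - p.1 ≠ 0 := sub_ne_zero.mpr h
      rw [smul_eq_mul]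
      field_simp
      ring
    rw [e, norm_div]
    rw [ContinuousLinearMap.toSpanSingleton_apply] at h2
    calc _ ≤ ε / 2 * ‖p.1 - p.2‖ / ‖p.1 - p.2‖ := by gcongr
      _ = ε / 2 := mul_div_cancel_right₀ _ (norm_ne_zero_iff.mpr hne)
      _ < ε := by linarith

/-- The exponential `e^{2πiw/m}` identifying `ℂ / mℤ` with the punctured plane. -/
def cylExp (m : ℝ) (w : ℂ) : ℂ := cexp (2 * Real.pi * I * (w / m))

lemma cylExp_eq_iff {m : ℝ} (hm : 0 < m) {z w : ℂ} :
    cylExp m z = cylExp m w ↔ ∃ k : ℤ, z = w + k * m := by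
  have hm' : (m : ℂ) ≠ 0 := by exact_mod_cast hm.ne'
  rw [cylExp, cylExp, exp_two_pi_mul_eq_iff]
  refine exists_congr fun k => ?_
  rw [div_eq_iff hm', add_mul, div_mul_cancel₀ _ hm']

lemma cylExp_add_int_mul {m : ℝ} (hm : 0 < m) (w : ℂ) (k : ℤ) :
    cylExp m (w + k * m) = cylExp m w := (cylExp_eq_iff hm).mpr ⟨k, rfl⟩

lemma cylExp_ne_zero (m : ℝ) (w : ℂ) : cylExp m w ≠ 0 := Complex.exp_ne_zero _

lemma norm_cylExp (m : ℝ) (w : ℂ) : ‖cylExp m w‖ = Real.exp (-(2 * Real.pi * w.im / m)) := by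
  rw [cylExp, Complex.norm_exp]
  congr 1
  rw [← mul_div_assoc, Complex.div_ofReal_re]
  simp [neg_div]

lemma hasDerivAt_cylExp (m : ℝ) (w : ℂ) :
    HasDerivAt (cylExp m) (2 * Real.pi * I / m * cylExp m w) w := by
  have := (((hasDerivAt_id w).div_const (m : ℂ)).const_mul (2 * Real.pi * I : ℂ)).cexp
  refine HasDerivAt.congr_deriv this ?_
  rw [cylExp, id_eq]
  ring

lemma analyticAt_cylExp (m : ℝ) (w : ℂ) : AnalyticAt ℂ (cylExp m) w :=
  (Differentiable.analyticAt (fun w => (hasDerivAt_cylExp m w).differentiableAt) w)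

/-- The image of a conformal map in the punctured plane. -/
def expOf (φ : ℂ → ℂ) (w : ℂ) : ℂ := cexp (2 * Real.pi * I * φ w)

/-- The difference quotient `(e^{2πiφ(w')} - e^{2πiφ(w)}) / (e^{2πiw'/m} - e^{2πiw/m})`. -/
def cylQuot (m : ℝ) (φ : ℂ → ℂ) (p : ℂ × ℂ) : ℂ :=
  open Classical in
  if cylExp m p.1 = cylExp m p.2 then deriv (expOf φ) p.1 / deriv (cylExp m) p.1
  else (expOf φ p.2 - expOf φ p.1) / (cylExp m p.2 - cylExp m p.1)

section Uniformization

variable {m : ℝ} {U : Set ℂ} {φ : ℂ → ℂ}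

lemma IsUniformization.expOf_eq_iff (hm : 0 < m) (hφ : IsUniformization m U φ) {z w : ℂ}
    (hz : z ∈ strip) (hw : w ∈ strip) : expOf φ z = expOf φ w ↔ cylExp m z = cylExp m w := by
  rw [expOf, expOf, exp_two_pi_mul_eq_iff, cylExp_eq_iff hm]
  refine exists_congr fun k => ?_
  rw [← hφ.add_int_mul hw k]
  exact hφ.bijective.injOn.eq_iff hz (add_int_mul_mem_strip hw k)

lemma IsUniformization.expOf_add_int_mul (hφ : IsUniformization m U φ) {z : ℂ} (hz : z ∈ strip)
    (k : ℤ) : expOf φ (z + k * m) = expOf φ z :=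
  exp_two_pi_mul_eq_iff.mpr ⟨k, hφ.add_int_mul hz k⟩

lemma IsUniformization.analyticAt_expOf (hφ : IsUniformization m U φ) {z : ℂ} (hz : z ∈ strip) :
    AnalyticAt ℂ (expOf φ) z :=
  AnalyticAt.cexp' (analyticAt_const.mul (hφ.analyticAt hz))

lemma IsUniformization.deriv_expOf (hφ : IsUniformization m U φ) {z : ℂ} (hz : z ∈ strip) :
    deriv (expOf φ) z = 2 * Real.pi * I * deriv φ z * expOf φ z := by
  have := (((hφ.analyticAt hz).differentiableAt.hasDerivAt).const_mul (2 * Real.pi * I : ℂ)).cexp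
  rw [show expOf φ = fun w => cexp (2 * Real.pi * I * φ w) from rfl, this.deriv]
  ring

lemma deriv_cylExp_ne_zero (hm : 0 < m) (w : ℂ) : deriv (cylExp m) w ≠ 0 := by
  rw [(hasDerivAt_cylExp m w).deriv]
  have hm' : (m : ℂ) ≠ 0 := by exact_mod_cast hm.ne'
  exact mul_ne_zero (div_ne_zero Complex.two_pi_I_ne_zero hm') (cylExp_ne_zero m w)

/-- Where the two exponentials `cylExp` differ this is injectivity of `φ` modulo periods; where they
coincide it is `φ' ≠ 0`. -/
lemma IsUniformization.cylQuot_ne_zero (hm : 0 < m) (hφ : IsUniformization m U φ) {p : ℂ × ℂ}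
    (hp : p ∈ strip ×ˢ strip) : cylQuot m φ p ≠ 0 := by
  rw [cylQuot]
  split_ifs with h
  · refine div_ne_zero ?_ (deriv_cylExp_ne_zero hm _)
    rw [hφ.deriv_expOf hp.1]
    exact mul_ne_zero (mul_ne_zero Complex.two_pi_I_ne_zero (hφ.deriv_ne_zero hp.1))
      (Complex.exp_ne_zero _)
  · refine div_ne_zero (sub_ne_zero.mpr fun h' => h ?_) (sub_ne_zero.mpr fun h' => h h'.symm)
    exact ((hφ.expOf_eq_iff hm hp.2 hp.1).mp h').symm

lemma IsUniformization.cylQuot_add_int_mul (hm : 0 < m) (hφ : IsUniformization m U φ) {p : ℂ × ℂ}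
    (hp : p ∈ strip ×ˢ strip) (k : ℤ) : cylQuot m φ (p.1, p.2 + k * m) = cylQuot m φ p := by
  simp only [cylQuot]
  rw [cylExp_add_int_mul hm, hφ.expOf_add_int_mul hp.2]

lemma IsUniformization.continuousAt_cylQuot_diag (hm : 0 < m) (hφ : IsUniformization m U φ)
    {w : ℂ} (hw : w ∈ strip) : ContinuousAt (cylQuot m φ) (w, w) := by
  have h1 := continuousAt_dslope_diag (hφ.analyticAt_expOf hw)
  have h2 := continuousAt_dslope_diag (analyticAt_cylExp m w)
  have h3 : dslope (cylExp m) w w ≠ 0 := by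
    rw [dslope_same]
    exact deriv_cylExp_ne_zero hm w
  refine (h1.div h2 h3).congr ?_
  filter_upwards [h2.eventually_ne h3] with p hp
  rw [cylQuot]
  by_cases h : p.2 = p.1
  · simp [h]
  · have h4 : cylExp m p.1 ≠ cylExp m p.2 := by
      intro h'
      apply hp
      rw [dslope_of_ne _ h, slope_def_field, h', sub_self, zero_div]
    rw [if_neg h4, Pi.div_apply, dslope_of_ne _ h, dslope_of_ne _ h, slope_def_field,
      slope_def_field, div_div_div_cancel_right₀ (sub_ne_zero.mpr h)]

/-- Where the denominator vanishes, a period in the second variable moves the point to the diagonal;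
there numerator and denominator are replaced by divided differences. -/
lemma IsUniformization.continuousAt_cylQuot (hm : 0 < m) (hφ : IsUniformization m U φ)
    {p : ℂ × ℂ} (hp : p ∈ strip ×ˢ strip) : ContinuousAt (cylQuot m φ) p := by
  by_cases h : cylExp m p.2 = cylExp m p.1
  · obtain ⟨k, hk⟩ := (cylExp_eq_iff hm).mp h
    have h1 : ContinuousAt (fun q : ℂ × ℂ => cylQuot m φ (q.1, q.2 + (-k : ℤ) * m)) p := by
      refine ContinuousAt.comp (g := cylQuot m φ) (f := fun q : ℂ × ℂ =>
        (q.1, q.2 + (-k : ℤ) * (m : ℂ))) ?_ (by fun_prop)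
      have : (p.1, p.2 + (-k : ℤ) * (m : ℂ)) = (p.1, p.1) := by
        rw [hk]
        push_cast
        ring_nf
      rw [this]
      exact hφ.continuousAt_cylQuot_diag hm hp.1
    refine h1.congr ?_
    filter_upwards [(isOpen_strip.prod isOpen_strip).mem_nhds hp] with q hq
    exact hφ.cylQuot_add_int_mul hm hq _
  · have h1 : ContinuousAt (fun q : ℂ × ℂ => cylExp m q.2 - cylExp m q.1) p :=
      ((analyticAt_cylExp m p.2).continuousAt.comp continuousAt_snd).sub
        ((analyticAt_cylExp m p.1).continuousAt.comp continuousAt_fst)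
    have h2 : ContinuousAt (fun q : ℂ × ℂ => expOf φ q.2 - expOf φ q.1) p :=
      ((hφ.analyticAt_expOf hp.2).continuousAt.comp continuousAt_snd).sub
        ((hφ.analyticAt_expOf hp.1).continuousAt.comp continuousAt_fst)
    have h3 : cylExp m p.2 - cylExp m p.1 ≠ 0 := sub_ne_zero.mpr h
    refine (h2.div h1 h3).congr ?_
    filter_upwards [h1.eventually_ne h3] with q hq
    rw [cylQuot, if_neg fun h' => hq (by rw [h', sub_self])]
    rfl

lemma cylQuot_symm (p : ℂ × ℂ) (h : cylExp m p.1 ≠ cylExp m p.2 ∨ p.1 = p.2) :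
    cylQuot m φ p.swap = cylQuot m φ p := by
  rcases h with h | h
  · rw [cylQuot, cylQuot, if_neg h, if_neg (fun h' => h h'.symm), Prod.fst_swap, Prod.snd_swap,
      ← neg_sub, ← neg_sub (cylExp m p.2), neg_div_neg_eq]
  · rw [show p.swap = p from Prod.ext h.symm h]

/-- The difference quotient has a logarithm; `n` is its additive period. -/
lemma IsUniformization.exists_log_cylQuot (hm : 0 < m) (hφ : IsUniformization m U φ) :
    ∃ (L : ℂ × ℂ → ℂ) (n : ℤ), ContinuousOn L (strip ×ˢ strip) ∧
      (∀ p ∈ strip ×ˢ strip, cexp (L p) = cylQuot m φ p) ∧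
      (∀ p ∈ strip ×ˢ strip, L (p.1, p.2 + m) = L p + n * (2 * Real.pi * I)) ∧
      ∀ w ∈ strip, L (w + m, w + m) = L (w, w) + 2 * n * (2 * Real.pi * I) := by
  have hne : (strip ×ˢ strip).Nonempty := by
    refine ⟨(Real.pi / 2 * I, Real.pi / 2 * I), ?_⟩
    have := Real.pi_pos
    have h : (Real.pi / 2 * I : ℂ) ∈ strip := by
      constructor <;> simp <;> linarith
    exact ⟨h, h⟩
  have hconv : Convex ℝ (strip ×ˢ strip) := convex_strip.prod convex_strip
  -- A nonvanishing continuous function on this convex set has a logarithm.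
  have hsc : IsSimplyConnected (strip ×ˢ strip) := by
    have := hconv.contractibleSpace hne
    exact SimplyConnectedSpace.ofContractible _
  obtain ⟨L, hL, he⟩ := exists_continuousOn_eqOn_exp_comp hsc (isOpen_strip.prod isOpen_strip)
    (g := cylQuot m φ) (fun p hp => (hφ.continuousAt_cylQuot hm hp).continuousWithinAt) (by
      rintro ⟨p, hp, h⟩
      exact hφ.cylQuot_ne_zero hm hp h)
  replace he : ∀ p ∈ strip ×ˢ strip, cexp (L p) = cylQuot m φ p := fun p hp => he hp
  have hLne : ∀ p ∈ strip ×ˢ strip, cylQuot m φ p ≠ 0 := fun p hp => hφ.cylQuot_ne_zero hm hp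
  have hshift : ∀ p ∈ strip ×ˢ strip, (p.1, p.2 + (m : ℂ)) ∈ strip ×ˢ strip :=
    fun p hp => ⟨hp.1, add_ofReal_mem_strip hp.2 m⟩
  have hpre := hconv.isPreconnected
  obtain ⟨p₀, hp₀⟩ := hne
  have hLs : ContinuousOn (fun p : ℂ × ℂ => L (p.1, p.2 + m)) (strip ×ˢ strip) :=
    ContinuousOn.comp hL (by fun_prop) hshift
  have hexp : ∀ p ∈ strip ×ˢ strip, cexp (L (p.1, p.2 + m) - L p) = 1 := by
    intro p hp
    rw [Complex.exp_sub, he _ (hshift p hp), he p hp]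
    have := hφ.cylQuot_add_int_mul hm hp 1
    rw [Int.cast_one, one_mul] at this
    rw [this, div_self (hLne p hp)]
  obtain ⟨n, hn⟩ := Complex.exp_eq_one_iff.mp (hexp p₀ hp₀)
  have hper : ∀ p ∈ strip ×ˢ strip, L (p.1, p.2 + m) = L p + n * (2 * Real.pi * I) := by
    intro p hp
    have := eq_of_exp_eq_one hpre (hLs.sub hL) hexp hp hp₀
    rw [Pi.sub_apply, Pi.sub_apply, hn] at this
    linear_combination this
  -- The difference of the two logarithms is constant and vanishes on the diagonal. By symmetry both
  -- variables have the same additive period, which accounts for the `2 * n` on the diagonal.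
  have hsym : ∀ p ∈ strip ×ˢ strip, L p.swap = L p := by
    have hsw : ∀ p ∈ strip ×ˢ strip, p.swap ∈ strip ×ˢ strip := fun p hp => ⟨hp.2, hp.1⟩
    have hLsw : ContinuousOn (fun p : ℂ × ℂ => L p.swap) (strip ×ˢ strip) :=
      ContinuousOn.comp hL continuous_swap.continuousOn hsw
    have hdiff : ∀ p ∈ strip ×ˢ strip, cylQuot m φ p.swap = cylQuot m φ p := by
      intro p hp
      by_cases h : cylExp m p.1 = cylExp m p.2
      · obtain ⟨k, hk⟩ := (cylExp_eq_iff hm).mp h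
        have h1 := hφ.cylQuot_add_int_mul hm (p := (p.2, p.2)) ⟨hp.2, hp.2⟩ k
        have h2 := hφ.cylQuot_add_int_mul hm (p := (p.1, p.1)) ⟨hp.1, hp.1⟩ (-k)
        have h3 : p.1 + (-k : ℤ) * (m : ℂ) = p.2 := by rw [hk]; push_cast; ring
        simp only [← hk] at h1
        simp only [h3] at h2
        rw [show p.swap = (p.2, p.1) from rfl, h1]
        rw [show p = (p.1, p.2) from rfl, h2]
        have e : expOf φ p.1 = expOf φ p.2 := (hφ.expOf_eq_iff hm hp.1 hp.2).mpr h
        have hd : deriv φ p.1 = deriv φ p.2 := by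
          have : ∀ (z : ℂ), z ∈ strip → ∀ k : ℤ, deriv φ (z + k * m) = deriv φ z := by
            intro z hz k
            rw [← deriv_comp_add_const]
            have : (fun x => φ (x + k * m)) =ᶠ[𝓝 z] fun x => φ x + k := by
              filter_upwards [isOpen_strip.mem_nhds hz] with w hw using hφ.add_int_mul hw k
            rw [this.deriv_eq, deriv_add_const]
          rw [hk, this _ hp.2]
        simp only [cylQuot, if_pos, (hasDerivAt_cylExp m _).deriv, hφ.deriv_expOf hp.1,
          hφ.deriv_expOf hp.2, h, e, hd]
      · exact cylQuot_symm p (Or.inl h)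
    intro p hp
    have h1 := eq_of_exp_eq_one hpre (hLsw.sub hL) (fun q hq => by
      rw [Pi.sub_apply, Complex.exp_sub, he _ (hsw q hq), he q hq, hdiff q hq, div_self (hLne q hq)]) hp
      (⟨hp.1, hp.1⟩ : (p.1, p.1) ∈ strip ×ˢ strip)
    rw [Pi.sub_apply, Pi.sub_apply, Prod.swap_prod_mk, Prod.swap_prod_mk, sub_self] at h1
    exact sub_eq_zero.mp h1
  refine ⟨L, n, hL, he, hper, fun w hw => ?_⟩
  have hwm := add_ofReal_mem_strip hw m
  have h1 := hper (w + m, w) ⟨hwm, hw⟩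
  have h2 := hsym (w, w + m) ⟨hw, hwm⟩
  have h3 := hper (w, w) ⟨hw, hw⟩
  simp only [Prod.swap_prod_mk] at h1 h2 h3
  rw [h1, h2, h3]
  ring

end Uniformization

/-! ### Boundary correspondence -/

section Uniformization

variable {m : ℝ} {U : Set ℂ} {φ : ℂ → ℂ}

lemma line_mem_strip {y : ℝ} (h0 : 0 < y) (h1 : y < Real.pi) (x : ℝ) : (x + y * I : ℂ) ∈ strip := by
  simp [strip, h0, h1]

lemma IsUniformization.continuous_line (hφ : IsUniformization m U φ) {y : ℝ} (h0 : 0 < y)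
    (h1 : y < Real.pi) : Continuous fun x : ℝ => φ (x + y * I) := by
  rw [continuous_iff_continuousAt]
  intro x
  exact ContinuousAt.comp (g := φ) (hφ.analyticAt (line_mem_strip h0 h1 x)).continuousAt
    (DimerCylinder.continuous_line y).continuousAt

lemma IsUniformization.continuous_expOf_line (hφ : IsUniformization m U φ) {y : ℝ} (h0 : 0 < y)
    (h1 : y < Real.pi) : Continuous fun x : ℝ => expOf φ (x + y * I) :=
  Complex.continuous_exp.comp (continuous_const.mul (hφ.continuous_line h0 h1))

lemma IsUniformization.expOf_line_add (hφ : IsUniformization m U φ) {y : ℝ} (h0 : 0 < y)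
    (h1 : y < Real.pi) (x : ℝ) : expOf φ ((x + m : ℝ) + y * I) = expOf φ (x + y * I) := by
  have := hφ.expOf_add_int_mul (line_mem_strip h0 h1 x) 1
  rw [← this]
  congr 1
  push_cast
  ring

lemma IsUniformization.hasWinding_expOf (hφ : IsUniformization m U φ) {y : ℝ} (h0 : 0 < y)
    (h1 : y < Real.pi) : HasWinding m (fun x => expOf φ (x + y * I)) 1 := by
  refine ⟨fun x => 2 * Real.pi * I * φ (x + y * I), continuous_const.mul (hφ.continuous_line h0 h1),
    fun x => rfl, fun x => ?_⟩
  have := hφ.equivariant _ (line_mem_strip h0 h1 x)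
  have h2 : ((x + m : ℝ) : ℂ) + y * I = x + y * I + m := by push_cast; ring
  simp only [h2, this]
  push_cast
  ring

lemma cylExp_line_add (hm : 0 < m) (x y : ℝ) :
    cylExp m ((x + m : ℝ) + y * I) = cylExp m (x + y * I) := by
  rw [← cylExp_add_int_mul hm (x + y * I) 1]
  congr 1
  push_cast
  ring

lemma continuous_cylExp_line (m y : ℝ) : Continuous fun x : ℝ => cylExp m (x + y * I) := by
  unfold cylExp
  fun_prop

/-- `cylExp` sends higher lines to smaller circles about `0`, so a point below the line lies outside
its circle. -/
lemma hasWinding_cylExp_sub_of_lt (hm : 0 < m) {y : ℝ} {w : ℂ} (h : w.im < y) :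
    HasWinding m (fun x => cylExp m (x + y * I) - cylExp m w) 0 := by
  have hw := cylExp_ne_zero m w
  have h1 : HasWinding m (fun x => 1 - cylExp m (x + y * I) / cylExp m w) 0 := by
    refine HasWinding.of_norm_sub_one_lt (continuous_const.sub
      ((continuous_cylExp_line m y).div_const _)) (fun x => by rw [cylExp_line_add hm]) fun x => ?_
    rw [sub_sub_cancel_left, norm_neg, norm_div, norm_cylExp, norm_cylExp, ← Real.exp_sub,
      Real.exp_lt_one_iff]
    simp only [add_im, ofReal_im, mul_im, ofReal_re, I_im, mul_one, I_re, mul_zero, add_zero,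
      zero_add]
    rw [sub_neg_eq_add, neg_add_lt_iff_lt_add, add_zero]
    have := Real.pi_pos
    gcongr
  have h2 := (HasWinding.const m (neg_ne_zero.mpr hw)).mul h1
  rw [add_zero] at h2
  convert h2 using 2 with x
  field_simp
  ring

/-- Here the point lies inside the circle and is encircled once, as `0` is. -/
lemma hasWinding_cylExp_sub_of_gt (hm : 0 < m) {y : ℝ} {w : ℂ} (h : y < w.im) :
    HasWinding m (fun x => cylExp m (x + y * I) - cylExp m w) 1 := by
  have hm' : (m : ℂ) ≠ 0 := by exact_mod_cast hm.ne'
  have h0 : HasWinding m (fun x => cylExp m (x + y * I)) 1 := by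
    refine ⟨fun x => 2 * Real.pi * I * ((x + y * I) / m), by fun_prop, fun x => rfl, fun x => ?_⟩
    push_cast
    field_simp
    ring
  have hz : ∀ x : ℝ, cylExp m (x + y * I) ≠ 0 := fun x => cylExp_ne_zero m _
  have h1 : HasWinding m (fun x => 1 - cylExp m w / cylExp m (x + y * I)) 0 := by
    refine HasWinding.of_norm_sub_one_lt (continuous_const.sub
      (continuous_const.div (continuous_cylExp_line m y) hz))
      (fun x => by rw [cylExp_line_add hm]) fun x => ?_
    rw [sub_sub_cancel_left, norm_neg, norm_div, norm_cylExp, norm_cylExp, ← Real.exp_sub,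
      Real.exp_lt_one_iff]
    simp only [add_im, ofReal_im, mul_im, ofReal_re, I_im, mul_one, I_re, mul_zero, add_zero,
      zero_add]
    rw [sub_neg_eq_add, neg_add_lt_iff_lt_add, add_zero]
    have := Real.pi_pos
    gcongr
  have h2 := h0.mul h1
  rw [add_zero] at h2
  convert h2 using 2 with x
  field_simp [hz x]

lemma IsUniformization.expOf_sub_eq (hm : 0 < m) (hφ : IsUniformization m U φ) {z w : ℂ}
    (hz : z ∈ strip) (hw : w ∈ strip) :
    expOf φ z - expOf φ w = cylQuot m φ (w, z) * (cylExp m z - cylExp m w) := by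
  rw [cylQuot]
  split_ifs with h
  · simp only at h
    rw [h, sub_self, mul_zero, (hφ.expOf_eq_iff hm hz hw).mpr h.symm, sub_self]
  · rw [div_mul_cancel₀]
    exact sub_ne_zero.mpr fun h' => h h'.symm

/-- `expOf_sub_eq` factors the difference: the quotient winds `n` times because of its logarithm,
the `cylExp` difference `k` times. -/
lemma IsUniformization.hasWinding_expOf_sub (hm : 0 < m) (hφ : IsUniformization m U φ)
    {L : ℂ × ℂ → ℂ} {n k : ℤ} (hL : ContinuousOn L (strip ×ˢ strip))
    (he : ∀ p ∈ strip ×ˢ strip, cexp (L p) = cylQuot m φ p)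
    (hp : ∀ p ∈ strip ×ˢ strip, L (p.1, p.2 + m) = L p + n * (2 * Real.pi * I)) {w : ℂ}
    (hw : w ∈ strip) {y : ℝ} (h0 : 0 < y) (h1 : y < Real.pi)
    (hk : HasWinding m (fun x => cylExp m (x + y * I) - cylExp m w) k) :
    HasWinding m (fun x => expOf φ (x + y * I) - expOf φ w) (n + k) := by
  have hmem : ∀ x : ℝ, (w, (x + y * I : ℂ)) ∈ strip ×ˢ strip :=
    fun x => ⟨hw, line_mem_strip h0 h1 x⟩
  have h2 : HasWinding m (fun x => cylQuot m φ (w, x + y * I)) n := by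
    refine ⟨fun x => L (w, x + y * I), hL.comp_continuous (by fun_prop) hmem,
      fun x => he _ (hmem x), fun x => ?_⟩
    have := hp _ (hmem x)
    simp only at this
    rw [← this]
    push_cast
    ring_nf
  convert h2.mul hk using 2 with x
  exact hφ.expOf_sub_eq hm (line_mem_strip h0 h1 x) hw

/-- The exponential of the upper side lies in the component of `0` in a set that the curve avoids,
so the winding number is that about `0`. -/
lemma IsUniformization.hasWinding_upper (hm : 0 < m) (hφ : IsUniformization m U φ) {a : ℂ}
    (ha : a ∈ upperSide U) {y : ℝ} (h0 : 0 < y) (h1 : y < Real.pi) :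
    HasWinding m (fun x => expOf φ (x + y * I) - cexp (2 * Real.pi * I * a)) 1 := by
  have hC := isPreconnected_connectedComponentIn
    (F := ((fun z : ℂ => cexp (2 * Real.pi * I * z)) '' U)ᶜ) (x := 0)
  rw [← hasWinding_sub_iff_of_isPreconnected hm (hφ.continuous_expOf_line h0 h1)
    (hφ.expOf_line_add h0 h1) hC ?_ (mem_connectedComponentIn ?_) ha]
  · simpa using hφ.hasWinding_expOf h0 h1
  · intro x hx
    exact connectedComponentIn_subset _ _ hx
      ⟨_, hφ.bijective.mapsTo (line_mem_strip h0 h1 x), rfl⟩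
  · rintro ⟨z, -, hz⟩
    exact Complex.exp_ne_zero _ hz

/-- The reciprocal curve `1/u` winds `-1` times about `0`, hence about `1/p`; then `u - p = -p · u ·
(1/u - 1/p)` winds `0 + 1 - 1` times. -/
lemma IsUniformization.hasWinding_lower (hm : 0 < m) (hφ : IsUniformization m U φ) {a : ℂ}
    (ha : a ∈ lowerSide U) {y : ℝ} (h0 : 0 < y) (h1 : y < Real.pi) :
    HasWinding m (fun x => expOf φ (x + y * I) - cexp (2 * Real.pi * I * a)) 0 := by
  have hC := isPreconnected_connectedComponentIn
    (F := ((fun z : ℂ => cexp (-(2 * Real.pi * I * z))) '' U)ᶜ) (x := 0)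
  have hne : ∀ x : ℝ, expOf φ (x + y * I) ≠ 0 := fun x => Complex.exp_ne_zero _
  have h2 : HasWinding m (fun x => (expOf φ (x + y * I))⁻¹ - cexp (-(2 * Real.pi * I * a))) (-1) := by
    rw [← hasWinding_sub_iff_of_isPreconnected hm (u := fun x : ℝ => (expOf φ (x + y * I))⁻¹)
      ((hφ.continuous_expOf_line h0 h1).inv₀ hne)
      (fun x => by simp only [hφ.expOf_line_add h0 h1]) hC ?_ (mem_connectedComponentIn ?_) ha]
    · simpa using (hφ.hasWinding_expOf h0 h1).inv
    · intro x hx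
      refine connectedComponentIn_subset _ _ hx
        ⟨_, hφ.bijective.mapsTo (line_mem_strip h0 h1 x), ?_⟩
      rw [expOf, ← Complex.exp_neg]
    · rintro ⟨z, -, hz⟩
      exact Complex.exp_ne_zero _ hz
  have h3 := ((HasWinding.const m (neg_ne_zero.mpr (Complex.exp_ne_zero (2 * Real.pi * I * a)))).mul
    (hφ.hasWinding_expOf h0 h1)).mul h2
  norm_num at h3
  convert h3 using 2 with x
  have := hne x
  rw [Complex.exp_neg]
  field_simp [Complex.exp_ne_zero]
  ring

lemma IsCylindricalDomain.add_int_mem (hU : IsCylindricalDomain U) (z : ℂ) (k : ℤ) :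
    z + k ∈ U ↔ z ∈ U := by
  induction k using Int.induction_on with
  | zero => simp
  | succ n ih =>
    rw [← ih, ← hU.periodic (z + (n : ℤ))]
    push_cast
    rw [add_assoc]
  | pred n ih =>
    rw [← ih, ← hU.periodic (z + (-n - 1 : ℤ))]
    push_cast
    rw [add_assoc, sub_add_cancel]

lemma IsUniformization.line_ne (hU : IsCylindricalDomain U) (hφ : IsUniformization m U φ) {a : ℂ}
    (ha : a ∉ U) {y : ℝ} (h0 : 0 < y) (h1 : y < Real.pi) (x : ℝ) :
    expOf φ (x + y * I) ≠ cexp (2 * Real.pi * I * a) := by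
  intro h
  obtain ⟨k, hk⟩ := exp_two_pi_mul_eq_iff.mp h
  have h2 := hφ.bijective.mapsTo (line_mem_strip h0 h1 x)
  rw [hk, hU.add_int_mem] at h2
  exact ha h2

/-- Sequences approaching the boundary of the strip have, up to periods, subsequences whose images
converge to boundary points. -/
lemma IsUniformization.exists_tendsto_frontier (hU : IsCylindricalDomain U)
    (hφ : IsUniformization m U φ) {w : ℕ → ℂ} (hw : ∀ k, w k ∈ strip) {t : ℝ}
    (ht : t ∉ Ioo 0 Real.pi) (hlim : Tendsto (fun k => (w k).im) atTop (𝓝 t)) :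
    ∃ a ∈ frontier U, ∃ (j : ℕ → ℤ) (κ : ℕ → ℕ), StrictMono κ ∧
      Tendsto (fun k => φ (w (κ k) + j k * m)) atTop (𝓝 a) := by
  obtain ⟨R, hR⟩ := hU.bounded
  -- Translation by periods puts the real parts of the images into `[0, 1]`; as `U` is vertically
  -- bounded, the images lie in a compact rectangle.
  set j : ℕ → ℤ := fun k => -⌊(φ (w k)).re⌋ with hj
  have hφj : ∀ k, φ (w k + j k * m) = φ (w k) + j k := fun k => hφ.add_int_mul (hw k) _
  have hmem : ∀ k, φ (w k + j k * m) ∈ Icc (0 : ℝ) 1 ×ℂ Icc (-R) R := by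
    intro k
    rw [hφj, mem_reProdIm]
    have h1 := hR _ (hφ.bijective.mapsTo (hw k))
    have h2 := Int.floor_le (φ (w k)).re
    have h3 := Int.lt_floor_add_one (φ (w k)).re
    simp only [hj, add_re, intCast_re, add_im, intCast_im, add_zero]
    push_cast
    exact ⟨⟨by linarith, by linarith⟩, abs_le.mp h1⟩
  obtain ⟨a, -, κ, hκ, ha⟩ := (isCompact_Icc.reProdIm isCompact_Icc).tendsto_subseq hmem
  refine ⟨a, ?_, fun k => j (κ k), κ, hκ, ha⟩
  rw [hU.isOpen.frontier_eq]
  refine ⟨mem_closure_of_tendsto ha (.of_forall fun k =>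
    hφ.bijective.mapsTo (add_int_mul_mem_strip (hw _) _)), fun haU => ?_⟩
  -- A limit `φ z` inside `U` is impossible: `φ` is open and injective, so the preimages would stay
  -- near `z`, away from the height `t`.
  obtain ⟨z, hz, rfl⟩ := hφ.bijective.surjOn haU
  have hzt : z.im ≠ t := fun h => ht (h ▸ hz)
  have hpos : 0 < |z.im - t| := abs_pos.mpr (sub_ne_zero.mpr hzt)
  set S : Set ℂ := strip ∩ {v | |z.im - t| / 2 < |v.im - t|} with hS
  have hSo : IsOpen S := isOpen_strip.inter (isOpen_lt continuous_const (by fun_prop))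
  have hzS : z ∈ S := ⟨hz, by simp only [mem_ofPred_eq]; linarith⟩
  have himg : φ '' S ∈ 𝓝 (φ z) := by
    rw [← (hφ.analyticAt hz).hasStrictDerivAt.map_nhds_eq (hφ.deriv_ne_zero hz)]
    exact image_mem_map (hSo.mem_nhds hzS)
  have h1 := hlim.comp hκ.tendsto_atTop
  have h2 : ∀ᶠ k in atTop, |(w (κ k)).im - t| < |z.im - t| / 2 := by
    have := Metric.tendsto_nhds.mp h1 (|z.im - t| / 2) (by linarith)
    simpa [Real.dist_eq] using this
  obtain ⟨k, hk1, hk2⟩ := (h2.and (ha himg)).exists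
  obtain ⟨v, hvS, hv⟩ := hk2
  have h3 := hφ.bijective.injOn hvS.1 (add_int_mul_mem_strip (hw (κ k)) (j (κ k))) hv
  have h4 : |z.im - t| / 2 < |v.im - t| := hvS.2
  rw [h3] at h4
  simp at h4
  linarith

/-- The winding number about a frontier point equals that about nearby image points, and it
distinguishes the two sides. -/
lemma IsUniformization.hasWinding_of_tendsto (hU : IsCylindricalDomain U) (hm : 0 < m)
    (hφ : IsUniformization m U φ) {w : ℕ → ℂ} {a : ℂ} (ha : a ∈ frontier U)
    (hlim : Tendsto (fun k => φ (w k)) atTop (𝓝 a)) {n : ℤ} {y : ℝ} (h0 : 0 < y)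
    (h1 : y < Real.pi)
    (hn : ∀ᶠ k in atTop, HasWinding m (fun x => expOf φ (x + y * I) - expOf φ (w k)) n) :
    (a ∈ upperSide U ∧ n = 1) ∨ (a ∈ lowerSide U ∧ n = 0) := by
  rw [hU.isOpen.frontier_eq] at ha
  have h2 := eventually_hasWinding_sub_iff hm (hφ.continuous_expOf_line h0 h1)
    (hφ.expOf_line_add h0 h1) (hφ.line_ne hU ha.2 h0 h1)
  have h3 : Tendsto (fun k => expOf φ (w k)) atTop (𝓝 (cexp (2 * Real.pi * I * a))) :=
    (Complex.continuous_exp.tendsto _).comp (hlim.const_mul _)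
  obtain ⟨k, h4, h5⟩ := (hn.and (h3.eventually h2)).exists
  have h6 := (h5 n).mpr h4
  have h7 : a ∈ lowerSide U ∪ upperSide U := hU.compl ▸ ha.2
  rcases h7 with h7 | h7
  · exact Or.inr ⟨h7, h6.unique (hφ.hasWinding_lower hm h7 h0 h1)⟩
  · exact Or.inl ⟨h7, h6.unique (hφ.hasWinding_upper hm h7 h0 h1)⟩

lemma exists_seq_strip {t : ℝ} (ht : t ∈ Icc 0 Real.pi) :
    ∃ w : ℕ → ℂ, (∀ k, w k ∈ strip) ∧ Tendsto (fun k => (w k).im) atTop (𝓝 t) := by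
  have h : t ∈ closure (Ioo 0 Real.pi) := by
    rwa [closure_Ioo Real.pi_pos.ne]
  obtain ⟨u, hu, hlim⟩ := mem_closure_iff_seq_limit.mp h
  exact ⟨fun k => u k * I, fun k => by simpa [strip] using hu k, by simpa using hlim⟩

/-- The additive period of the logarithm of the difference quotient vanishes, and the boundary
components correspond to each other. -/
lemma IsUniformization.boundary_correspondence (hU : IsCylindricalDomain U) (hm : 0 < m)
    (hφ : IsUniformization m U φ) {L : ℂ × ℂ → ℂ} {n : ℤ} (hL : ContinuousOn L (strip ×ˢ strip))
    (he : ∀ p ∈ strip ×ˢ strip, cexp (L p) = cylQuot m φ p)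
    (hp : ∀ p ∈ strip ×ˢ strip, L (p.1, p.2 + m) = L p + n * (2 * Real.pi * I)) :
    n = 0 ∧
    (∀ (w : ℕ → ℂ) (a : ℂ), (∀ k, w k ∈ strip) → a ∈ frontier U →
      Tendsto (fun k => (w k).im) atTop (𝓝 0) → Tendsto (fun k => φ (w k)) atTop (𝓝 a) →
      a ∈ lowerSide U) ∧
    (∀ (w : ℕ → ℂ) (a : ℂ), (∀ k, w k ∈ strip) → a ∈ frontier U →
      Tendsto (fun k => (w k).im) atTop (𝓝 Real.pi) → Tendsto (fun k => φ (w k)) atTop (𝓝 a) →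
      a ∈ upperSide U) := by
  have hpi := Real.pi_pos
  have h0 : 0 < Real.pi / 2 := by linarith
  have h1 : Real.pi / 2 < Real.pi := by linarith
  have hbot : ∀ (w : ℕ → ℂ) (a : ℂ), (∀ k, w k ∈ strip) → a ∈ frontier U →
      Tendsto (fun k => (w k).im) atTop (𝓝 0) → Tendsto (fun k => φ (w k)) atTop (𝓝 a) →
      (a ∈ upperSide U ∧ n = 1) ∨ (a ∈ lowerSide U ∧ n = 0) := by
    intro w a hw ha him hlim
    refine hφ.hasWinding_of_tendsto hU hm ha hlim h0 h1 ?_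
    filter_upwards [him.eventually_lt_const h0] with k hk
    simpa using hφ.hasWinding_expOf_sub hm hL he hp (hw k) h0 h1 (hasWinding_cylExp_sub_of_lt hm hk)
  have htop : ∀ (w : ℕ → ℂ) (a : ℂ), (∀ k, w k ∈ strip) → a ∈ frontier U →
      Tendsto (fun k => (w k).im) atTop (𝓝 Real.pi) → Tendsto (fun k => φ (w k)) atTop (𝓝 a) →
      (a ∈ upperSide U ∧ n + 1 = 1) ∨ (a ∈ lowerSide U ∧ n + 1 = 0) := by
    intro w a hw ha him hlim
    refine hφ.hasWinding_of_tendsto hU hm ha hlim h0 h1 ?_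
    filter_upwards [him.eventually_const_lt h1] with k hk
    exact hφ.hasWinding_expOf_sub hm hL he hp (hw k) h0 h1 (hasWinding_cylExp_sub_of_gt hm hk)
  -- A sequence approaching the bottom gives `n ∈ {0, 1}`, one approaching the top gives `n + 1 ∈
  -- {0, 1}`.
  have hn : n = 0 := by
    obtain ⟨w, hw, him⟩ := exists_seq_strip (t := 0) ⟨le_rfl, hpi.le⟩
    obtain ⟨a, ha, j, κ, hκ, hlim⟩ := hφ.exists_tendsto_frontier hU hw (fun h => h.1.false) him
    have h2 := hbot _ a (fun k => add_int_mul_mem_strip (hw (κ k)) (j k)) ha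
      (by simpa [Function.comp_def] using him.comp hκ.tendsto_atTop) hlim
    obtain ⟨w', hw', him'⟩ := exists_seq_strip (t := Real.pi) ⟨hpi.le, le_rfl⟩
    obtain ⟨a', ha', j', κ', hκ', hlim'⟩ :=
      hφ.exists_tendsto_frontier hU hw' (fun h => h.2.false) him'
    have h3 := htop _ a' (fun k => add_int_mul_mem_strip (hw' (κ' k)) (j' k)) ha'
      (by simpa [Function.comp_def] using him'.comp hκ'.tendsto_atTop) hlim'
    omega
  subst hn
  refine ⟨rfl, fun w a hw ha him hlim => ?_, fun w a hw ha him hlim => ?_⟩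
  · rcases hbot w a hw ha him hlim with h | h
    · omega
    · exact h.1
  · rcases htop w a hw ha him hlim with h | h
    · exact h.1
    · omega

lemma int_translate_iff (hU : IsCylindricalDomain U) {p : ℂ → Prop}
    (hp : ∀ z ∈ U, p (z + 1) ↔ p z) {z : ℂ} (hz : z ∈ U) (k : ℤ) : p (z + k) ↔ p z := by
  induction k using Int.induction_on with
  | zero => simp
  | succ n ih =>
    rw [← ih, ← hp (z + (n : ℤ)) ((hU.add_int_mem _ _).mpr hz)]
    push_cast
    rw [add_assoc]
  | pred n ih =>
    rw [← ih, ← hp (z + (-n - 1 : ℤ)) ((hU.add_int_mem _ _).mpr hz)]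
    push_cast
    rw [add_assoc, sub_add_cancel]

/-- Periodic properties that hold near the bottom boundary hold near the bottom of the strip. -/
lemma IsUniformization.eventually_bottom (hU : IsCylindricalDomain U) (hm : 0 < m)
    (hφ : IsUniformization m U φ) {p : ℂ → Prop} (hp : ∀ z ∈ U, p (z + 1) ↔ p z)
    (hb : ∀ a ∈ bottomBoundary U, ∀ᶠ z in 𝓝[U] a, p z) :
    ∃ δ > 0, ∀ w ∈ strip, w.im < δ → p (φ w) := by
  obtain ⟨L, n, hL, he, hper, -⟩ := hφ.exists_log_cylQuot hm
  obtain ⟨-, hbot, -⟩ := hφ.boundary_correspondence hU hm hL he hper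
  -- Otherwise `p` fails at points whose heights tend to `0`. Up to periods their images accumulate
  -- at a frontier point, which the boundary correspondence places on the bottom, against `hb`.
  by_contra! hcon
  choose w hw him hnp using fun k : ℕ => hcon (1 / ((k : ℝ) + 1)) (by positivity)
  have hlim : Tendsto (fun k => (w k).im) atTop (𝓝 0) :=
    squeeze_zero (fun k => (hw k).1.le) (fun k => (him k).le) tendsto_one_div_add_atTop_nhds_zero_nat
  obtain ⟨a, ha, j, κ, hκ, hlim'⟩ := hφ.exists_tendsto_frontier hU hw (fun h => h.1.false) hlim
  have hmem := fun k => add_int_mul_mem_strip (m := m) (hw (κ k)) (j k)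
  have h1 := hbot _ a hmem ha (by simpa [Function.comp_def] using hlim.comp hκ.tendsto_atTop) hlim'
  have h2 := tendsto_nhdsWithin_iff.mpr ⟨hlim', .of_forall fun k => hφ.bijective.mapsTo (hmem k)⟩
  obtain ⟨k, hk⟩ := (h2.eventually (hb a ⟨ha, h1⟩)).exists
  rw [hφ.add_int_mul (hw (κ k)), int_translate_iff hU hp (hφ.bijective.mapsTo (hw (κ k)))] at hk
  exact hnp _ hk

/-- Periodic properties that hold near the top boundary hold near the top of the strip. -/
lemma IsUniformization.eventually_top (hU : IsCylindricalDomain U) (hm : 0 < m)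
    (hφ : IsUniformization m U φ) {p : ℂ → Prop} (hp : ∀ z ∈ U, p (z + 1) ↔ p z)
    (hb : ∀ a ∈ topBoundary U, ∀ᶠ z in 𝓝[U] a, p z) :
    ∃ δ > 0, ∀ w ∈ strip, Real.pi - δ < w.im → p (φ w) := by
  obtain ⟨L, n, hL, he, hper, -⟩ := hφ.exists_log_cylQuot hm
  obtain ⟨-, -, htop⟩ := hφ.boundary_correspondence hU hm hL he hper
  by_contra! hcon
  choose w hw him hnp using fun k : ℕ => hcon (1 / ((k : ℝ) + 1)) (by positivity)
  have hlim : Tendsto (fun k => (w k).im) atTop (𝓝 Real.pi) := by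
    refine tendsto_of_tendsto_of_tendsto_of_le_of_le
      (g := fun k : ℕ => Real.pi - 1 / ((k : ℝ) + 1)) ?_ tendsto_const_nhds
      (fun k => (him k).le) (fun k => (hw k).2.le)
    simpa using tendsto_one_div_add_atTop_nhds_zero_nat.const_sub Real.pi
  obtain ⟨a, ha, j, κ, hκ, hlim'⟩ := hφ.exists_tendsto_frontier hU hw (fun h => h.2.false) hlim
  have hmem := fun k => add_int_mul_mem_strip (m := m) (hw (κ k)) (j k)
  have h1 := htop _ a hmem ha (by simpa [Function.comp_def] using hlim.comp hκ.tendsto_atTop) hlim'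
  have h2 := tendsto_nhdsWithin_iff.mpr ⟨hlim', .of_forall fun k => hφ.bijective.mapsTo (hmem k)⟩
  obtain ⟨k, hk⟩ := (h2.eventually (hb a ⟨ha, h1⟩)).exists
  rw [hφ.add_int_mul (hw (κ k)), int_translate_iff hU hp (hφ.bijective.mapsTo (hw (κ k)))] at hk
  exact hnp _ hk

/-- The derivative of the uniformization has a periodic logarithm. -/
lemma IsUniformization.exists_log_deriv (hU : IsCylindricalDomain U) (hm : 0 < m)
    (hφ : IsUniformization m U φ) : ∃ l : ℂ → ℂ, ContinuousOn l strip ∧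
      (∀ w ∈ strip, cexp (l w) = deriv φ w) ∧ ∀ w ∈ strip, l (w + m) = l w := by
  obtain ⟨L, n, hL, he, hper, hdiag⟩ := hφ.exists_log_cylQuot hm
  obtain ⟨rfl, -, -⟩ := hφ.boundary_correspondence hU hm hL he hper
  have hm' : (m : ℂ) ≠ 0 := by exact_mod_cast hm.ne'
  -- On the diagonal the quotient is `m φ'(w) e^{2πiφ(w)} / e^{2πiw/m}`, and `φ(w) - w/m` is
  -- periodic.
  refine ⟨fun w => L (w, w) - Complex.log m + 2 * Real.pi * I * (w / m - φ w), ?_, ?_, ?_⟩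
  · refine ContinuousOn.add (ContinuousOn.sub ?_ continuousOn_const)
      (continuousOn_const.mul (ContinuousOn.sub (by fun_prop) hφ.holomorphic.continuousOn))
    exact ContinuousOn.comp hL (by fun_prop) fun w hw => ⟨hw, hw⟩
  · intro w hw
    have h1 : (2 * Real.pi * I : ℂ) * (w / m - φ w) =
        2 * Real.pi * I * (w / m) - 2 * Real.pi * I * φ w := by ring
    rw [Complex.exp_add, Complex.exp_sub, he _ ⟨hw, hw⟩, Complex.exp_log hm', h1, Complex.exp_sub]
    have h2 : cylQuot m φ (w, w) = deriv (expOf φ) w / deriv (cylExp m) w := by simp [cylQuot]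
    have h3 : expOf φ w ≠ 0 := Complex.exp_ne_zero _
    have h4 := cylExp_ne_zero m w
    rw [h2, hφ.deriv_expOf hw, (hasDerivAt_cylExp m w).deriv,
      show cexp (2 * Real.pi * I * (w / m)) = cylExp m w from rfl,
      show cexp (2 * Real.pi * I * φ w) = expOf φ w from rfl]
    have := Complex.two_pi_I_ne_zero
    field_simp
  · intro w hw
    have h1 := hdiag w hw
    simp only [h1, hφ.equivariant w hw]
    push_cast
    field_simp
    ring

end Uniformization

/-! ### Logarithms on half-planes and the multiplier of a nonvanishing function -/

/-- `T` is a half-open strip in the applications, so the logarithm is taken of `v ∘ r` on an open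
convex set `S`, where `r` retracts `S` onto `T`. -/
lemma exists_log_line {S : Set ℂ} (hS : Convex ℝ S) (hSo : IsOpen S) (hne : S.Nonempty) {r : ℂ → ℂ}
    {T : Set ℂ} (hr : ContinuousOn r S) (hrT : MapsTo r S T) (hid : ∀ w ∈ T, w ∈ S → r w = w)
    {v : ℂ → ℂ} (hv : ContinuousOn v T) (hv0 : ∀ w ∈ T, v w ≠ 0) (hTS : T ⊆ S) :
    ∃ l : ℂ → ℂ, ContinuousOn l T ∧ ∀ w ∈ T, cexp (l w) = v w := by
  have hsc : IsSimplyConnected S := by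
    have := hS.contractibleSpace hne
    exact SimplyConnectedSpace.ofContractible _
  obtain ⟨l, hl, he⟩ := exists_continuousOn_eqOn_exp_comp hsc hSo (g := v ∘ r) (hv.comp hr hrT) (by
    rintro ⟨w, hw, h⟩
    exact hv0 _ (hrT hw) h)
  refine ⟨l, hl.mono hTS, fun w hw => ?_⟩
  have := he (hTS hw)
  simp only [Function.comp_apply, hid w hw (hTS hw)] at this
  exact this

/-- For real `e^l` the number `2i Im l = l - conj l` is a logarithm of `1`. -/
lemma im_eq_of_exp_real {l : ℝ → ℂ} (hl : Continuous l) (hre : ∀ x, (cexp (l x)).im = 0)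
    (x y : ℝ) : (l x).im = (l y).im := by
  have h := eq_of_exp_eq_one isPreconnected_univ (d := fun x => (2 * (l x).im : ℝ) * I)
    (by fun_prop) (fun x _ => by
      have h1 : ((2 * (l x).im : ℝ) : ℂ) * I = l x - conj (l x) := by
        rw [Complex.sub_conj]
      rw [h1, Complex.exp_sub, Complex.exp_conj, Complex.conj_eq_iff_im.mpr (hre x),
        div_self (Complex.exp_ne_zero _)]) (mem_univ x) (mem_univ y)
  have h2 := congrArg Complex.im h
  simp at h2
  exact h2

/-- A nonvanishing function on the closed strip that is real on both boundary lines, up to a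
factor with a periodic logarithm, has a constant multiplier. -/
lemma multiplier_slope_eq_zero {m : ℝ} {l vb vt : ℂ → ℂ} {α : ℂ} {M : ℝ}
    (hl : ContinuousOn l strip) (hlm : ∀ w ∈ strip, l (w + m) = l w)
    (hbc : ContinuousOn vb {w | 0 ≤ w.im ∧ w.im < Real.pi})
    (hb0 : ∀ w : ℂ, 0 ≤ w.im → w.im < Real.pi → vb w ≠ 0) (hbr : ∀ x : ℝ, (vb x).im = 0)
    (htc : ContinuousOn vt {w | 0 < w.im ∧ w.im ≤ Real.pi})
    (ht0 : ∀ w : ℂ, 0 < w.im → w.im ≤ Real.pi → vt w ≠ 0)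
    (htr : ∀ x : ℝ, (vt (x + Real.pi * I)).im = 0)
    (hrel : ∀ w ∈ strip, vt w = vb w * cexp (l w))
    (hmul : ∀ w : ℂ, 0 ≤ w.im → w.im < Real.pi → vb (w + m) = cexp (α - 2 * M * w) * vb w) :
    M = 0 := by
  have hpi := Real.pi_pos
  obtain ⟨b, hb, hbe⟩ := exists_log_line (S := {w : ℂ | w.im < Real.pi})
    (T := {w : ℂ | 0 ≤ w.im ∧ w.im < Real.pi}) (r := fun w => w.re + (max w.im 0 : ℝ) * I)
    (convex_halfSpace_im_lt _) (isOpen_lt continuous_im continuous_const) ⟨0, by simpa using hpi⟩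
    (by fun_prop) (fun w hw => by
      have hw' : w.im < Real.pi := hw
      simp [hw', hpi]) (fun w hw _ => by
      simp only [max_eq_left hw.1, Complex.re_add_im]) hbc (fun w hw => hb0 w hw.1 hw.2)
    (fun w hw => hw.2)
  obtain ⟨t, ht, hte⟩ := exists_log_line (S := {w : ℂ | 0 < w.im})
    (T := {w : ℂ | 0 < w.im ∧ w.im ≤ Real.pi}) (r := fun w => w.re + (min w.im Real.pi : ℝ) * I)
    (convex_halfSpace_im_gt _) (isOpen_lt continuous_const continuous_im) ⟨I, by simp⟩
    (by fun_prop) (fun w hw => by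
      have hw' : 0 < w.im := hw
      simp [hw', hpi]) (fun w hw _ => by
      simp only [min_eq_left hw.2, Complex.re_add_im]) htc (fun w hw => ht0 w hw.1 hw.2)
    (fun w hw => hw.1)
  have hpreb : IsPreconnected {w : ℂ | 0 ≤ w.im ∧ w.im < Real.pi} :=
    ((convex_halfSpace_im_ge 0).inter (convex_halfSpace_im_lt Real.pi)).isPreconnected
  have hcomb : ContinuousOn (fun w : ℂ => b (w + m) - b w - (α - 2 * M * w))
      {w : ℂ | 0 ≤ w.im ∧ w.im < Real.pi} := by
    refine ContinuousOn.sub (ContinuousOn.sub (ContinuousOn.comp hb (by fun_prop) fun w hw => ?_) hb)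
      (by fun_prop)
    simpa using hw
  have hexp : ∀ w ∈ {w : ℂ | 0 ≤ w.im ∧ w.im < Real.pi},
      cexp (b (w + m) - b w - (α - 2 * M * w)) = 1 := by
    intro w hw
    rw [Complex.exp_sub, Complex.exp_sub, hbe _ (by simpa using hw), hbe w hw, hmul w hw.1 hw.2,
      mul_div_cancel_right₀ _ (hb0 w hw.1 hw.2), div_self (Complex.exp_ne_zero _)]
  obtain ⟨n, hn⟩ : ∃ n : ℤ, ∀ w : ℂ, 0 ≤ w.im → w.im < Real.pi →
      b (w + m) - b w = α - 2 * M * w + n * (2 * Real.pi * I) := by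
    have h0 : (0 : ℂ) ∈ {w : ℂ | 0 ≤ w.im ∧ w.im < Real.pi} := by simpa using hpi
    obtain ⟨n, hn⟩ := Complex.exp_eq_one_iff.mp (hexp 0 h0)
    refine ⟨n, fun w h1 h2 => ?_⟩
    have := eq_of_exp_eq_one hpreb hcomb hexp ⟨h1, h2⟩ h0
    rw [hn] at this
    linear_combination this
  have hbline : Continuous fun x : ℝ => b x :=
    hb.comp_continuous Complex.continuous_ofReal fun x => by simpa using hpi
  have hbim := im_eq_of_exp_real hbline (fun x => by
    rw [hbe x (by simpa using hpi)]
    exact hbr x)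
  -- Along the bottom `vb` is real and nonvanishing, so its argument is constant.
  have e1 : α.im + n * (2 * Real.pi) = 0 := by
    have h1 := congrArg Complex.im (hn 0 (by simp) (by simpa using hpi))
    have h2 := hbim m 0
    simp at h1 h2
    rw [h2] at h1
    linarith
  have hstrip : ∀ w ∈ strip, t (w + m) - t w = α - 2 * M * w + n * (2 * Real.pi * I) := by
    intro w hw
    have hwm := add_ofReal_mem_strip hw m
    have h1 := eq_of_exp_eq_one convex_strip.isPreconnected (d := fun w => t w - b w - l w)
      (((ht.mono fun w hw => ⟨hw.1, hw.2.le⟩).sub (hb.mono fun w hw => ⟨hw.1.le, hw.2⟩)).sub hl)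
      (fun w hw => by
        rw [Complex.exp_sub, Complex.exp_sub, hte w ⟨hw.1, hw.2.le⟩, hbe w ⟨hw.1.le, hw.2⟩,
          hrel w hw, mul_div_cancel_left₀ _ (hb0 w hw.1.le hw.2), div_self (Complex.exp_ne_zero _)])
      hwm hw
    have h2 := hn w hw.1.le hw.2
    have h3 := hlm w hw
    linear_combination h1 + h2 + h3
  have hline : ∀ y : ℝ, 0 < y → y ≤ Real.pi → (y : ℂ) * I ∈ {w : ℂ | 0 < w.im ∧ w.im ≤ Real.pi} :=
    fun y h1 h2 => by simpa using ⟨h1, h2⟩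
  -- The relation passes to the top line by continuity. There the argument is constant too, which
  -- gives `Im α - 2πM + 2πn = 0`; comparison with `e1` yields `M = 0`.
  have htop : t (Real.pi * I + m) - t (Real.pi * I) =
      α - 2 * M * (Real.pi * I) + n * (2 * Real.pi * I) := by
    have hmemπ : ((Real.pi : ℂ) * I) ∈ {w : ℂ | 0 < w.im ∧ w.im ≤ Real.pi} := hline _ hpi le_rfl
    have hcl : (Real.pi * I : ℂ) ∈ closure strip := by
      obtain ⟨u, hu, hlim⟩ := mem_closure_iff_seq_limit.mp
        (show Real.pi ∈ closure (Ioo 0 Real.pi) by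
          rw [closure_Ioo hpi.ne]
          exact ⟨hpi.le, le_rfl⟩)
      exact mem_closure_iff_seq_limit.mpr ⟨fun k => u k * I, fun k => by simpa [strip] using hu k,
        ((Complex.continuous_ofReal.tendsto _).comp hlim).mul_const I⟩
    have hne : (𝓝[strip] (Real.pi * I : ℂ)).NeBot := mem_closure_iff_nhdsWithin_neBot.mp hcl
    have hsub : strip ⊆ {w : ℂ | 0 < w.im ∧ w.im ≤ Real.pi} := fun w hw => ⟨hw.1, hw.2.le⟩
    have h1 : Tendsto (fun w => t (w + m) - t w) (𝓝[strip] (Real.pi * I : ℂ))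
        (𝓝 (t (Real.pi * I + m) - t (Real.pi * I))) := by
      have h2 : ContinuousOn (fun w : ℂ => t (w + m) - t w) {w : ℂ | 0 < w.im ∧ w.im ≤ Real.pi} := by
        refine ContinuousOn.sub (ContinuousOn.comp ht (by fun_prop) fun w hw => ?_) ht
        simpa using hw
      exact (h2 _ hmemπ).mono_left (nhdsWithin_mono _ hsub)
    have h2 : Tendsto (fun w : ℂ => α - 2 * M * w + n * (2 * Real.pi * I))
        (𝓝[strip] (Real.pi * I : ℂ)) (𝓝 (α - 2 * M * (Real.pi * I) + n * (2 * Real.pi * I))) := by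
      have : Continuous fun w : ℂ => α - 2 * M * w + n * (2 * Real.pi * I) := by fun_prop
      exact (this.tendsto _).mono_left nhdsWithin_le_nhds
    refine tendsto_nhds_unique (h1.congr' ?_) h2
    filter_upwards [self_mem_nhdsWithin] with w hw using hstrip w hw
  have htline : Continuous fun x : ℝ => t (x + Real.pi * I) :=
    ht.comp_continuous (by fun_prop) fun x => by simpa using hpi
  have htim := im_eq_of_exp_real htline (fun x => by
    rw [hte _ (by simpa using hpi)]
    exact htr x)
  have h1 := congrArg Complex.im htop
  have h2 := htim m 0
  rw [add_comm (m : ℂ), Complex.ofReal_zero, zero_add] at h2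
  rw [sub_im, h2, sub_self] at h1
  simp at h1
  have h3 : M * (2 * Real.pi) = 0 := by linarith
  exact (mul_eq_zero.mp h3).resolve_right (by positivity)

/-! ### Removable singularities -/

/-- The limit of a function at a point. -/
def regularize (f : ℂ → ℂ) (z : ℂ) : ℂ := limUnder (𝓝[≠] z) f

lemma regularize_eventuallyEq {f g : ℂ → ℂ} {z : ℂ} (hg : AnalyticAt ℂ g z)
    (h : f =ᶠ[𝓝[≠] z] g) : regularize f =ᶠ[𝓝 z] g := by
  have h1 : ∀ᶠ w in 𝓝[≠] z, ∀ᶠ w' in 𝓝 w, f w' = g w' := by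
    have h2 := eventually_eventually_nhdsWithin.mpr h
    filter_upwards [h2, self_mem_nhdsWithin] with w hw hne
    rwa [(isOpen_compl_singleton.nhdsWithin_eq hne)] at hw
  have h3 : ∀ᶠ w in 𝓝 z, ∀ᶠ w' in 𝓝[≠] w, f w' = g w' := by
    rw [eventually_nhdsWithin_iff] at h1
    filter_upwards [h1] with w hw
    by_cases hwz : w = z
    · rw [hwz]
      exact h
    · exact (hw hwz).filter_mono nhdsWithin_le_nhds
  filter_upwards [h3, hg.eventually_analyticAt] with w hw hgw
  refine Tendsto.limUnder_eq ?_
  exact (hgw.continuousAt.tendsto.mono_left nhdsWithin_le_nhds).congr' (hw.mono fun _ h => h.symm)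

lemma RemovableAt.analyticAt_regularize {f : ℂ → ℂ} {z : ℂ} (h : RemovableAt f z) :
    AnalyticAt ℂ (regularize f) z := by
  obtain ⟨g, hg, he⟩ := h
  exact hg.congr (regularize_eventuallyEq hg he).symm

lemma RemovableAt.regularize_eventuallyEq_nhdsNE {f : ℂ → ℂ} {z : ℂ} (h : RemovableAt f z) :
    regularize f =ᶠ[𝓝[≠] z] f := by
  obtain ⟨g, hg, he⟩ := h
  exact ((regularize_eventuallyEq hg he).filter_mono nhdsWithin_le_nhds).trans he.symm

lemma RemovableAt.tendsto_regularize {f : ℂ → ℂ} {z : ℂ} (h : RemovableAt f z) :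
    Tendsto f (𝓝[≠] z) (𝓝 (regularize f z)) :=
  (h.analyticAt_regularize.continuousAt.tendsto.mono_left nhdsWithin_le_nhds).congr'
    h.regularize_eventuallyEq_nhdsNE

lemma regularize_eq_of_analyticAt {f : ℂ → ℂ} {z : ℂ} (h : AnalyticAt ℂ f z) : regularize f z = f z :=
  (regularize_eventuallyEq h EventuallyEq.rfl).self_of_nhds

/-- `f` agrees near `z` with a nonvanishing analytic function. -/
def UnitAt (f : ℂ → ℂ) (z : ℂ) : Prop := ∃ g, AnalyticAt ℂ g z ∧ g z ≠ 0 ∧ f =ᶠ[𝓝[≠] z] g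

lemma UnitAt.removableAt {f : ℂ → ℂ} {z : ℂ} (h : UnitAt f z) : RemovableAt f z := by
  obtain ⟨g, hg, -, he⟩ := h
  exact ⟨g, hg, he⟩

lemma UnitAt.regularize_ne_zero {f : ℂ → ℂ} {z : ℂ} (h : UnitAt f z) : regularize f z ≠ 0 := by
  obtain ⟨g, hg, h0, he⟩ := h
  rwa [(regularize_eventuallyEq hg he).self_of_nhds]

lemma unitAt_of_analyticAt {f : ℂ → ℂ} {z : ℂ} (h : AnalyticAt ℂ f z) (h0 : f z ≠ 0) : UnitAt f z :=
  ⟨f, h, h0, EventuallyEq.rfl⟩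

lemma UnitAt.congr {f g : ℂ → ℂ} {z : ℂ} (h : UnitAt f z) (he : f =ᶠ[𝓝[≠] z] g) : UnitAt g z := by
  obtain ⟨k, hk, h0, hk'⟩ := h
  exact ⟨k, hk, h0, he.symm.trans hk'⟩

lemma UnitAt.mul {f g : ℂ → ℂ} {z : ℂ} (hf : UnitAt f z) (hg : UnitAt g z) :
    UnitAt (fun w => f w * g w) z := by
  obtain ⟨f', hf', hf0, hfe⟩ := hf
  obtain ⟨g', hg', hg0, hge⟩ := hg
  exact ⟨fun w => f' w * g' w, hf'.fun_mul hg', mul_ne_zero hf0 hg0, hfe.mul hge⟩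

lemma UnitAt.inv {f : ℂ → ℂ} {z : ℂ} (hf : UnitAt f z) : UnitAt (fun w => (f w)⁻¹) z := by
  obtain ⟨f', hf', hf0, hfe⟩ := hf
  exact ⟨fun w => (f' w)⁻¹, hf'.fun_inv hf0, inv_ne_zero hf0, hfe.inv⟩

lemma UnitAt.pow {f : ℂ → ℂ} {z : ℂ} (hf : UnitAt f z) (n : ℕ) : UnitAt (fun w => f w ^ n) z := by
  obtain ⟨f', hf', hf0, hfe⟩ := hf
  exact ⟨fun w => f' w ^ n, hf'.fun_pow n, pow_ne_zero n hf0, hfe.pow_const n⟩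

lemma UnitAt.prod {ι : Type*} {s : Finset ι} {f : ι → ℂ → ℂ} {z : ℂ}
    (hf : ∀ i ∈ s, UnitAt (f i) z) : UnitAt (fun w => ∏ i ∈ s, f i w) z := by
  classical
  induction s using Finset.induction_on with
  | empty => exact ⟨fun _ => 1, analyticAt_const, one_ne_zero, .of_forall fun w => by simp⟩
  | insert a s ha ih =>
    refine (UnitAt.mul (hf a (by simp)) (ih fun i hi => hf i (by simp [hi]))).congr
      (.of_forall fun w => ?_)
    simp [Finset.prod_insert ha]

lemma UnitAt.comp_add_const {f : ℂ → ℂ} {z c : ℂ} (h : UnitAt f (z + c)) :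
    UnitAt (fun w => f (w + c)) z := by
  obtain ⟨g, hg, h0, he⟩ := h
  exact ⟨fun w => g (w + c), AnalyticAt.fun_comp (f := fun w => w + c) hg (by fun_prop), h0,
    (tendsto_add_const_nhdsNE z c).eventually he⟩

/-- An analytic function with a zero of order `n` is a unit times `(w - z) ^ n`. -/
lemma exists_unitAt_div_pow {f : ℂ → ℂ} {z : ℂ} (hf : AnalyticAt ℂ f z)
    (hne : ¬∀ᶠ w in 𝓝 z, f w = 0) : ∃ n : ℕ, UnitAt (fun w => f w / (w - z) ^ n) z ∧
      (f z = 0 → n ≠ 0) := by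
  obtain ⟨n, g, hg, h0, he⟩ := hf.exists_eventuallyEq_pow_smul_nonzero_iff.mpr hne
  refine ⟨n, ⟨g, hg, h0, ?_⟩, ?_⟩
  · filter_upwards [he.filter_mono nhdsWithin_le_nhds, self_mem_nhdsWithin] with w hw hwz
    rw [hw, smul_eq_mul, mul_div_cancel_left₀ _ (pow_ne_zero n (sub_ne_zero.mpr hwz))]
  · rintro hz rfl
    have := he.self_of_nhds
    rw [hz] at this
    simp at this
    exact h0 this.symm

/-! ### Theta products that are real on both boundary lines -/

/-- The product `Θ(w - z) Θ(w - z̄)`. -/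
def thetaPair (m : ℝ) (z w : ℂ) : ℂ := theta m (w - z) * theta m (w - conj z)

section Theta

variable {m : ℝ}

lemma thetaPair_add_period (hm : 0 < m) (z w : ℂ) :
    thetaPair m z (w + m) = cexp (2 * w + m - 2 * z.re) * thetaPair m z w := by
  rw [thetaPair, thetaPair, add_sub_right_comm, add_sub_right_comm, theta_add_period hm,
    theta_add_period hm]
  have : (2 * w + m - 2 * z.re : ℂ) = (w - z + m / 2) + (w - conj z + m / 2) := by
    have := Complex.add_conj z
    push_cast at this
    linear_combination this
  rw [this, Complex.exp_add (w - z + m / 2)]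
  ring

lemma theta_sub_pi_eq (x : ℂ) : theta m (x - Real.pi * I) = -theta m (x + Real.pi * I) := by
  have := theta_add_two_pi (m := m) (x - Real.pi * I)
  rw [← neg_eq_iff_eq_neg.mpr this]
  congr 2
  ring

lemma thetaPair_real_bottom (hm : 0 < m) (z : ℂ) (x : ℝ) : (thetaPair m z x).im = 0 := by
  rw [← Complex.conj_eq_iff_im, thetaPair, map_mul, ← theta_conj hm, ← theta_conj hm]
  simp only [map_sub, Complex.conj_ofReal, Complex.conj_conj]
  ring

/-- Conjugation replaces `πi` by `-πi`; each theta factor changes sign, and the product does not. -/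
lemma thetaPair_real_top (hm : 0 < m) (z : ℂ) (x : ℝ) :
    (thetaPair m z (x + Real.pi * I)).im = 0 := by
  rw [← Complex.conj_eq_iff_im, thetaPair, map_mul, ← theta_conj hm, ← theta_conj hm]
  simp only [map_sub, map_add, map_mul, Complex.conj_ofReal, Complex.conj_conj, Complex.conj_I]
  have h1 : (x + Real.pi * -I - conj z : ℂ) = (x - conj z) - Real.pi * I := by ring
  have h2 : (x + Real.pi * -I - z : ℂ) = (x - z) - Real.pi * I := by ring
  rw [h1, h2, theta_sub_pi_eq, theta_sub_pi_eq, neg_mul_neg, mul_comm]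
  congr 2 <;> ring

lemma analyticAt_thetaPair (hm : 0 < m) (z w : ℂ) : AnalyticAt ℂ (thetaPair m z) w := by
  unfold thetaPair
  exact ((analyticAt_theta hm _).fun_comp (f := fun w => w - z) (by fun_prop)).fun_mul
    ((analyticAt_theta hm _).fun_comp (f := fun w => w - conj z) (by fun_prop))

/-- In the closed strip the reflected factor vanishes only if `z` lies on a boundary line, where
`conj z` and `z` agree modulo `2πi`. -/
lemma eq_add_int_mul_of_thetaPair_eq_zero (hm : 0 < m) {z w : ℂ} (hz0 : 0 ≤ z.im)
    (hz1 : z.im ≤ Real.pi) (hw0 : 0 ≤ w.im) (hw1 : w.im ≤ Real.pi) (h : thetaPair m z w = 0) :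
    ∃ k : ℤ, w = z + k * m := by
  have hpi := Real.pi_pos
  rcases mul_eq_zero.mp h with h | h
  · rw [theta_eq_zero_iff hm, mem_periods_lattice hm] at h
    obtain ⟨j, k, h⟩ := h
    have h2 := congrArg Complex.im h
    simp at h2
    have hk : k = 0 := by
      have h3 : (k : ℝ) < 1 := by nlinarith
      have h4 : (-1 : ℝ) < k := by nlinarith
      have h5 : k < 1 := by exact_mod_cast h3
      have h6 : -1 < k := by exact_mod_cast h4
      omega
    refine ⟨j, ?_⟩
    rw [hk] at h
    push_cast at h
    linear_combination h
  · rw [theta_eq_zero_iff hm, mem_periods_lattice hm] at h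
    obtain ⟨j, k, h⟩ := h
    have h2 := congrArg Complex.im h
    simp at h2
    have hk : k = 0 ∨ k = 1 := by
      have h3 : (k : ℝ) < 2 := by nlinarith
      have h4 : (-1 : ℝ) < k := by nlinarith
      have h5 : k < 2 := by exact_mod_cast h3
      have h6 : -1 < k := by exact_mod_cast h4
      omega
    refine ⟨j, ?_⟩
    rcases hk with rfl | rfl
    · have hz : conj z = z := Complex.conj_eq_iff_im.mpr (by simp at h2; linarith)
      rw [hz] at h
      push_cast at h
      linear_combination h
    · have hz : conj z = z - 2 * Real.pi * I := by
        have : z.im = Real.pi := by simp at h2; linarith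
        apply Complex.ext <;> simp [this]
        ring
      rw [hz] at h
      push_cast at h
      linear_combination h

lemma unitAt_theta_sub_div (hm : 0 < m) (z : ℂ) :
    UnitAt (fun w => theta m (w - z) / (w - z)) z := by
  have h1 := (analyticAt_theta hm 0)
  refine ⟨fun w => dslope (theta m) 0 (w - z), ?_, ?_, ?_⟩
  · refine AnalyticAt.fun_comp (f := fun w : ℂ => w - z) ?_ (by fun_prop)
    rw [sub_self]
    exact analyticAt_dslope h1
  · simp only [sub_self, dslope_same]
    exact deriv_theta_zero_ne hm
  · filter_upwards [self_mem_nhdsWithin] with w hw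
    rw [theta_eq_mul_dslope hm, mul_div_cancel_left₀ _ (sub_ne_zero.mpr hw)]

lemma unitAt_thetaPair_div (hm : 0 < m) {z : ℂ} (h0 : 0 < z.im) (h1 : z.im < Real.pi) :
    UnitAt (fun w => thetaPair m z w / (w - z) ^ 1) z := by
  have h2 : UnitAt (fun w => theta m (w - conj z)) z := by
    refine unitAt_of_analyticAt ((analyticAt_theta hm _).fun_comp (f := fun w => w - conj z)
      (by fun_prop)) ?_
    refine theta_ne_zero hm (notMem_of_im hm ?_ ?_ ?_) <;> simp <;> linarith
  refine ((unitAt_theta_sub_div hm z).mul h2).congr (.of_forall fun w => ?_)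
  simp only [thetaPair]
  rw [pow_one, mul_div_right_comm]

/-- On the boundary the two factors vanish together, so the zero is double. -/
lemma unitAt_thetaPair_div_sq (hm : 0 < m) {z : ℂ} (h : z.im = 0 ∨ z.im = Real.pi) :
    UnitAt (fun w => thetaPair m z w / (w - z) ^ 2) z := by
  have h2 : UnitAt (fun w => theta m (w - conj z) / (w - z)) z := by
    rcases h with h | h
    · rw [Complex.conj_eq_iff_im.mpr h]
      exact unitAt_theta_sub_div hm z
    · have hz : conj z = z - 2 * Real.pi * I := by
        apply Complex.ext <;> simp [h]
        ring
      have h3 : UnitAt (fun _ : ℂ => (-1 : ℂ)) z := unitAt_of_analyticAt analyticAt_const (by norm_num)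
      rw [hz]
      refine (h3.mul (unitAt_theta_sub_div hm z)).congr (.of_forall fun w => ?_)
      simp only
      rw [show w - (z - 2 * Real.pi * I) = w - z + 2 * Real.pi * I by ring, theta_add_two_pi]
      ring
  refine ((unitAt_theta_sub_div hm z).mul h2).congr (.of_forall fun w => ?_)
  simp only [thetaPair]
  rw [div_mul_div_comm, sq]

end Theta

/-! ### Functions with mixed reality conditions -/

/-- Analytic functions `b` near the bottom and inside, `t = b ρ` near the top and inside of the
strip, with multiplier `C`. -/
structure AnalyticPair (m δ : ℝ) (C : ℂ) (ρ b t : ℂ → ℂ) : Prop where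
  pos : 0 < δ
  analytic_bottom : ∀ w : ℂ, -δ < w.im → w.im < Real.pi → AnalyticAt ℂ b w
  analytic_top : ∀ w : ℂ, 0 < w.im → w.im < Real.pi + δ → AnalyticAt ℂ t w
  multiplier_bottom : ∀ w : ℂ, -δ < w.im → w.im < Real.pi → b (w + m) = C * b w
  multiplier_top : ∀ w : ℂ, 0 < w.im → w.im < Real.pi + δ → t (w + m) = C * t w
  rel : ∀ w ∈ strip, t w = b w * ρ w

lemma UnitAt.add_int_mul {f e : ℂ → ℂ} {m : ℝ} {S : Set ℂ} (hSo : IsOpen S)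
    (hS : ∀ w : ℂ, w + m ∈ S ↔ w ∈ S) (he : ∀ w, AnalyticAt ℂ e w) (he0 : ∀ w, e w ≠ 0)
    (hf : ∀ w ∈ S, f (w + m) = e w * f w) {z : ℂ} (hz : z ∈ S) (h : UnitAt f z) (k : ℤ) :
    z + k * m ∈ S ∧ UnitAt f (z + k * m) := by
  have hstep : ∀ z ∈ S, (UnitAt f (z + m) ↔ UnitAt f z) := by
    intro z hz
    have hev : ∀ᶠ w in 𝓝[≠] z, f (w + m) = e w * f w := by
      filter_upwards [mem_nhdsWithin_of_mem_nhds (hSo.mem_nhds hz)] with w hw using hf w hw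
    constructor
    · intro h
      refine (((unitAt_of_analyticAt (he z) (he0 z)).inv).mul h.comp_add_const).congr ?_
      filter_upwards [hev] with w hw
      rw [hw, inv_mul_cancel_left₀ (he0 w)]
    · intro h
      have h1 := (unitAt_of_analyticAt (he z) (he0 z)).mul h
      have h2 : UnitAt (fun w => f (w + m)) z := h1.congr (hev.mono fun w hw => hw.symm)
      have h3 : UnitAt (fun w => f (w + m)) (z + m + -m) := by rwa [add_neg_cancel_right]
      refine (UnitAt.comp_add_const (f := fun w => f (w + m)) (c := -m) h3).congr
        (.of_forall fun w => ?_)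
      simp
  induction k using Int.induction_on with
  | zero => simpa using ⟨hz, h⟩
  | succ n ih =>
    have e : z + ((n + 1 : ℤ) : ℂ) * m = z + (n : ℤ) * m + m := by push_cast; ring
    rw [e]
    exact ⟨(hS _).mpr ih.1, (hstep _ ih.1).mpr ih.2⟩
  | pred n ih =>
    have e : z + ((-n : ℤ) : ℂ) * m = z + ((-n - 1 : ℤ) : ℂ) * m + m := by push_cast; ring
    rw [e] at ih
    have h1 := (hS _).mp ih.1
    exact ⟨h1, (hstep _ h1).mp ih.2⟩

lemma unitAt_sq_div_prod {m : ℝ} (hm : 0 < m) {κ : ℂ → ℂ} {Z : Finset ℂ} {μ : ℂ → ℕ} {z : ℂ} {n e : ℕ}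
    (hκ : UnitAt (fun w => κ w / (w - z) ^ n) z)
    (hB : UnitAt (fun w => thetaPair m z w / (w - z) ^ e) z) (hne : 2 * n = e * μ z)
    (hothers : ∀ z' ∈ Z, z' ≠ z → thetaPair m z' z ≠ 0) (hz : z ∈ Z) :
    UnitAt (fun w => κ w ^ 2 / ∏ z' ∈ Z, thetaPair m z' w ^ μ z') z := by
  classical
  have h1 : UnitAt (fun w => ∏ z' ∈ Z.erase z, thetaPair m z' w ^ μ z') z := by
    refine UnitAt.prod fun z' hz' => ?_
    rw [Finset.mem_erase] at hz'
    exact (unitAt_of_analyticAt (analyticAt_thetaPair hm z' z) (hothers z' hz'.2 hz'.1)).pow _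
  refine (((hκ.pow 2).mul (hB.pow (μ z)).inv).mul h1.inv).congr ?_
  filter_upwards [self_mem_nhdsWithin] with w hw
  have hw' : w - z ≠ 0 := sub_ne_zero.mpr hw
  rw [← Finset.mul_prod_erase Z _ hz, div_pow, div_pow, ← pow_mul, ← pow_mul, mul_comm n 2, hne,
    inv_div]
  have hp := pow_ne_zero (e * μ z) hw'
  rw [div_mul_div_cancel₀ hp, ← div_div, ← div_eq_mul_inv]

lemma regularize_im_eq_zero {f : ℂ → ℂ} {x : ℝ} {c : ℂ} (h : RemovableAt f (x + c))
    (hf : ∀ x' : ℝ, (f (x' + c)).im = 0) : (regularize f (x + c)).im = 0 := by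
  have h1 : Tendsto (fun x' : ℝ => (x' : ℂ) + c) (𝓝[≠] x) (𝓝[≠] (x + c)) := by
    refine tendsto_nhdsWithin_iff.mpr ⟨?_, ?_⟩
    · have : Continuous fun x' : ℝ => (x' : ℂ) + c := by fun_prop
      exact (this.tendsto x).mono_left nhdsWithin_le_nhds
    · filter_upwards [self_mem_nhdsWithin] with x' hx' h2
      exact hx' (by simpa using h2)
  have h2 := (Complex.continuous_im.tendsto _).comp (h.tendsto_regularize.comp h1)
  refine tendsto_nhds_unique h2 ?_
  simp only [Function.comp_def, hf]
  exact tendsto_const_nhds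

lemma regularize_add_eq {f e : ℂ → ℂ} {w c : ℂ} (h : RemovableAt f w) (h' : RemovableAt f (w + c))
    (he : ContinuousAt e w) (hf : ∀ᶠ w' in 𝓝 w, f (w' + c) = e w' * f w') :
    regularize f (w + c) = e w * regularize f w := by
  refine tendsto_nhds_unique (h'.tendsto_regularize.comp (tendsto_add_const_nhdsNE w c)) ?_
  refine ((he.tendsto.mono_left nhdsWithin_le_nhds).mul h.tendsto_regularize).congr' ?_
  filter_upwards [hf.filter_mono nhdsWithin_le_nhds] with w' hw' using hw'.symm

lemma exists_fundamental {m : ℝ} (hm : 0 < m) (z : ℂ) :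
    ∃ (z' : ℂ) (k : ℤ), z = z' + k * m ∧ 0 ≤ z'.re ∧ z'.re < m ∧ z'.im = z.im := by
  refine ⟨z - (⌊z.re / m⌋ : ℤ) * m, ⌊z.re / m⌋, by ring, ?_, ?_, ?_⟩
  · have := (le_div_iff₀ hm).mp (Int.floor_le (z.re / m))
    simp
    linarith
  · have := (div_lt_iff₀ hm).mp (Int.lt_floor_add_one (z.re / m))
    simp
    linarith
  · simp

/-- The zeros of a mixed pair in the closed strip are constrained by its multiplier: a constant
multiplier and real boundary values leave no zeros. -/
theorem AnalyticPair.ne_zero {m δ : ℝ} (hm : 0 < m) {c : ℂ} {ρ l b t : ℂ → ℂ}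
    (h : AnalyticPair m δ (cexp c) ρ b t) (hl : ContinuousOn l strip)
    (hle : ∀ w ∈ strip, cexp (l w) = ρ w) (hlm : ∀ w ∈ strip, l (w + m) = l w)
    (hρ : ∀ w ∈ strip, AnalyticAt ℂ ρ w) (hbr : ∀ x : ℝ, (b x).im = 0)
    (htr : ∀ x : ℝ, (t (x + Real.pi * I)).im = 0) (hne : ∃ w₀ ∈ strip, b w₀ ≠ 0) :
    (∀ w : ℂ, 0 ≤ w.im → w.im < Real.pi → b w ≠ 0) ∧
      ∀ w : ℂ, 0 < w.im → w.im ≤ Real.pi → t w ≠ 0 := by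
  classical
  obtain ⟨hδ, hba, hta, hbm, htm, hrel⟩ := h
  obtain ⟨w₀, hw₀, hbw₀⟩ := hne
  have hpi := Real.pi_pos
  have hρ0 : ∀ w ∈ strip, ρ w ≠ 0 := fun w hw => hle w hw ▸ Complex.exp_ne_zero _
  set Sb : Set ℂ := {w | -δ < w.im ∧ w.im < Real.pi} with hSb
  set St : Set ℂ := {w | 0 < w.im ∧ w.im < Real.pi + δ} with hSt
  have hSbo : IsOpen Sb :=
    (isOpen_lt continuous_const continuous_im).inter (isOpen_lt continuous_im continuous_const)
  have hSto : IsOpen St :=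
    (isOpen_lt continuous_const continuous_im).inter (isOpen_lt continuous_im continuous_const)
  have hSbc : IsPreconnected Sb :=
    ((convex_halfSpace_im_gt _).inter (convex_halfSpace_im_lt _)).isPreconnected
  have hStc : IsPreconnected St :=
    ((convex_halfSpace_im_gt _).inter (convex_halfSpace_im_lt _)).isPreconnected
  have hnb : ∀ z : ℂ, 0 ≤ z.im → z.im < Real.pi → ¬∀ᶠ w in 𝓝 z, b w = 0 := by
    intro z h0 h1 hz
    have hb : AnalyticOnNhd ℂ b Sb := fun w hw => hba w hw.1 hw.2
    exact hbw₀ (hb.eqOn_zero_of_preconnected_of_eventuallyEq_zero hSbc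
      (⟨by linarith, h1⟩ : z ∈ Sb) hz ⟨by linarith [hw₀.1], hw₀.2⟩)
  have hnt : ∀ z : ℂ, 0 < z.im → z.im ≤ Real.pi → ¬∀ᶠ w in 𝓝 z, t w = 0 := by
    intro z h0 h1 hz
    have ht : AnalyticOnNhd ℂ t St := fun w hw => hta w hw.1 hw.2
    have := ht.eqOn_zero_of_preconnected_of_eventuallyEq_zero hStc
      (⟨h0, by linarith⟩ : z ∈ St) hz (⟨hw₀.1, by linarith [hw₀.2]⟩ : w₀ ∈ St)
    rw [hrel w₀ hw₀] at this
    exact mul_ne_zero hbw₀ (hρ0 w₀ hw₀) this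
  -- `f z` is the member of the pair used at `z`: `t` on the top line, `b` below it.
  set f : ℂ → ℂ → ℂ := fun z => if z.im < Real.pi then b else t with hf
  have hfb : ∀ z : ℂ, z.im < Real.pi → f z = b := fun z hz => if_pos hz
  have hft : ∀ z : ℂ, z.im = Real.pi → f z = t := fun z hz => if_neg (by rw [hz]; exact lt_irrefl _)
  have hfa : ∀ z : ℂ, 0 ≤ z.im → z.im ≤ Real.pi → AnalyticAt ℂ (f z) z := by
    intro z h0 h1
    rcases h1.lt_or_eq with h1 | h1
    · rw [hfb z h1]
      exact hba z (by linarith) h1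
    · rw [hft z h1]
      exact hta z (by linarith) (by linarith)
  have hfn : ∀ z : ℂ, 0 ≤ z.im → z.im ≤ Real.pi → ¬∀ᶠ w in 𝓝 z, f z w = 0 := by
    intro z h0 h1
    rcases h1.lt_or_eq with h1 | h1
    · rw [hfb z h1]
      exact hnb z h0 h1
    · rw [hft z h1]
      exact hnt z (by linarith) h1.le
  have hN : ∀ z : ℂ, ∃ n : ℕ, 0 ≤ z.im → z.im ≤ Real.pi →
      UnitAt (fun w => f z w / (w - z) ^ n) z ∧ (f z z = 0 → n ≠ 0) := by
    intro z
    by_cases hz : 0 ≤ z.im ∧ z.im ≤ Real.pi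
    · obtain ⟨n, hn⟩ := exists_unitAt_div_pow (hfa z hz.1 hz.2) (hfn z hz.1 hz.2)
      exact ⟨n, fun _ _ => hn⟩
    · exact ⟨0, fun h0 h1 => absurd ⟨h0, h1⟩ hz⟩
  choose N hN using hN
  -- Zeros in a period rectangle would accumulate in its compact closure, forcing `b` or `t` to
  -- vanish identically.
  have hfin : {z : ℂ | (0 ≤ z.re ∧ z.re < m) ∧ (0 ≤ z.im ∧ z.im ≤ Real.pi) ∧ f z z = 0}.Finite := by
    by_contra hinf
    obtain ⟨z, hzK, hz⟩ := Set.Infinite.exists_accPt_of_subset_isCompact hinf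
      ((isCompact_Icc (a := (0 : ℝ)) (b := m)).reProdIm (isCompact_Icc (a := (0 : ℝ))
        (b := Real.pi))) (fun w hw => mem_reProdIm.mpr ⟨⟨hw.1.1, hw.1.2.le⟩, hw.2.1⟩)
    rw [accPt_iff_frequently_nhdsNE] at hz
    have hz01 := (mem_reProdIm.mp hzK).2
    refine hfn z hz01.1 hz01.2 ((hfa z hz01.1 hz01.2).frequently_zero_iff_eventually_zero.mp ?_)
    rcases hz01.2.lt_or_eq with h1 | h1
    · have hev : ∀ᶠ w in 𝓝[≠] z, w.im < Real.pi :=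
        (continuous_im.continuousAt.eventually_lt continuousAt_const h1).filter_mono
          nhdsWithin_le_nhds
      refine (hz.and_eventually hev).mono fun w hw => ?_
      rw [hfb z h1, ← hfb w hw.2]
      exact hw.1.2.2
    · have hev : ∀ᶠ w in 𝓝[≠] z, 0 < w.im :=
        (continuousAt_const.eventually_lt continuous_im.continuousAt (by linarith)).filter_mono
          nhdsWithin_le_nhds
      refine (hz.and_eventually hev).mono fun w hw => ?_
      rw [hft z h1]
      rcases hw.1.2.1.2.lt_or_eq with h2 | h2
      · have h3 := hw.1.2.2
        rw [hfb w h2] at h3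
        rw [hrel w ⟨hw.2, h2⟩, h3, zero_mul]
      · rw [← hft w h2]
        exact hw.1.2.2
  set Z := hfin.toFinset with hZ
  have hZmem : ∀ z, z ∈ Z ↔ (0 ≤ z.re ∧ z.re < m) ∧ (0 ≤ z.im ∧ z.im ≤ Real.pi) ∧ f z z = 0 :=
    fun z => hfin.mem_toFinset
  -- `D` has the zeros of the square: an interior zero of order `N` needs the simple zero of
  -- `thetaPair` `2N` times, a boundary zero needs the double zero only `N` times. Squaring makes
  -- both cases integral.
  set μ : ℂ → ℕ := fun z => if z.im = 0 ∨ z.im = Real.pi then N z else 2 * N z with hμ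
  set D : ℂ → ℂ := fun w => ∏ z ∈ Z, thetaPair m z w ^ μ z with hD
  have hfund : ∀ z : ℂ, 0 ≤ z.re → z.re < m → 0 ≤ z.im → z.im ≤ Real.pi →
      UnitAt (fun w => f z w ^ 2 / D w) z := by
    intro z hr0 hr1 h0 h1
    have hoth : ∀ z' ∈ Z, z' ≠ z → thetaPair m z' z ≠ 0 := by
      intro z' hz' hne h2
      rw [hZmem] at hz'
      obtain ⟨k, hk⟩ := eq_add_int_mul_of_thetaPair_eq_zero hm hz'.2.1.1 hz'.2.1.2 h0 h1 h2
      have h3 := congrArg Complex.re hk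
      simp at h3
      have hk0 : k = 0 := by
        have h4 : (k : ℝ) < 1 := by nlinarith [hz'.1.1, hz'.1.2]
        have h5 : (-1 : ℝ) < k := by nlinarith [hz'.1.1, hz'.1.2]
        have h6 : k < 1 := by exact_mod_cast h4
        have h7 : -1 < k := by exact_mod_cast h5
        omega
      rw [hk0] at hk
      simp at hk
      exact hne hk.symm
    by_cases hz : z ∈ Z
    · by_cases hbd : z.im = 0 ∨ z.im = Real.pi
      · exact unitAt_sq_div_prod hm (hN z h0 h1).1 (unitAt_thetaPair_div_sq hm hbd)
          (by simp [hμ, hbd]) hoth hz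
      · have h2 : 0 < z.im := lt_of_le_of_ne h0 fun h => hbd (Or.inl h.symm)
        have h3 : z.im < Real.pi := lt_of_le_of_ne h1 fun h => hbd (Or.inr h)
        exact unitAt_sq_div_prod hm (hN z h0 h1).1 (unitAt_thetaPair_div hm h2 h3)
          (by simp [hμ, hbd]) hoth hz
    · have h2 : f z z ≠ 0 := fun h2 => hz ((hZmem z).mpr ⟨⟨hr0, hr1⟩, ⟨h0, h1⟩, h2⟩)
      have h3 : UnitAt D z := UnitAt.prod fun z' hz' =>
        (unitAt_of_analyticAt (analyticAt_thetaPair hm z' z)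
          (hoth z' hz' fun h => hz (h ▸ hz'))).pow _
      refine (((unitAt_of_analyticAt (hfa z h0 h1) h2).pow 2).mul h3.inv).congr
        (.of_forall fun w => ?_)
      exact (div_eq_mul_inv _ _).symm
  -- Each factor `thetaPair` has multiplier of slope `2` in `w`, so that of `b² / D` is `exp (α -
  -- 2Mw)`.
  set M : ℝ := ∑ z ∈ Z, (μ z : ℝ) with hM
  set α : ℂ := 2 * c - ∑ z ∈ Z, μ z * (m - 2 * z.re) with hα
  have hDm : ∀ w, D (w + m) = cexp (-(α - 2 * M * w) + 2 * c) * D w := by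
    intro w
    have e1 : -(α - 2 * M * w) + 2 * c = ∑ z ∈ Z, μ z * (2 * w + m - 2 * z.re) := by
      rw [hα, hM]
      push_cast
      rw [Finset.mul_sum, Finset.sum_mul]
      have : ∀ z : ℂ, (μ z : ℂ) * (2 * w + m - 2 * z.re) =
        μ z * (m - 2 * z.re) + 2 * (μ z : ℂ) * w := fun z => by ring
      simp only [this, Finset.sum_add_distrib]
      ring
    rw [e1, Complex.exp_sum]
    simp only [hD]
    rw [← Finset.prod_mul_distrib]
    refine Finset.prod_congr rfl fun z _ => ?_
    rw [thetaPair_add_period hm, mul_pow, ← Complex.exp_nat_mul]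
  have hE : ∀ w, cexp c ^ 2 / cexp (-(α - 2 * M * w) + 2 * c) = cexp (α - 2 * M * w) := by
    intro w
    rw [← Complex.exp_nat_mul, ← Complex.exp_sub]
    congr 1
    push_cast
    ring
  have hvb : ∀ w ∈ Sb, b (w + m) ^ 2 / D (w + m) = cexp (α - 2 * M * w) * (b w ^ 2 / D w) := by
    intro w hw
    rw [hbm w hw.1 hw.2, hDm, mul_pow, mul_div_mul_comm, hE]
  have hvt : ∀ w ∈ St, t (w + m) ^ 2 / D (w + m) = cexp (α - 2 * M * w) * (t w ^ 2 / D w) := by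
    intro w hw
    rw [htm w hw.1 hw.2, hDm, mul_pow, mul_div_mul_comm, hE]
  have hEa : ∀ w, AnalyticAt ℂ (fun w => cexp (α - 2 * M * w)) w := fun w => by fun_prop
  have hub : ∀ z : ℂ, 0 ≤ z.im → z.im < Real.pi → UnitAt (fun w => b w ^ 2 / D w) z := by
    intro z h0 h1
    obtain ⟨z', k, rfl, hr0, hr1, him⟩ := exists_fundamental hm z
    rw [← him] at h0 h1
    have := hfund z' hr0 hr1 h0 h1.le
    rw [hfb z' h1] at this
    exact (this.add_int_mul hSbo (fun w => by simp [hSb]) hEa (fun w => Complex.exp_ne_zero _) hvb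
      ⟨by linarith, h1⟩ k).2
  have hut : ∀ z : ℂ, 0 < z.im → z.im ≤ Real.pi → UnitAt (fun w => t w ^ 2 / D w) z := by
    intro z h0 h1
    rcases h1.lt_or_eq with h1 | h1
    · refine ((hub z h0.le h1).mul ((unitAt_of_analyticAt (hρ z ⟨h0, h1⟩)
        (hρ0 z ⟨h0, h1⟩)).pow 2)).congr ?_
      filter_upwards [mem_nhdsWithin_of_mem_nhds (isOpen_strip.mem_nhds ⟨h0, h1⟩)] with w hw
      rw [hrel w hw]
      ring
    · obtain ⟨z', k, rfl, hr0, hr1, him⟩ := exists_fundamental hm z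
      rw [← him] at h0 h1
      have := hfund z' hr0 hr1 h0.le h1.le
      rw [hft z' h1] at this
      exact (this.add_int_mul hSto (fun w => by simp [hSt]) hEa (fun w => Complex.exp_ne_zero _) hvt
        ⟨h0, by linarith⟩ k).2
  have hDb : ∀ x : ℝ, conj (D x) = D x := by
    intro x
    simp only [hD, map_prod, map_pow]
    refine Finset.prod_congr rfl fun z _ => ?_
    rw [Complex.conj_eq_iff_im.mpr (thetaPair_real_bottom hm z x)]
  have hDt : ∀ x : ℝ, conj (D (x + Real.pi * I)) = D (x + Real.pi * I) := by
    intro x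
    simp only [hD, map_prod, map_pow]
    refine Finset.prod_congr rfl fun z _ => ?_
    rw [Complex.conj_eq_iff_im.mpr (thetaPair_real_top hm z x)]
  -- The quotients `b²/D` and `t²/D` are nonvanishing and real on their boundary lines; they differ
  -- by `ρ²`, whose logarithm `2l` is periodic.
  have hM0 : M = 0 := by
    refine multiplier_slope_eq_zero (m := m) (l := fun w => 2 * l w)
      (vb := regularize fun w => b w ^ 2 / D w) (vt := regularize fun w => t w ^ 2 / D w) (α := α)
      (continuousOn_const.mul hl) (fun w hw => by rw [hlm w hw])
      (fun w hw => (hub w hw.1 hw.2).removableAt.analyticAt_regularize.continuousAt.continuousWithinAt)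
      (fun w h0 h1 => (hub w h0 h1).regularize_ne_zero) (fun x => ?_)
      (fun w hw => (hut w hw.1 hw.2).removableAt.analyticAt_regularize.continuousAt.continuousWithinAt)
      (fun w h0 h1 => (hut w h0 h1).regularize_ne_zero) (fun x => ?_) (fun w hw => ?_)
      (fun w h0 h1 => ?_)
    · have := regularize_im_eq_zero (x := x) (c := 0) (hub (x + 0) (by simp) (by simpa using hpi)).removableAt
        (fun x' => by
          rw [← Complex.conj_eq_iff_im, map_div₀, map_pow, add_zero, hDb,
            Complex.conj_eq_iff_im.mpr (hbr x')])
      simpa using this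
    · exact regularize_im_eq_zero (hut (x + Real.pi * I) (by simpa using hpi) (by simp)).removableAt
        (fun x' => by
          rw [← Complex.conj_eq_iff_im, map_div₀, map_pow, hDt,
            Complex.conj_eq_iff_im.mpr (htr x')])
    · have h1 := (hub w hw.1.le hw.2).removableAt
      have h2 : AnalyticAt ℂ (fun w' => regularize (fun w => b w ^ 2 / D w) w' * ρ w' ^ 2) w :=
        h1.analyticAt_regularize.fun_mul ((hρ w hw).fun_pow 2)
      rw [(regularize_eventuallyEq h2 ?_).self_of_nhds]
      · rw [two_mul, Complex.exp_add, hle w hw]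
        ring
      · filter_upwards [h1.regularize_eventuallyEq_nhdsNE,
          mem_nhdsWithin_of_mem_nhds (isOpen_strip.mem_nhds hw)] with w' h3 h4
        rw [h3, hrel w' h4]
        ring
    · refine regularize_add_eq (f := fun w => b w ^ 2 / D w) (hub w h0 h1).removableAt
        (hub (w + m) (by simpa using h0) (by simpa using h1)).removableAt (hEa w).continuousAt ?_
      filter_upwards [hSbo.mem_nhds ⟨by linarith, h1⟩] with w' hw' using hvb w' hw'
  have hZe : Z = ∅ := by
    rw [Finset.eq_empty_iff_forall_notMem]
    intro z hz
    have h1 : (μ z : ℝ) = 0 :=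
      (Finset.sum_eq_zero_iff_of_nonneg fun i _ => Nat.cast_nonneg _).mp hM0 z hz
    have h2 : μ z = 0 := by exact_mod_cast h1
    have h3 := (hZmem z).mp hz
    have h4 := (hN z h3.2.1.1 h3.2.1.2).2 h3.2.2
    simp only [hμ] at h2
    split_ifs at h2 <;> omega
  have hD1 : ∀ w, D w = 1 := fun w => by simp [hD, hZe]
  simp only [hD1, div_one] at hub hut
  refine ⟨fun w h0 h1 hw => ?_, fun w h0 h1 hw => ?_⟩
  · apply (hub w h0 h1).regularize_ne_zero
    rw [regularize_eq_of_analyticAt ((hba w (by linarith) h1).fun_pow 2), hw, sq, zero_mul]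
  · apply (hut w h0 h1).regularize_ne_zero
    rw [regularize_eq_of_analyticAt ((hta w h0 (by linarith)).fun_pow 2), hw, sq, zero_mul]

/-! ### Boundary regularity of solutions of the boundary value problem -/

/-- Analytic relations on a horizontal strip propagate from a smaller strip. -/
lemma analytic_antiperiodic_of_subset {f : ℂ → ℂ} {m a b a' b' : ℝ} (ha : a ≤ a') (hab : a' < b')
    (hb : b' ≤ b) (hf : ∀ w : ℂ, a < w.im → w.im < b → AnalyticAt ℂ f w)
    (h : ∀ w : ℂ, a' < w.im → w.im < b' → f (w + m) = -f w) (w : ℂ) (h0 : a < w.im)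
    (h1 : w.im < b) : f (w + m) = -f w := by
  have hc : IsPreconnected {w : ℂ | a < w.im ∧ w.im < b} :=
    ((convex_halfSpace_im_gt _).inter (convex_halfSpace_im_lt _)).isPreconnected
  have h2 : AnalyticOnNhd ℂ (fun w => f (w + m)) {w : ℂ | a < w.im ∧ w.im < b} := fun w hw =>
    AnalyticAt.fun_comp (f := fun w => w + (m : ℂ)) (hf _ (by simpa using hw.1) (by simpa using hw.2))
      (by fun_prop)
  have h3 : AnalyticOnNhd ℂ (fun w => -f w) {w : ℂ | a < w.im ∧ w.im < b} :=
    fun w hw => (hf w hw.1 hw.2).fun_neg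
  have hz : ((a' + b') / 2 : ℝ) * I ∈ {w : ℂ | a' < w.im ∧ w.im < b'} := by
    simp only [mem_ofPred_eq, mul_im, ofReal_re, I_im, mul_one, ofReal_im, I_re, mul_zero, add_zero]
    constructor <;> linarith
  have ho : IsOpen {w : ℂ | a' < w.im ∧ w.im < b'} :=
    (isOpen_lt continuous_const continuous_im).inter (isOpen_lt continuous_im continuous_const)
  refine h2.eqOn_of_preconnected_of_eventuallyEq h3 hc (z₀ := ((a' + b') / 2 : ℝ) * I)
    ⟨ha.trans_lt hz.1, hz.2.trans_le hb⟩ ?_ ⟨h0, h1⟩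
  filter_upwards [ho.mem_nhds hz] with w hw using h w hw.1 hw.2

lemma topBoundary_add_one {U : Set ℂ} (hU : IsCylindricalDomain U) {a : ℂ}
    (ha : a ∈ topBoundary U) : a + 1 ∈ topBoundary U := by
  obtain ⟨hf, hu⟩ := ha
  refine ⟨?_, ?_⟩
  · rw [hU.isOpen.frontier_eq] at hf ⊢
    exact ⟨map_mem_closure (f := fun z : ℂ => z + 1) (by fun_prop) hf.1
      fun z hz => (hU.periodic z).mpr hz, fun h => hf.2 ((hU.periodic a).mp h)⟩
  · rw [upperSide, mem_ofPred_eq] at hu ⊢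
    rwa [show cexp (2 * Real.pi * I * (a + 1)) = cexp (2 * Real.pi * I * a) from
      exp_two_pi_mul_eq_iff.mpr ⟨1, by simp⟩]

section BVP

variable {m : ℝ} {U : Set ℂ} {φ : ℂ → ℂ} {η w₁ : ℂ} {F : ℂ → ℂ}

lemma SolvesBVP.apply_add_period (hφ : IsUniformization m U φ) (hF : SolvesBVP U η (φ w₁) F)
    {w : ℂ} (hw : w ∈ strip) : F (φ (w + m)) = -F (φ w) := by
  rw [hφ.equivariant w hw, hF.antiperiodic _ (hφ.bijective.mapsTo hw)]

lemma SolvesBVP.differentiableAt (hU : IsCylindricalDomain U) (hφ : IsUniformization m U φ)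
    (hw₁ : w₁ ∈ strip) (hF : SolvesBVP U η (φ w₁) F) {w : ℂ} (hw : w ∈ strip)
    (hne : ∀ k : ℤ, w ≠ w₁ + k * m) : DifferentiableAt ℂ F (φ w) := by
  refine hF.holomorphic.differentiableAt (IsOpen.mem_nhds ?_ ⟨hφ.bijective.mapsTo hw, fun k h => ?_⟩)
  · have hcl : IsClosed {z : ℂ | ∃ k : ℤ, z = φ w₁ + k} := by
      have h1 : IsClosed (range ((↑) : ℤ → ℂ)) := Complex.isClosed_range_intCast
      have h2 : {z : ℂ | ∃ k : ℤ, z = φ w₁ + k} = (fun z => z - φ w₁) ⁻¹' range ((↑) : ℤ → ℂ) := by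
        ext z
        simp only [mem_ofPred_eq, mem_preimage, mem_range]
        exact exists_congr fun k => ⟨fun h => by rw [h]; ring, fun h => by rw [h]; ring⟩
      rw [h2]
      exact h1.preimage (by fun_prop)
    have h3 : {z | z ∈ U ∧ ∀ k : ℤ, z ≠ φ w₁ + k} = U ∩ {z : ℂ | ∃ k : ℤ, z = φ w₁ + k}ᶜ := by
      ext z
      simp
    rw [h3]
    exact hU.isOpen.inter hcl.isOpen_compl
  · rw [← hφ.add_int_mul hw₁] at h
    exact hne k (hφ.bijective.injOn hw (add_int_mul_mem_strip hw₁ k) h)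

/-- Below the singularity `F ∘ φ` is holomorphic with period `2m`, and `eventually_bottom` makes its
real part uniformly small near the bottom, so the reflection lemma applies. Antiperiodicity
propagates by the identity theorem. -/
lemma SolvesBVP.exists_bottom_extension (hU : IsCylindricalDomain U) (hm : 0 < m)
    (hφ : IsUniformization m U φ) (hw₁ : w₁ ∈ strip) (hF : SolvesBVP U η (φ w₁) F) :
    ∃ δ > 0, ∃ B : ℂ → ℂ, (∀ w : ℂ, -δ < w.im → w.im < δ → AnalyticAt ℂ B w) ∧
      (∀ w : ℂ, 0 < w.im → w.im < δ → B w = F (φ w)) ∧ (∀ x : ℝ, (B x).re = 0) ∧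
      ∀ w : ℂ, -δ < w.im → w.im < δ → B (w + m) = -B w := by
  have hpi := Real.pi_pos
  have hpos := hw₁.1
  have hmem : ∀ z : ℂ, 0 < z.im → z.im < w₁.im → z ∈ strip := fun z h0 h1 => ⟨h0, h1.trans hw₁.2⟩
  obtain ⟨g, hgd, hg, hgc⟩ := exists_extension_of_re_tendsto (P := 2 * m) (f := fun w => F (φ w))
    (by linarith) hpos (fun z h0 h1 => by
      refine DifferentiableAt.fun_comp' z (hF.differentiableAt hU hφ hw₁ (hmem z h0 h1) fun k hk => ?_)
        (hφ.analyticAt (hmem z h0 h1)).differentiableAt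
      rw [hk] at h1
      simp at h1) (fun z h0 h1 => by
      have h2 := hmem z h0 h1
      have h3 := hF.apply_add_period hφ (add_ofReal_mem_strip h2 m)
      rw [hF.apply_add_period hφ h2, neg_neg] at h3
      rw [← h3]
      congr 2
      push_cast
      ring) (fun ε hε => by
      obtain ⟨δ, hδ, h⟩ := hφ.eventually_bottom hU hm (p := fun z => |(F z).re| < ε)
        (fun z hz => by rw [hF.antiperiodic z hz, neg_re, abs_neg]) (fun a ha => by
          have := Metric.tendsto_nhds.mp (hF.bottom a ha) ε hε
          simpa [Real.dist_eq] using this)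
      refine ⟨min δ Real.pi, lt_min hδ hpi, fun z h0 h1 => h z ⟨h0, h1.trans_le (min_le_right _ _)⟩
        (h1.trans_le (min_le_left _ _))⟩)
  have hopen : IsOpen {z : ℂ | |z.im| < w₁.im / 2} :=
    isOpen_lt (continuous_abs.comp continuous_im) continuous_const
  have hga : ∀ w : ℂ, -(w₁.im / 2) < w.im → w.im < w₁.im / 2 → AnalyticAt ℂ g w :=
    fun w h0 h1 => hgd.analyticAt (hopen.mem_nhds (abs_lt.mpr ⟨h0, h1⟩))
  refine ⟨w₁.im / 2, by linarith, g, hga, hg, fun x => ?_, ?_⟩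
  · have h1 := hgc x
    rw [Complex.conj_ofReal] at h1
    have h2 := congrArg Complex.re h1
    simp at h2
    linarith
  · refine analytic_antiperiodic_of_subset (a' := 0) (b' := w₁.im / 2) (by linarith) (by linarith)
      le_rfl hga fun w h0 h1 => ?_
    rw [hg w h0 h1, hg _ (by simpa using h0) (by simpa using h1)]
    exact hF.apply_add_period hφ (hmem w h0 (by linarith))

/-- Near the top boundary, the pulled back solution has a quasi-antiperiodic primitive with
imaginary part vanishing uniformly at the top. -/
lemma SolvesBVP.exists_primitive (hU : IsCylindricalDomain U) (hm : 0 < m)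
    (hφ : IsUniformization m U φ) (hF : SolvesBVP U η (φ w₁) F) :
    ∃ δ > 0, δ ≤ Real.pi ∧ ∃ H : ℂ → ℂ,
      (∀ w : ℂ, Real.pi - δ < w.im → w.im < Real.pi → HasDerivAt H (F (φ w) * deriv φ w) w) ∧
      (∀ w : ℂ, Real.pi - δ < w.im → w.im < Real.pi → H (w + m) = -H w) ∧
      ∀ ε > 0, ∃ δ' > 0, ∀ w : ℂ, Real.pi - δ' < w.im → w.im < Real.pi → |(H w).im| < ε := by
  have hpi := Real.pi_pos
  obtain ⟨V, g, hVo, hVp, hVt, hg, hlim⟩ := hF.top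
  obtain ⟨δ₁, hδ₁, hV⟩ := hφ.eventually_top hU hm (p := fun z => z ∈ V) (fun z _ => hVp z)
    (fun a ha => mem_nhdsWithin_of_mem_nhds (hVo.mem_nhds (hVt ha)))
  set δ := min δ₁ Real.pi with hδ
  have hδ0 : 0 < δ := lt_min hδ₁ hpi
  have hmem : ∀ w : ℂ, Real.pi - δ < w.im → w.im < Real.pi → w ∈ strip := fun w h0 h1 =>
    ⟨by linarith [min_le_right δ₁ Real.pi], h1⟩
  have hderiv : ∀ w : ℂ, Real.pi - δ < w.im → w.im < Real.pi →
      HasDerivAt (fun w => g (φ w)) (F (φ w) * deriv φ w) w := by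
    intro w h0 h1
    have hw := hmem w h0 h1
    exact (hg _ ⟨hφ.bijective.mapsTo hw, hV w hw (by linarith [min_le_left δ₁ Real.pi])⟩).comp w
      (hφ.analyticAt hw).differentiableAt.hasDerivAt
  -- The integrand is antiperiodic, so this sum has zero derivative; subtracting `K / 2` from the
  -- primitive makes it antiperiodic.
  obtain ⟨K, hK⟩ : ∃ K, ∀ w : ℂ, Real.pi - δ < w.im → w.im < Real.pi →
      g (φ (w + m)) + g (φ w) = K := by
    have hS : IsOpen {w : ℂ | Real.pi - δ < w.im ∧ w.im < Real.pi} :=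
      (isOpen_lt continuous_const continuous_im).inter (isOpen_lt continuous_im continuous_const)
    have hc : IsPreconnected {w : ℂ | Real.pi - δ < w.im ∧ w.im < Real.pi} :=
      ((convex_halfSpace_im_gt _).inter (convex_halfSpace_im_lt _)).isPreconnected
    have hd : ∀ w ∈ {w : ℂ | Real.pi - δ < w.im ∧ w.im < Real.pi},
        HasDerivAt (fun w => g (φ (w + m)) + g (φ w)) 0 w := by
      intro w hw
      have h1 := (hderiv (w + m) (by simpa using hw.1) (by simpa using hw.2)).comp_add_const w (m : ℂ)
      have h2 := h1.add (hderiv w hw.1 hw.2)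
      have h3 := hmem w hw.1 hw.2
      rw [hF.apply_add_period hφ h3, hφ.deriv_add_period h3, neg_mul, neg_add_cancel] at h2
      exact h2
    obtain ⟨K, hK⟩ := hS.exists_is_const_of_deriv_eq_zero hc
      (fun w hw => (hd w hw).differentiableAt.differentiableWithinAt) (fun w hw => (hd w hw).deriv)
    exact ⟨K, fun w h0 h1 => hK w ⟨h0, h1⟩⟩
  -- Smallness of `Im g` is not yet known to be periodic, so it is claimed for some translate. The
  -- pair of consecutive translates shows that `K` is real, after which `|Im g|` is periodic
  -- (`habs`).
  have hnear : ∀ ε > 0, ∃ δ' > 0, δ' ≤ δ ∧ ∀ w : ℂ, Real.pi - δ' < w.im → w.im < Real.pi →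
      ∃ k : ℤ, |(g (φ (w + k * m))).im| < ε ∧ |(g (φ (w + k * m + m))).im| < ε := by
    intro ε hε
    obtain ⟨δ₂, hδ₂, h⟩ := hφ.eventually_top hU hm
      (p := fun z => ∃ k : ℤ, |(g (z + k)).im| < ε ∧ |(g (z + k + 1)).im| < ε)
      (fun z _ => by
        constructor
        · rintro ⟨k, h1, h2⟩
          refine ⟨k + 1, ?_, ?_⟩ <;> push_cast
          · rwa [← add_assoc, add_right_comm]
          · rwa [← add_assoc, add_right_comm z]
        · rintro ⟨k, h1, h2⟩
          refine ⟨k - 1, ?_, ?_⟩ <;> push_cast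
          · rwa [show z + 1 + (k - 1 : ℂ) = z + k by ring]
          · rwa [show z + 1 + (k - 1 : ℂ) = z + k by ring])
      (fun a ha => by
        have h1 := Metric.tendsto_nhds.mp (hlim a ha) ε hε
        have h2 := Metric.tendsto_nhds.mp (hlim _ (topBoundary_add_one hU ha)) ε hε
        have ht : Tendsto (fun z : ℂ => z + 1) (𝓝[U] a) (𝓝[U] (a + 1)) := by
          refine tendsto_nhdsWithin_iff.mpr ⟨?_, ?_⟩
          · exact ((continuous_add_const (1 : ℂ)).tendsto a).mono_left nhdsWithin_le_nhds
          · filter_upwards [self_mem_nhdsWithin] with z hz using (hU.periodic z).mpr hz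
        filter_upwards [h1, ht.eventually h2] with z h3 h4
        refine ⟨0, ?_, ?_⟩
        · simpa [Real.dist_eq] using h3
        · simpa [Real.dist_eq] using h4)
    refine ⟨min δ₂ δ, lt_min hδ₂ hδ0, min_le_right _ _, fun w h0 h1 => ?_⟩
    have hw := hmem w (by linarith [min_le_right δ₂ δ]) h1
    obtain ⟨k, h2, h3⟩ := h w hw (by linarith [min_le_left δ₂ δ])
    refine ⟨k, ?_, ?_⟩
    · rwa [hφ.add_int_mul hw]
    · rwa [hφ.equivariant _ (add_int_mul_mem_strip hw k), hφ.add_int_mul hw]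
  have hKim : K.im = 0 := by
    rw [← abs_eq_zero]
    refine le_antisymm (le_of_forall_pos_le_add fun ε hε => ?_) (abs_nonneg _)
    obtain ⟨δ', hδ', hle, h⟩ := hnear (ε / 2) (by linarith)
    have h0 : Real.pi - δ' < ((Real.pi - δ' / 2 : ℝ) * I : ℂ).im := by simp; linarith
    have h1 : ((Real.pi - δ' / 2 : ℝ) * I : ℂ).im < Real.pi := by simp; linarith
    obtain ⟨k, h2, h3⟩ := h _ h0 h1
    have h4 := hK ((Real.pi - δ' / 2 : ℝ) * I + k * m) (by simp; linarith) (by simp; linarith)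
    rw [← h4, add_im]
    refine (abs_add_le _ _).trans ?_
    linarith
  have habs : ∀ (w : ℂ), Real.pi - δ < w.im → w.im < Real.pi → ∀ k : ℤ,
      |(g (φ (w + k * m))).im| = |(g (φ w)).im| := by
    intro w h0 h1 k
    have hstep : ∀ w : ℂ, Real.pi - δ < w.im → w.im < Real.pi →
        |(g (φ (w + m))).im| = |(g (φ w)).im| := by
      intro w h0 h1
      have := congrArg Complex.im (hK w h0 h1)
      rw [add_im, hKim] at this
      rw [eq_neg_of_add_eq_zero_left this, abs_neg]
    induction k using Int.induction_on with
    | zero => simp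
    | succ n ih =>
      rw [← ih, ← hstep (w + (n : ℤ) * m) (by simpa using h0) (by simpa using h1)]
      push_cast
      ring_nf
    | pred n ih =>
      rw [← ih, ← hstep (w + ((-n - 1 : ℤ) : ℂ) * m) (by simpa using h0) (by simpa using h1)]
      push_cast
      ring_nf
  refine ⟨δ, hδ0, min_le_right _ _, fun w => g (φ w) - K / 2, fun w h0 h1 =>
    (hderiv w h0 h1).sub_const _, fun w h0 h1 => ?_, fun ε hε => ?_⟩
  · linear_combination hK w h0 h1
  · obtain ⟨δ', hδ', hle, h⟩ := hnear ε hε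
    refine ⟨δ', hδ', fun w h0 h1 => ?_⟩
    obtain ⟨k, h2, -⟩ := h w h0 h1
    rw [habs w (by linarith) h1] at h2
    have h3 : (K / 2).im = 0 := by
      rw [show (2 : ℂ) = (2 : ℝ) by norm_cast, Complex.div_ofReal_im, hKim, zero_div]
    rwa [sub_im, h3, sub_zero]

/-- Turned over by `w ↦ πi - w` and multiplied by `i`, the primitive has real part tending to zero
at the bottom. It extends by reflection, and the derivative of the extension recovers `(F ∘ φ) φ'`
and its reality on the top line. -/
lemma SolvesBVP.exists_top_extension (hU : IsCylindricalDomain U) (hm : 0 < m)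
    (hφ : IsUniformization m U φ) (hF : SolvesBVP U η (φ w₁) F) :
    ∃ δ > 0, ∃ T : ℂ → ℂ,
      (∀ w : ℂ, Real.pi - δ < w.im → w.im < Real.pi + δ → AnalyticAt ℂ T w) ∧
      (∀ w : ℂ, Real.pi - δ < w.im → w.im < Real.pi → T w = F (φ w) * deriv φ w) ∧
      (∀ x : ℝ, (T (x + Real.pi * I)).im = 0) ∧
      ∀ w : ℂ, Real.pi - δ < w.im → w.im < Real.pi + δ → T (w + m) = -T w := by
  have hpi := Real.pi_pos
  obtain ⟨δ, hδ, hδpi, H, hHd, hHm, hHim⟩ := hF.exists_primitive hU hm hφ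
  have him : ∀ z : ℂ, (Real.pi * I - z).im = Real.pi - z.im := fun z => by simp
  obtain ⟨G, hGd, hG, hGc⟩ := exists_extension_of_re_tendsto (P := 2 * m) (δ := δ)
    (f := fun z => I * H (Real.pi * I - z)) (by linarith) hδ (fun z h0 h1 => by
      have h2 := (hHd (Real.pi * I - z) (by rw [him]; linarith)
        (by rw [him]; linarith)).differentiableAt
      exact (DifferentiableAt.fun_comp' z h2 (by fun_prop)).const_mul I) (fun z h0 h1 => by
      have h2 := hHm (Real.pi * I - (z + (2 * m : ℝ))) (by rw [him]; simp; linarith)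
        (by rw [him]; simpa using h0)
      have h3 := hHm (Real.pi * I - (z + (2 * m : ℝ)) + m) (by simp; linarith) (by simpa using h0)
      have h4 : Real.pi * I - (z + (2 * m : ℝ)) + m + m = Real.pi * I - z := by push_cast; ring
      rw [h2, neg_neg, h4] at h3
      simp only [h3]) (fun ε hε => by
      obtain ⟨δ', hδ', h⟩ := hHim ε hε
      refine ⟨δ', hδ', fun z h0 h1 => ?_⟩
      have := h (Real.pi * I - z) (by rw [him]; linarith) (by rw [him]; linarith)
      simpa using this)
  have hopen : IsOpen {z : ℂ | |z.im| < δ / 2} :=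
    isOpen_lt (continuous_abs.comp continuous_im) continuous_const
  have hGa : ∀ w : ℂ, -(δ / 2) < w.im → w.im < δ / 2 → AnalyticAt ℂ G w :=
    fun w h0 h1 => hGd.analyticAt (hopen.mem_nhds (abs_lt.mpr ⟨h0, h1⟩))
  have hTa : ∀ w : ℂ, Real.pi - δ / 2 < w.im → w.im < Real.pi + δ / 2 →
      AnalyticAt ℂ (fun w => I * deriv G (Real.pi * I - w)) w := by
    intro w h0 h1
    exact analyticAt_const.fun_mul (AnalyticAt.fun_comp (f := fun w => Real.pi * I - w)
      (hGa _ (by rw [him]; linarith) (by rw [him]; linarith)).deriv (by fun_prop))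
  have hT : ∀ w : ℂ, Real.pi - δ / 2 < w.im → w.im < Real.pi →
      I * deriv G (Real.pi * I - w) = F (φ w) * deriv φ w := by
    intro w h0 h1
    have hopen' : IsOpen {z : ℂ | 0 < z.im ∧ z.im < δ / 2} :=
      (isOpen_lt continuous_const continuous_im).inter (isOpen_lt continuous_im continuous_const)
    have h2 : G =ᶠ[𝓝 (Real.pi * I - w)] fun z => I * H (Real.pi * I - z) := by
      filter_upwards [hopen'.mem_nhds (⟨by rw [him]; linarith, by rw [him]; linarith⟩ :
        Real.pi * I - w ∈ {z : ℂ | 0 < z.im ∧ z.im < δ / 2})] with z hz using hG z hz.1 hz.2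
    have h3 : HasDerivAt (fun z => I * H (Real.pi * I - z)) (I * -(F (φ w) * deriv φ w))
        (Real.pi * I - w) := by
      have h4 := hHd w (by linarith) h1
      have h5 : HasDerivAt H (F (φ w) * deriv φ w) (Real.pi * I - (Real.pi * I - w)) := by
        rwa [sub_sub_cancel]
      exact (h5.comp_const_sub (Real.pi * I) (Real.pi * I - w)).const_mul I
    rw [h2.deriv_eq, h3.deriv, ← mul_assoc, mul_comm, ← mul_assoc]
    linear_combination -(F (φ w) * deriv φ w) * Complex.I_mul_I
  refine ⟨δ / 2, by linarith, fun w => I * deriv G (Real.pi * I - w), hTa, hT, fun x => ?_, ?_⟩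
  · have h1 : HasDerivAt G (deriv G ((-x : ℝ) : ℂ)) ((-x : ℝ) : ℂ) :=
      (hGa _ (by simp; linarith) (by simp; linarith)).differentiableAt.hasDerivAt
    have h2 := h1.real_of_complex
    have h3 : (fun x : ℝ => (G x).re) = fun _ => 0 := by
      funext y
      have h4 := congrArg Complex.re (hGc y)
      rw [Complex.conj_ofReal] at h4
      simp at h4
      linarith
    rw [h3] at h2
    have h4 := h2.unique (hasDerivAt_const _ _)
    have h5 : (Real.pi * I - (x + Real.pi * I) : ℂ) = ((-x : ℝ) : ℂ) := by push_cast; ring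
    simp only [h5]
    simpa using h4
  · refine analytic_antiperiodic_of_subset (a' := Real.pi - δ / 2) (b' := Real.pi) le_rfl
      (by linarith) (by linarith) hTa fun w h0 h1 => ?_
    have hw : w ∈ strip := ⟨by linarith, h1⟩
    rw [hT w h0 h1, hT _ (by simpa using h0) (by simpa using h1), hF.apply_add_period hφ hw,
      hφ.deriv_add_period hw, neg_mul]

end BVP

/-! ### Algebra of removable singularities. -/

lemma RemovableAt.add {f g : ℂ → ℂ} {z : ℂ} (hf : RemovableAt f z) (hg : RemovableAt g z) :
    RemovableAt (fun w => f w + g w) z := by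
  obtain ⟨f', hf', hfe⟩ := hf
  obtain ⟨g', hg', hge⟩ := hg
  exact ⟨fun w => f' w + g' w, hf'.fun_add hg', hfe.add hge⟩

lemma RemovableAt.mul {f g : ℂ → ℂ} {z : ℂ} (hf : RemovableAt f z) (hg : RemovableAt g z) :
    RemovableAt (fun w => f w * g w) z := by
  obtain ⟨f', hf', hfe⟩ := hf
  obtain ⟨g', hg', hge⟩ := hg
  exact ⟨fun w => f' w * g' w, hf'.fun_mul hg', hfe.mul hge⟩

lemma RemovableAt.congr {f g : ℂ → ℂ} {z : ℂ} (hf : RemovableAt f z) (h : f =ᶠ[𝓝[≠] z] g) :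
    RemovableAt g z := by
  obtain ⟨f', hf', hfe⟩ := hf
  exact ⟨f', hf', h.symm.trans hfe⟩

lemma RemovableAt.comp_add_const {f : ℂ → ℂ} {z c : ℂ} (h : RemovableAt f (z + c)) :
    RemovableAt (fun w => f (w + c)) z := by
  obtain ⟨g, hg, he⟩ := h
  exact ⟨fun w => g (w + c), AnalyticAt.fun_comp (f := fun w => w + c) hg (by fun_prop),
    (tendsto_add_const_nhdsNE z c).eventually he⟩

lemma RemovableAt.add_int_mul {f : ℂ → ℂ} {m : ℝ} {C : ℂ} (hC : C ≠ 0) {S : Set ℂ} (hSo : IsOpen S)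
    (hS : ∀ w : ℂ, w + m ∈ S ↔ w ∈ S) (hf : ∀ w ∈ S, f (w + m) = C * f w) {z : ℂ} (hz : z ∈ S)
    (h : RemovableAt f z) (k : ℤ) : z + k * m ∈ S ∧ RemovableAt f (z + k * m) := by
  have hc : ∀ c z : ℂ, RemovableAt (fun _ => c) z := fun c z => analyticAt_const.removableAt
  have hstep : ∀ z ∈ S, (RemovableAt f (z + m) ↔ RemovableAt f z) := by
    intro z hz
    have hev : ∀ᶠ w in 𝓝[≠] z, f (w + m) = C * f w := by
      filter_upwards [mem_nhdsWithin_of_mem_nhds (hSo.mem_nhds hz)] with w hw using hf w hw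
    constructor
    · intro h
      refine ((hc C⁻¹ z).mul h.comp_add_const).congr ?_
      filter_upwards [hev] with w hw
      rw [hw, inv_mul_cancel_left₀ hC]
    · intro h
      have h2 : RemovableAt (fun w => f (w + m)) z :=
        ((hc C z).mul h).congr (hev.mono fun w hw => hw.symm)
      have h3 : RemovableAt (fun w => f (w + m)) (z + m + -m) := by rwa [add_neg_cancel_right]
      refine (RemovableAt.comp_add_const (f := fun w => f (w + m)) (c := -m) h3).congr
        (.of_forall fun w => ?_)
      simp
  induction k using Int.induction_on with
  | zero => simpa using ⟨hz, h⟩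
  | succ n ih =>
    have e : z + ((n + 1 : ℤ) : ℂ) * m = z + (n : ℤ) * m + m := by push_cast; ring
    rw [e]
    exact ⟨(hS _).mpr ih.1, (hstep _ ih.1).mpr ih.2⟩
  | pred n ih =>
    have e : z + ((-n : ℤ) : ℂ) * m = z + ((-n - 1 : ℤ) : ℂ) * m + m := by push_cast; ring
    rw [e] at ih
    have h1 := (hS _).mp ih.1
    exact ⟨h1, (hstep _ h1).mp ih.2⟩

lemma removableAt_of_isBigO_one {f : ℂ → ℂ} {z : ℂ} (hd : ∀ᶠ w in 𝓝[≠] z, DifferentiableAt ℂ f w)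
    (hb : f =O[𝓝[≠] z] fun _ => (1 : ℝ)) : RemovableAt f z := by
  have h0 : Tendsto (fun w : ℂ => w - z) (𝓝[≠] z) (𝓝 0) := by
    have : Continuous fun w : ℂ => w - z := by fun_prop
    simpa using (this.tendsto z).mono_left nhdsWithin_le_nhds
  have h1 : AnalyticAt ℂ (fun w => (w - z) * f w) z := by
    refine analyticAt_of_differentiable_on_punctured_nhds_of_continuousAt ?_ ?_
    · filter_upwards [hd] with w hw
      exact (by fun_prop : DifferentiableAt ℂ (fun w : ℂ => w - z) w).mul hw
    · rw [continuousAt_iff_punctured_nhds, sub_self, zero_mul]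
      have h2 : (fun w => (w - z) * f w) =O[𝓝[≠] z] fun w => ‖w - z‖ * (1 : ℝ) :=
        (Asymptotics.isBigO_refl _ _).norm_right.mul hb
      refine h2.trans_tendsto ?_
      simpa using h0.norm
  refine removableAt_div_sub h1 (by simp) ?_
  filter_upwards [self_mem_nhdsWithin] with w hw
  rw [mul_div_cancel_left₀ _ (sub_ne_zero.mpr hw)]

/-- Extensions of a solution of the boundary value problem, pulled back to the strip: `b` across
the bottom, and `t = b φ'` across the top. -/
structure BVPExtension (m : ℝ) (φ F : ℂ → ℂ) (η w₁ : ℂ) (δ : ℝ) (b t : ℂ → ℂ) : Prop where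
  pos : 0 < δ
  le_im : δ ≤ w₁.im
  eq_bottom : ∀ w ∈ strip, b w = F (φ w)
  eq_top : ∀ w ∈ strip, t w = F (φ w) * deriv φ w
  analytic_bottom : ∀ w : ℂ, -δ < w.im → w.im < Real.pi → (∀ k : ℤ, w ≠ w₁ + k * m) →
    AnalyticAt ℂ b w
  analytic_top : ∀ w : ℂ, 0 < w.im → w.im < Real.pi + δ → (∀ k : ℤ, w ≠ w₁ + k * m) →
    AnalyticAt ℂ t w
  multiplier_bottom : ∀ w : ℂ, -δ < w.im → w.im < Real.pi → b (w + m) = -b w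
  multiplier_top : ∀ w : ℂ, 0 < w.im → w.im < Real.pi + δ → t (w + m) = -t w
  real_bottom : ∀ x : ℝ, (b x).re = 0
  real_top : ∀ x : ℝ, (t (x + Real.pi * I)).im = 0
  singularity : RemovableAt
    (fun w => b w - 1 / (Real.pi * I) * (conj η / deriv φ w₁) / (w - w₁)) w₁

section BVP

variable {m : ℝ} {U : Set ℂ} {φ : ℂ → ℂ} {η w₁ : ℂ} {F : ℂ → ℂ}

lemma eventually_ne_add_int_mul (hm : 0 < m) (w₁ : ℂ) :
    ∀ᶠ w in 𝓝[≠] w₁, ∀ k : ℤ, w ≠ w₁ + k * m := by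
  filter_upwards [mem_nhdsWithin_of_mem_nhds (Metric.ball_mem_nhds w₁ hm), self_mem_nhdsWithin]
    with w hw hne k hk
  by_cases hk0 : k = 0
  · exact hne (by simpa [hk0] using hk)
  · rw [Metric.mem_ball, dist_eq_norm, hk, add_sub_cancel_left, norm_mul, Complex.norm_intCast,
      Complex.norm_real, Real.norm_eq_abs, abs_of_pos hm] at hw
    have h1 : (1 : ℝ) ≤ |(k : ℝ)| := by exact_mod_cast Int.one_le_abs hk0
    nlinarith

/-- Since `φ(w) - φ(w₁) = (w - w₁) s(w)` with `s(w₁) = φ'(w₁)`, the change of coordinate divides the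
residue by `φ'(w₁)` and adds only a removable term. -/
lemma SolvesBVP.removableAt_singularity (hU : IsCylindricalDomain U) (hm : 0 < m)
    (hφ : IsUniformization m U φ) (hw₁ : w₁ ∈ strip) (hF : SolvesBVP U η (φ w₁) F) :
    RemovableAt (fun w => F (φ w) - 1 / (Real.pi * I) * (conj η / deriv φ w₁) / (w - w₁)) w₁ := by
  have hφa := hφ.analyticAt hw₁
  have hφ0 := hφ.deriv_ne_zero hw₁
  set s : ℂ → ℂ := dslope φ w₁ with hs
  have hsa : AnalyticAt ℂ s w₁ := analyticAt_dslope hφa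
  have hs1 : s w₁ = deriv φ w₁ := dslope_same _ _
  have hsφ : ∀ w, φ w - φ w₁ = (w - w₁) * s w := fun w => by
    rw [← smul_eq_mul, hs, sub_smul_dslope]
  have hstrip : ∀ᶠ w in 𝓝[≠] w₁, w ∈ strip := mem_nhdsWithin_of_mem_nhds (isOpen_strip.mem_nhds hw₁)
  have hinj : ∀ᶠ w in 𝓝[≠] w₁, φ w ≠ φ w₁ := by
    filter_upwards [hstrip, self_mem_nhdsWithin] with w h1 h2 h3
    exact h2 (hφ.bijective.injOn h1 hw₁ h3)
  have hlim : Tendsto φ (𝓝[≠] w₁) (𝓝[≠] (φ w₁)) :=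
    tendsto_nhdsWithin_iff.mpr ⟨hφa.continuousAt.tendsto.mono_left nhdsWithin_le_nhds, hinj⟩
  have h1 : RemovableAt (fun w => F (φ w) - 1 / (Real.pi * I) * (conj η / (φ w - φ w₁))) w₁ := by
    refine removableAt_of_isBigO_one ?_ (hF.singularity.comp_tendsto hlim)
    filter_upwards [hstrip, hinj, eventually_ne_add_int_mul hm w₁] with w h2 h3 h4
    have h5 := (hφ.analyticAt h2).differentiableAt
    have h6 := DifferentiableAt.fun_comp' w (hF.differentiableAt hU hφ hw₁ h2 h4) h5
    exact h6.sub ((differentiableAt_const _).mul ((differentiableAt_const _).div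
      (h5.sub_const _) (sub_ne_zero.mpr h3)))
  have h2 : RemovableAt (fun w => 1 / (Real.pi * I) * conj η *
      (1 / (φ w - φ w₁) - 1 / deriv φ w₁ / (w - w₁))) w₁ := by
    refine RemovableAt.mul analyticAt_const.removableAt ?_
    refine removableAt_div_sub (f := fun w => 1 / s w - 1 / s w₁) ?_ (by simp) ?_
    · have : s w₁ ≠ 0 := by rwa [hs1]
      exact ((analyticAt_const.fun_div hsa this).fun_sub analyticAt_const)
    · filter_upwards [self_mem_nhdsWithin] with w hw
      rw [hsφ, hs1, sub_div, div_div 1 (s w), mul_comm (s w)]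
  refine (h1.add h2).congr (.of_forall fun w => ?_)
  ring

lemma SolvesBVP.exists_extension (hU : IsCylindricalDomain U) (hm : 0 < m)
    (hφ : IsUniformization m U φ) (hw₁ : w₁ ∈ strip) (hF : SolvesBVP U η (φ w₁) F) :
    ∃ (δ : ℝ) (b t : ℂ → ℂ), BVPExtension m φ F η w₁ δ b t := by
  have hpi := Real.pi_pos
  obtain ⟨δ₁, hδ₁, B, hBa, hB, hBr, hBm⟩ := hF.exists_bottom_extension hU hm hφ hw₁
  obtain ⟨δ₂, hδ₂, T, hTa, hT, hTr, hTm⟩ := hF.exists_top_extension hU hm hφ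
  set δ := min (min δ₁ δ₂) (min w₁.im (Real.pi - w₁.im)) with hδ
  have e1 : δ ≤ δ₁ := (min_le_left _ _).trans (min_le_left _ _)
  have e2 : δ ≤ δ₂ := (min_le_left _ _).trans (min_le_right _ _)
  have e3 : δ ≤ w₁.im := (min_le_right _ _).trans (min_le_left _ _)
  have e4 : δ ≤ Real.pi - w₁.im := (min_le_right _ _).trans (min_le_right _ _)
  have hδ0 : 0 < δ := lt_min (lt_min hδ₁ hδ₂) (lt_min hw₁.1 (by linarith [hw₁.2]))
  have hFa : ∀ w ∈ strip, (∀ k : ℤ, w ≠ w₁ + k * m) → AnalyticAt ℂ (fun w => F (φ w)) w := by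
    intro w hw hne
    have hne' : ∀ᶠ w' in 𝓝 w, ∀ k : ℤ, w' ≠ w₁ + k * m := by
      have hcl : IsClosed (range fun k : ℤ => w₁ + k * (m : ℂ)) := by
        have h1 : IsClosed (range ((↑) : ℤ → ℂ)) := Complex.isClosed_range_intCast
        have hm' : (m : ℂ) ≠ 0 := by exact_mod_cast hm.ne'
        have h2 : (range fun k : ℤ => w₁ + k * (m : ℂ)) =
            (fun z => (z - w₁) / m) ⁻¹' range ((↑) : ℤ → ℂ) := by
          ext z
          simp only [mem_preimage, mem_range]
          refine exists_congr fun k => ⟨fun h => ?_, fun h => ?_⟩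
          · rw [← h]
            field_simp
            ring
          · rw [eq_div_iff hm'] at h
            rw [h]
            ring
        rw [h2]
        exact h1.preimage (by fun_prop)
      filter_upwards [hcl.isOpen_compl.mem_nhds (fun ⟨k, hk⟩ => hne k hk.symm)] with w' hw' k hk
      exact hw' ⟨k, hk.symm⟩
    rw [Complex.analyticAt_iff_eventually_differentiableAt]
    filter_upwards [hne', isOpen_strip.mem_nhds hw] with w' h1 h2
    exact DifferentiableAt.fun_comp' w' (hF.differentiableAt hU hφ hw₁ h2 h1)
      (hφ.analyticAt h2).differentiableAt
  refine ⟨δ, fun w => if w.im ≤ 0 then B w else F (φ w),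
    fun w => if Real.pi ≤ w.im then T w else F (φ w) * deriv φ w, hδ0, e3, ?_, ?_, ?_, ?_, ?_,
    ?_, ?_, ?_, ?_⟩
  · exact fun w hw => if_neg (not_le.mpr hw.1)
  · exact fun w hw => if_neg (not_le.mpr hw.2)
  · intro w h0 h1 hne
    rcases le_or_gt w.im 0 with h | h
    · refine (hBa w (by linarith) (by linarith)).congr ?_
      have hev : ∀ᶠ w' in 𝓝 w, w'.im < δ₁ :=
        continuous_im.continuousAt.eventually_lt continuousAt_const (by linarith)
      filter_upwards [hev] with w' hw'
      split_ifs with h2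
      · rfl
      · exact hB w' (not_le.mp h2) hw'
    · refine (hFa w ⟨h, h1⟩ hne).congr ?_
      have hev : ∀ᶠ w' in 𝓝 w, 0 < w'.im :=
        continuousAt_const.eventually_lt continuous_im.continuousAt h
      filter_upwards [hev] with w' hw'
      exact (if_neg (not_le.mpr hw')).symm
  · intro w h0 h1 hne
    rcases le_or_gt Real.pi w.im with h | h
    · refine (hTa w (by linarith) (by linarith)).congr ?_
      have hev : ∀ᶠ w' in 𝓝 w, Real.pi - δ₂ < w'.im :=
        continuousAt_const.eventually_lt continuous_im.continuousAt (by linarith)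
      filter_upwards [hev] with w' hw'
      split_ifs with h2
      · rfl
      · exact hT w' hw' (not_le.mp h2)
    · refine ((hFa w ⟨h0, h⟩ hne).fun_mul (hφ.analyticAt ⟨h0, h⟩).deriv).congr ?_
      have hev : ∀ᶠ w' in 𝓝 w, w'.im < Real.pi :=
        continuous_im.continuousAt.eventually_lt continuousAt_const h
      filter_upwards [hev] with w' hw'
      exact (if_neg (not_le.mpr hw')).symm
  · intro w h0 h1
    simp only [add_im, ofReal_im, add_zero]
    split_ifs with h
    · exact hBm w (by linarith) (by linarith)
    · exact hF.apply_add_period hφ ⟨not_le.mp h, h1⟩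
  · intro w h0 h1
    simp only [add_im, ofReal_im, add_zero]
    split_ifs with h
    · exact hTm w (by linarith) (by linarith)
    · have hw : w ∈ strip := ⟨h0, not_le.mp h⟩
      rw [hF.apply_add_period hφ hw, hφ.deriv_add_period hw, neg_mul]
  · intro x
    simpa using hBr x
  · intro x
    simpa using hTr x
  · refine (hF.removableAt_singularity hU hm hφ hw₁).congr ?_
    filter_upwards [mem_nhdsWithin_of_mem_nhds (isOpen_strip.mem_nhds hw₁)] with w hw
    rw [if_neg (not_le.mpr hw.1)]

end BVP

/-! ### The zero-free factor of the kernel -/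

lemma exists_zero_of_antiperiodic {g : ℝ → ℝ} (hg : Continuous g) {m : ℝ}
    (h : ∀ x, g (x + m) = -g x) : ∃ x, g x = 0 := by
  have h1 := intermediate_value_uIcc (f := g) (a := 0) (b := m) hg.continuousOn
  have h2 := h 0
  rw [zero_add] at h2
  obtain ⟨x, -, hx⟩ := h1 (show (0 : ℝ) ∈ uIcc (g 0) (g m) by
    rw [h2, mem_uIcc]
    rcases le_total (g 0) 0 with h3 | h3
    · exact Or.inl ⟨h3, by linarith⟩
    · exact Or.inr ⟨by linarith, h3⟩)
  exact ⟨x, hx⟩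

/-- The point `πi/2` in the middle of the strip. -/
def midPoint : ℂ := (Real.pi / 2 : ℝ) * I

lemma midPoint_re : midPoint.re = 0 := by simp [midPoint]

lemma midPoint_im : midPoint.im = Real.pi / 2 := by simp [midPoint]

lemma midPoint_mem_strip : midPoint ∈ strip := by
  have := Real.pi_pos
  constructor <;> rw [midPoint_im] <;> linarith

/-- The inverse of the elliptic function of the second kind with poles at `± πi/2` and zeros at the
boundary points `p` and `q + πi`. -/
def thetaQuot (m p q : ℝ) (w : ℂ) : ℂ :=
  thetaPair m midPoint w / (cexp (w / 2) * theta m (w - p) * theta m (w - (q + Real.pi * I)))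

section Theta

variable {m : ℝ}

/-- Numerator and denominator carry two theta factors each, so the dependence on `w` cancels. The
multiplier is negative because one pole is displaced by `πi`. -/
lemma thetaQuot_add_period (hm : 0 < m) (p q : ℝ) (w : ℂ) :
    thetaQuot m p q (w + m) = -cexp (p + q - m / 2) * thetaQuot m p q w := by
  rw [thetaQuot, thetaQuot, thetaPair_add_period hm, midPoint_re,
    show (w + m - p : ℂ) = w - p + m by ring,
    show (w + m - (q + Real.pi * I) : ℂ) = w - (q + Real.pi * I) + m by ring, theta_add_period hm, theta_add_period hm, add_div, Complex.exp_add]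
  have h1 : cexp (2 * w + m - 2 * (0 : ℝ)) = -cexp (p + q - m / 2) *
      (cexp (m / 2) * cexp (w - p + m / 2) * cexp (w - (q + Real.pi * I) + m / 2)) := by
    rw [← Complex.exp_add, ← Complex.exp_add, neg_mul, ← Complex.exp_add]
    have : (2 * w + m - 2 * (0 : ℝ) : ℂ) = (p + q - m / 2 + (m / 2 + (w - p + m / 2) +
        (w - (q + Real.pi * I) + m / 2))) + Real.pi * I := by
      push_cast
      ring
    rw [this, Complex.exp_add _ (Real.pi * I), Complex.exp_pi_mul_I, mul_neg_one]
  rw [h1]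
  have e1 := Complex.exp_ne_zero (m / 2 : ℂ)
  have e2 := Complex.exp_ne_zero (w - p + m / 2 : ℂ)
  have e3 := Complex.exp_ne_zero (w - (q + Real.pi * I) + m / 2 : ℂ)
  rw [mul_assoc (-cexp (p + q - m / 2)), mul_div_assoc]
  congr 1
  rw [← mul_div_mul_left (thetaPair m midPoint w) _ (mul_ne_zero (mul_ne_zero e1 e2) e3)]
  congr 1
  ring

/-- Conjugation moves the pole `q + πi` by a period `2πi`, at the cost of one sign. Being imaginary
here, the quotient makes its product with a solution real. -/
lemma conj_thetaQuot_bottom (hm : 0 < m) (p q x : ℝ) :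
    conj (thetaQuot m p q x) = -thetaQuot m p q x := by
  rw [thetaQuot, map_div₀, map_mul, map_mul, ← theta_conj hm, ← theta_conj hm, ← Complex.exp_conj,
    Complex.conj_eq_iff_im.mpr (thetaPair_real_bottom hm _ x), map_div₀, map_sub, map_sub, map_add,
    map_mul, Complex.conj_ofReal, Complex.conj_ofReal, Complex.conj_ofReal, Complex.conj_ofReal,
    Complex.conj_I, map_ofNat,
    show (x - (q + Real.pi * -I) : ℂ) = x - (q + Real.pi * I) + 2 * Real.pi * I by ring,
    theta_add_two_pi, mul_neg, div_neg]

/-- The exponential and the theta factor at `p` both change sign, so the quotient is real. -/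
lemma conj_thetaQuot_top (hm : 0 < m) (p q x : ℝ) :
    conj (thetaQuot m p q (x + Real.pi * I)) = thetaQuot m p q (x + Real.pi * I) := by
  rw [thetaQuot, map_div₀, map_mul, map_mul, ← theta_conj hm, ← theta_conj hm, ← Complex.exp_conj,
    Complex.conj_eq_iff_im.mpr (thetaPair_real_top hm _ x), map_div₀, map_sub, map_sub, map_add,
    map_add, map_mul, Complex.conj_ofReal, Complex.conj_ofReal, Complex.conj_ofReal,
    Complex.conj_ofReal, Complex.conj_I, map_ofNat,
    show (x + Real.pi * -I - p : ℂ) = (x - p) - Real.pi * I by ring, theta_sub_pi_eq,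
    show (x - p + Real.pi * I : ℂ) = x + Real.pi * I - p by ring,
    show (x + Real.pi * -I - (q + Real.pi * -I) : ℂ) = x + Real.pi * I - (q + Real.pi * I) by ring,
    show ((x + Real.pi * -I) / 2 : ℂ) = (x + Real.pi * I) / 2 + -(Real.pi * I) by ring,
    Complex.exp_add, Complex.exp_neg, Complex.exp_pi_mul_I]
  norm_num

lemma analyticAt_theta_sub (hm : 0 < m) (z w : ℂ) : AnalyticAt ℂ (fun w => theta m (w - z)) w :=
  (analyticAt_theta hm _).fun_comp (f := fun w => w - z) (by fun_prop)

lemma analyticAt_thetaQuot (hm : 0 < m) (p q : ℝ) {w : ℂ} (hp : theta m (w - p) ≠ 0)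
    (hq : theta m (w - (q + Real.pi * I)) ≠ 0) : AnalyticAt ℂ (thetaQuot m p q) w := by
  refine (analyticAt_thetaPair hm _ w).fun_div (((by fun_prop :
    AnalyticAt ℂ (fun w : ℂ => cexp (w / 2)) w).fun_mul (analyticAt_theta_sub hm _ w)).fun_mul
    (analyticAt_theta_sub hm _ w)) ?_
  exact mul_ne_zero (mul_ne_zero (Complex.exp_ne_zero _) hp) hq

end Theta

section BVP

variable {m δ : ℝ} {U : Set ℂ} {φ F b t : ℂ → ℂ}

lemma BVPExtension.exists_zero_bottom {η w₁ : ℂ} (h : BVPExtension m φ F η w₁ δ b t)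
    (hw₁ : w₁ ∈ strip) : ∃ p : ℝ, b p = 0 := by
  have hpi := Real.pi_pos
  have ha : ∀ x : ℝ, AnalyticAt ℂ b x := fun x =>
    h.analytic_bottom x (by simpa using h.pos) (by simpa using hpi) fun k hk => by
      have := congrArg Complex.im hk
      simp at this
      exact hw₁.1.ne this
  have hc : Continuous fun x : ℝ => (b x).im := by
    rw [continuous_iff_continuousAt]
    intro x
    exact Complex.continuous_im.continuousAt.comp
      (ContinuousAt.comp (g := b) (ha x).continuousAt Complex.continuous_ofReal.continuousAt)
  obtain ⟨p, hp⟩ := exists_zero_of_antiperiodic hc (m := m) fun x => by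
    have := h.multiplier_bottom x (by simpa using h.pos) (by simpa using hpi)
    rw [Complex.ofReal_add, this, neg_im]
  exact ⟨p, Complex.ext (h.real_bottom p) hp⟩

lemma BVPExtension.exists_zero_top {η w₁ : ℂ} (h : BVPExtension m φ F η w₁ δ b t)
    (hw₁ : w₁ ∈ strip) : ∃ q : ℝ, t (q + Real.pi * I) = 0 := by
  have hpi := Real.pi_pos
  have ha : ∀ x : ℝ, AnalyticAt ℂ t (x + Real.pi * I) := fun x =>
    h.analytic_top _ (by simpa using hpi) (by simpa using h.pos) fun k hk => by
      have := congrArg Complex.im hk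
      simp at this
      exact hw₁.2.ne this.symm
  have hc : Continuous fun x : ℝ => (t (x + Real.pi * I)).re := by
    rw [continuous_iff_continuousAt]
    intro x
    exact Complex.continuous_re.continuousAt.comp
      (ContinuousAt.comp (g := t) (f := fun x : ℝ => (x + Real.pi * I : ℂ)) (ha x).continuousAt
        (continuous_line Real.pi).continuousAt)
  obtain ⟨q, hq⟩ := exists_zero_of_antiperiodic hc (m := m) fun x => by
    have := h.multiplier_top (x + Real.pi * I) (by simpa using hpi) (by simpa using h.pos)
    rw [Complex.ofReal_add, add_right_comm, this, neg_re]
  exact ⟨q, Complex.ext hq (h.real_top q)⟩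

/-- The solution with singularity at `πi/2` yields a function without zeros in the closed strip. -/
theorem SolvesBVP.exists_zeroFree (hU : IsCylindricalDomain U) (hm : 0 < m)
    (hφ : IsUniformization m U φ) (hF : SolvesBVP U 1 (φ midPoint) F) :
    ∃ (a δ : ℝ) (κ κ' : ℂ → ℂ), AnalyticPair m δ (cexp (-a : ℝ)) (deriv φ) κ κ' ∧
      (∀ x : ℝ, (κ x).im = 0) ∧ (∀ x : ℝ, (κ' (x + Real.pi * I)).im = 0) ∧
      (∀ w : ℂ, 0 ≤ w.im → w.im < Real.pi → κ w ≠ 0) ∧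
      ∀ w : ℂ, 0 < w.im → w.im ≤ Real.pi → κ' w ≠ 0 := by
  have hpi := Real.pi_pos
  have hw₀ := midPoint_mem_strip
  obtain ⟨δ, b, t, h⟩ := hF.exists_extension hU hm hφ hw₀
  obtain ⟨p, hp⟩ := h.exists_zero_bottom hw₀
  obtain ⟨q, hq⟩ := h.exists_zero_top hw₀
  have hδ := h.pos
  have hδpi : δ ≤ Real.pi / 2 := by
    have := h.le_im
    rwa [midPoint_im] at this
  -- The zero of `E` at `πi/2` cancels the pole of the solution, and its poles cancel the boundary
  -- zeros `p` and `q + πi`; the two negative multipliers combine to `e^{-a} > 0`.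
  set E := thetaQuot m p q with hE
  set a : ℝ := m / 2 - p - q with ha
  have hEm : ∀ w, E (w + m) = -cexp (-a : ℝ) * E w := by
    intro w
    rw [hE, thetaQuot_add_period hm]
    congr 3
    rw [ha]
    push_cast
    ring
  have hC := Complex.exp_ne_zero ((-a : ℝ) : ℂ)
  set Sb : Set ℂ := {w | -δ < w.im ∧ w.im < Real.pi} with hSb
  set St : Set ℂ := {w | 0 < w.im ∧ w.im < Real.pi + δ} with hSt
  have hSbo : IsOpen Sb :=
    (isOpen_lt continuous_const continuous_im).inter (isOpen_lt continuous_im continuous_const)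
  have hSto : IsOpen St :=
    (isOpen_lt continuous_const continuous_im).inter (isOpen_lt continuous_im continuous_const)
  have hbm : ∀ w ∈ Sb, b (w + m) * E (w + m) = cexp (-a : ℝ) * (b w * E w) := by
    intro w hw
    rw [h.multiplier_bottom w hw.1 hw.2, hEm]
    ring
  have htm : ∀ w ∈ St, t (w + m) * E (w + m) = cexp (-a : ℝ) * (t w * E w) := by
    intro w hw
    rw [h.multiplier_top w hw.1 hw.2, hEm]
    ring
  have hθp : ∀ w : ℂ, -δ < w.im → w.im < Real.pi + δ → (∀ k : ℤ, w ≠ p + k * m) →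
      theta m (w - p) ≠ 0 := by
    intro w h0 h1 hne
    refine theta_ne_zero hm (notMem_of_ne hm (fun k hk => hne k ?_) ?_ ?_)
    · linear_combination hk
    · simp; linarith
    · simp; linarith
  have hθq : ∀ w : ℂ, -δ < w.im → w.im < Real.pi + δ → (∀ k : ℤ, w ≠ (q + Real.pi * I) + k * m) →
      theta m (w - (q + Real.pi * I)) ≠ 0 := by
    intro w h0 h1 hne
    refine theta_ne_zero hm (notMem_of_ne hm (fun k hk => hne k ?_) ?_ ?_)
    · linear_combination hk
    · simp; linarith
    · simp; linarith
  have ne_of_im : ∀ {w z : ℂ}, w.im ≠ z.im → ∀ k : ℤ, w ≠ z + k * m := by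
    intro w z hne k hk
    apply hne
    rw [hk]
    simp
  have exp_unit : ∀ w, UnitAt (fun w : ℂ => cexp (w / 2)) w := fun w =>
    unitAt_of_analyticAt (by fun_prop) (Complex.exp_ne_zero _)
  -- The residue of `b` at `πi/2` is nonzero, so the product does not vanish there. This excludes
  -- the zero function in the zero count.
  have hunit₀ : UnitAt (fun w => b w * E w) midPoint := by
    obtain ⟨g, hg, hge⟩ := h.singularity
    set A : ℂ := 1 / (Real.pi * I) * (conj 1 / deriv φ midPoint) with hA
    have hA0 : A ≠ 0 := by
      have hpi' : (Real.pi : ℂ) ≠ 0 := by exact_mod_cast hpi.ne'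
      refine mul_ne_zero (div_ne_zero one_ne_zero (mul_ne_zero hpi' I_ne_zero)) (div_ne_zero ?_ ?_)
      · simp
      · exact hφ.deriv_ne_zero hw₀
    have h1 : UnitAt (fun w => b w * (w - midPoint)) midPoint := by
      refine ⟨fun w => g w * (w - midPoint) + A, by fun_prop, by simpa using hA0, ?_⟩
      filter_upwards [hge, self_mem_nhdsWithin] with w hw hne
      have hne' := sub_ne_zero.mpr hne
      rw [← hw]
      field_simp
      ring
    have him : midPoint.im = Real.pi / 2 := midPoint_im
    have h2 := unitAt_of_analyticAt (analyticAt_theta_sub hm _ _) (hθp midPoint (by linarith)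
      (by linarith) (ne_of_im (by rw [him, ofReal_im]; linarith)))
    have h3 := unitAt_of_analyticAt (analyticAt_theta_sub hm _ _) (hθq midPoint (by linarith)
      (by linarith) (ne_of_im (by rw [him]; simp; linarith)))
    have h4 := unitAt_thetaPair_div hm hw₀.1 hw₀.2
    refine ((h1.mul h4).mul (((exp_unit midPoint).mul h2).mul h3).inv).congr ?_
    filter_upwards [self_mem_nhdsWithin] with w hne
    have hne' := sub_ne_zero.mpr hne
    rw [hE, thetaQuot]
    field_simp
  have hSbp : ∀ w : ℂ, w + m ∈ Sb ↔ w ∈ Sb := fun w => by simp [hSb]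
  have hStp : ∀ w : ℂ, w + m ∈ St ↔ w ∈ St := fun w => by simp [hSt]
  have hRp : RemovableAt (fun w => b w * E w) p := by
    have hbp : AnalyticAt ℂ b p := h.analytic_bottom p (by simpa using hδ) (by simpa using hpi)
      (ne_of_im (by rw [midPoint_im, ofReal_im]; linarith))
    have h1 : RemovableAt (fun w => b w / (w - p)) p :=
      removableAt_div_sub hbp hp (.of_forall fun w => rfl)
    have h2 := (unitAt_of_analyticAt (analyticAt_theta_sub hm _ _) (hθq p (by simpa using hδ)
      (by simp; linarith) (ne_of_im (by simp; linarith)))).inv.removableAt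
    refine (((h1.mul (unitAt_theta_sub_div hm (p : ℂ)).inv.removableAt).mul
      (analyticAt_thetaPair hm midPoint p).removableAt).mul
      ((exp_unit p).inv.removableAt.mul h2)).congr ?_
    filter_upwards [self_mem_nhdsWithin] with w hne
    have hne' := sub_ne_zero.mpr hne
    rw [hE, thetaQuot]
    field_simp
  have hRq : RemovableAt (fun w => t w * E w) (q + Real.pi * I) := by
    have htq : AnalyticAt ℂ t (q + Real.pi * I) :=
      h.analytic_top _ (by simpa using hpi) (by simpa using hδ)
        (ne_of_im (by rw [midPoint_im]; simp; linarith))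
    have h1 : RemovableAt (fun w => t w / (w - (q + Real.pi * I))) (q + Real.pi * I) :=
      removableAt_div_sub htq hq (.of_forall fun w => rfl)
    have h2 := (unitAt_of_analyticAt (analyticAt_theta_sub hm _ _) (hθp (q + Real.pi * I)
      (by simp; linarith) (by simpa using hδ) (ne_of_im (by simp)))).inv.removableAt
    refine (((h1.mul (unitAt_theta_sub_div hm (q + Real.pi * I : ℂ)).inv.removableAt).mul
      (analyticAt_thetaPair hm midPoint _).removableAt).mul
      ((exp_unit _).inv.removableAt.mul h2)).congr ?_
    filter_upwards [self_mem_nhdsWithin] with w hne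
    have hne' := sub_ne_zero.mpr hne
    rw [hE, thetaQuot]
    field_simp
  have hRb : ∀ w ∈ Sb, RemovableAt (fun w => b w * E w) w := by
    intro w hw
    by_cases h1 : ∃ k : ℤ, w = midPoint + k * m
    · obtain ⟨k, rfl⟩ := h1
      exact (RemovableAt.add_int_mul hC hSbo hSbp hbm
        ⟨by rw [midPoint_im]; linarith, hw₀.2⟩ hunit₀.removableAt k).2
    by_cases h2 : ∃ k : ℤ, w = p + k * m
    · obtain ⟨k, rfl⟩ := h2
      exact (RemovableAt.add_int_mul hC hSbo hSbp hbm
        ⟨by simpa using hδ, by simpa using hpi⟩ hRp k).2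
    push Not at h1 h2
    refine ((h.analytic_bottom w hw.1 hw.2 h1).fun_mul (analyticAt_thetaQuot hm p q
      (hθp w hw.1 (by linarith [hw.2]) h2)
      (hθq w hw.1 (by linarith [hw.2]) (ne_of_im ?_)))).removableAt
    simpa using hw.2.ne
  have hrel : ∀ w ∈ strip, t w * E w = b w * E w * deriv φ w := by
    intro w hw
    rw [h.eq_top w hw, h.eq_bottom w hw]
    ring
  have hρ : ∀ w ∈ strip, AnalyticAt ℂ (deriv φ) w := fun w hw => (hφ.analyticAt hw).deriv
  have hRt : ∀ w ∈ St, RemovableAt (fun w => t w * E w) w := by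
    intro w hw
    by_cases h0 : w.im < Real.pi
    · have hws : w ∈ strip := ⟨hw.1, h0⟩
      refine ((hRb w ⟨by linarith [hw.1], h0⟩).mul (hρ w hws).removableAt).congr ?_
      filter_upwards [mem_nhdsWithin_of_mem_nhds (isOpen_strip.mem_nhds hws)] with w' hw'
      exact (hrel w' hw').symm
    by_cases h2 : ∃ k : ℤ, w = (q + Real.pi * I) + k * m
    · obtain ⟨k, rfl⟩ := h2
      exact (RemovableAt.add_int_mul hC hSto hStp htm
        ⟨by simpa using hpi, by simpa using hδ⟩ hRq k).2
    push Not at h0 h2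
    refine ((h.analytic_top w hw.1 hw.2 (ne_of_im ?_)).fun_mul (analyticAt_thetaQuot hm p q
      (hθp w (by linarith [hw.1]) hw.2 (ne_of_im ?_))
      (hθq w (by linarith [hw.1]) hw.2 h2))).removableAt
    · rw [midPoint_im]
      linarith
    · rw [ofReal_im]
      linarith
  have hpair : AnalyticPair m δ (cexp (-a : ℝ)) (deriv φ) (regularize fun w => b w * E w)
      (regularize fun w => t w * E w) := by
    refine ⟨hδ, fun w h0 h1 => (hRb w ⟨h0, h1⟩).analyticAt_regularize,
      fun w h0 h1 => (hRt w ⟨h0, h1⟩).analyticAt_regularize, fun w h0 h1 => ?_, fun w h0 h1 => ?_,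
      fun w hw => ?_⟩
    · have hw : w ∈ Sb := ⟨h0, h1⟩
      refine regularize_add_eq (e := fun _ => cexp (-a : ℝ)) (hRb w hw) (hRb _ ((hSbp w).mpr hw))
        continuousAt_const ?_
      filter_upwards [hSbo.mem_nhds hw] with w' hw' using hbm w' hw'
    · have hw : w ∈ St := ⟨h0, h1⟩
      refine regularize_add_eq (e := fun _ => cexp (-a : ℝ)) (hRt w hw) (hRt _ ((hStp w).mpr hw))
        continuousAt_const ?_
      filter_upwards [hSto.mem_nhds hw] with w' hw' using htm w' hw'
    · have hwb : w ∈ Sb := ⟨by linarith [hw.1], hw.2⟩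
      refine (regularize_eventuallyEq ((hRb w hwb).analyticAt_regularize.fun_mul (hρ w hw))
        ?_).self_of_nhds
      filter_upwards [(hRb w hwb).regularize_eventuallyEq_nhdsNE,
        mem_nhdsWithin_of_mem_nhds (isOpen_strip.mem_nhds hw)] with w' h1 h2
      rw [hrel w' h2, h1]
  have hbr : ∀ x : ℝ, (regularize (fun w => b w * E w) x).im = 0 := by
    intro x
    have := regularize_im_eq_zero (f := fun w => b w * E w) (x := x) (c := 0)
      (by simpa using hRb x ⟨by simpa using hδ, by simpa using hpi⟩) fun x' => by
        have h1 := h.real_bottom x'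
        have h2 := congrArg Complex.re (conj_thetaQuot_bottom hm p q x')
        rw [conj_re, neg_re] at h2
        have h3 : (E x').re = 0 := by rw [hE]; linarith
        simp [h1, h3]
    simpa using this
  have htr : ∀ x : ℝ, (regularize (fun w => t w * E w) (x + Real.pi * I)).im = 0 := by
    intro x
    refine regularize_im_eq_zero (hRt _ ⟨by simpa using hpi, by simpa using hδ⟩) fun x' => ?_
    have h1 := h.real_top x'
    have h3 : (E (x' + Real.pi * I)).im = 0 :=
      Complex.conj_eq_iff_im.mp (conj_thetaQuot_top hm p q x')
    simp [mul_im, h1, h3]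
  obtain ⟨l, hl, hle, hlm⟩ := hφ.exists_log_deriv hU hm
  obtain ⟨h1, h2⟩ := hpair.ne_zero hm hl hle hlm hρ hbr htr
    ⟨midPoint, hw₀, hunit₀.regularize_ne_zero⟩
  exact ⟨a, δ, _, _, hpair, hbr, htr, h1, h2⟩

end BVP

/-! ### Explicit solution of the boundary value problem -/

/-- The solution of the boundary value problem in the straight strip, with multiplier determined
by `s`. -/
def bvpKernel (m : ℝ) (s k η w₁ w : ℂ) : ℂ :=
  1 / (Real.pi * I) *
    (conj η * k * kron m s (w - w₁) + η * conj k * kron m s (w - conj w₁))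

section Kernel

variable {m x : ℝ}

lemma bvpKernel_add_period (hm : 0 < m) (s k η w₁ w : ℂ) :
    bvpKernel m s k η w₁ (w + m) = cexp (m / 2 + s) * bvpKernel m s k η w₁ w := by
  rw [bvpKernel, bvpKernel, show w + m - w₁ = w - w₁ + m by ring,
    show w + m - conj w₁ = w - conj w₁ + m by ring, kron_add_period hm, kron_add_period hm]
  ring

/-- On the real line the two terms are conjugate, so their sum is real; the prefactor is imaginary.
-/
lemma bvpKernel_re_bottom (hm : 0 < m) (k η w₁ : ℂ) (y : ℝ) :
    (bvpKernel m (x + Real.pi * I) k η w₁ y).re = 0 := by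
  have h1 : (y - conj w₁ : ℂ) = conj (y - w₁) := by simp
  rw [bvpKernel, h1, kron_conj hm]
  set K := kron m (x + Real.pi * I) (y - w₁)
  have h2 : conj η * k * K + η * conj k * conj K = ((2 * (conj η * k * K).re : ℝ) : ℂ) := by
    rw [← Complex.add_conj]
    simp
  rw [h2, show (1 / (Real.pi * I) : ℂ) = ((1 / Real.pi : ℝ) : ℂ) * -I by
    have : (Real.pi : ℂ) ≠ 0 := by exact_mod_cast Real.pi_ne_zero
    push_cast
    field_simp
    rw [I_sq]; ring]
  rw [mul_assoc, re_ofReal_mul]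
  simp

/-- At height `π` the reflected argument differs from the conjugate one by `2πi`, where `kron`
changes sign; the sum of the two terms is then imaginary. -/
lemma bvpKernel_im_top (hm : 0 < m) (k η w₁ : ℂ) (y : ℝ) :
    (bvpKernel m (x + Real.pi * I) k η w₁ (y + Real.pi * I)).im = 0 := by
  have h1 : (y + Real.pi * I - conj w₁ : ℂ) - 2 * Real.pi * I = conj (y + Real.pi * I - w₁) := by
    simp only [map_sub, map_add, map_mul, conj_ofReal, conj_I]
    ring
  have h3 := kron_sub_two_pi (m := m) (x + Real.pi * I) (y + Real.pi * I - conj w₁)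
  rw [h1, kron_conj hm, eq_neg_iff_add_eq_zero, add_comm, ← eq_neg_iff_add_eq_zero] at h3
  rw [bvpKernel, h3]
  set K := kron m (x + Real.pi * I) (y + Real.pi * I - w₁)
  have h2 : conj η * k * K + η * conj k * -conj K = ((2 * (conj η * k * K).im : ℝ) : ℂ) * I := by
    rw [← Complex.sub_conj]
    simp [sub_eq_add_neg]
  rw [h2, show (1 / (Real.pi * I) : ℂ) = ((1 / Real.pi : ℝ) : ℂ) * -I by
    have : (Real.pi : ℂ) ≠ 0 := by exact_mod_cast Real.pi_ne_zero
    push_cast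
    field_simp
    rw [I_sq]; ring]
  rw [mul_assoc, im_ofReal_mul]
  simp

variable (hm : 0 < m)
include hm

lemma notMem_of_real_add_pi (x : ℝ) : (x + Real.pi * I : ℂ) ∉ (periods m hm).lattice := by
  have := Real.pi_pos
  refine notMem_of_im hm ?_ ?_ ?_ <;> simp <;> linarith

lemma notMem_sub_conj {w₁ w : ℂ} (hw₁ : w₁ ∈ strip) (h0 : 0 ≤ w.im) (h1 : w.im ≤ Real.pi) :
    w - conj w₁ ∉ (periods m hm).lattice := by
  have h2 := hw₁.1
  have h3 := hw₁.2
  have := Real.pi_pos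
  refine notMem_of_im hm ?_ ?_ ?_ <;> simp <;> linarith

lemma notMem_sub {w₁ w : ℂ} (hw₁ : w₁ ∈ strip) (h0 : 0 ≤ w.im) (h1 : w.im ≤ Real.pi)
    (hne : ∀ k : ℤ, w ≠ w₁ + k * m) : w - w₁ ∉ (periods m hm).lattice := by
  have h2 := hw₁.1
  have h3 := hw₁.2
  have := Real.pi_pos
  refine notMem_of_ne hm (fun k hk => hne k (by linear_combination hk)) ?_ ?_ <;> simp <;> linarith

lemma analyticAt_kron_sub {s z w : ℂ} (hs : s ∉ (periods m hm).lattice)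
    (h : w - z ∉ (periods m hm).lattice) : AnalyticAt ℂ (fun w => kron m s (w - z)) w :=
  (analyticAt_kron hm s (theta_ne_zero hm hs) (theta_ne_zero hm h)).fun_comp
    (f := fun w => w - z) (by fun_prop)

lemma analyticAt_bvpKernel {s k η w₁ w : ℂ} (hs : s ∉ (periods m hm).lattice) (hw₁ : w₁ ∈ strip)
    (h0 : 0 ≤ w.im) (h1 : w.im ≤ Real.pi) (hne : ∀ k : ℤ, w ≠ w₁ + k * m) :
    AnalyticAt ℂ (bvpKernel m s k η w₁) w :=
  analyticAt_const.fun_mul ((analyticAt_const.fun_mul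
    (analyticAt_kron_sub hm hs (notMem_sub hm hw₁ h0 h1 hne))).fun_add
    (analyticAt_const.fun_mul (analyticAt_kron_sub hm hs (notMem_sub_conj hm hw₁ h0 h1))))

/-- The choice of `k` matches the residues; the reflected term of the kernel is regular at `w₁`. -/
lemma removableAt_bvpKernel {s k η w₁ : ℂ} (hs : s ∉ (periods m hm).lattice) (hw₁ : w₁ ∈ strip)
    {h b : ℂ → ℂ} {d : ℂ} (hh : AnalyticAt ℂ h w₁) (hd : d ≠ 0) (hk : k = h w₁ / d)
    (hb : RemovableAt (fun w => b w - 1 / (Real.pi * I) * (conj η / d) / (w - w₁)) w₁) :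
    RemovableAt (fun w => h w * b w - bvpKernel m s k η w₁ w) w₁ := by
  obtain ⟨A, hA, hA1, hAk⟩ := exists_kron_eq_div hm s (theta_ne_zero hm hs)
  have hAc : AnalyticAt ℂ (fun w => A (w - w₁)) w₁ := by
    refine AnalyticAt.fun_comp (f := fun w : ℂ => w - w₁) ?_ (by fun_prop)
    simpa using hA
  have h1 : RemovableAt (fun w => (1 / (Real.pi * I) * conj η * (h w / d - k * A (w - w₁))) /
      (w - w₁)) w₁ := by
    refine removableAt_div_sub (f := fun w => 1 / (Real.pi * I) * conj η *
      (h w / d - k * A (w - w₁))) ?_ ?_ (.of_forall fun w => rfl)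
    · exact analyticAt_const.fun_mul ((hh.fun_div analyticAt_const hd).fun_sub
        (analyticAt_const.fun_mul hAc))
    · simp [hA1, hk]
  have h2 : AnalyticAt ℂ (fun w => -(1 / (Real.pi * I) * (η * conj k * kron m s (w - conj w₁))))
      w₁ :=
    (analyticAt_const.fun_mul (analyticAt_const.fun_mul (analyticAt_kron_sub hm hs
      (notMem_sub_conj hm hw₁ hw₁.1.le hw₁.2.le)))).fun_neg
  refine (((hh.removableAt.mul hb).add h1).add h2.removableAt).congr ?_
  filter_upwards [self_mem_nhdsWithin] with w hne
  have hne' := sub_ne_zero.mpr hne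
  rw [bvpKernel, hAk _ hne']
  field_simp
  ring

end Kernel

section BVP

variable {m δ δ' a : ℝ} {φ F b t κ κ' : ℂ → ℂ} {η w₁ : ℂ}

/-- A version of `eq_zero_of_mixed_boundary` for a function given by different expressions near the
two sides of the strip, with removable singularities. -/
lemma eq_zero_of_mixed_boundary_of_removableAt (hm : 0 < m) (hw₁ : w₁ ∈ strip) {Db Dt : ℂ → ℂ}
    (hDbm : ∀ w : ℂ, 0 ≤ w.im → w.im < Real.pi → Db (w + m) = -cexp a * Db w)
    (hDtm : ∀ w : ℂ, 0 < w.im → w.im ≤ Real.pi → Dt (w + m) = -cexp a * Dt w)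
    (hDeq : ∀ w ∈ strip, Db w = Dt w)
    (hDba : ∀ w : ℂ, 0 ≤ w.im → w.im < Real.pi → (∀ k : ℤ, w ≠ w₁ + k * m) → AnalyticAt ℂ Db w)
    (hDta : ∀ w : ℂ, 0 < w.im → w.im ≤ Real.pi → (∀ k : ℤ, w ≠ w₁ + k * m) → AnalyticAt ℂ Dt w)
    (hR₁ : RemovableAt Db w₁) (hbot : ∀ x : ℝ, (Db x).re = 0)
    (htop : ∀ x : ℝ, (Dt (x + Real.pi * I)).im = 0) {w : ℂ} (hw : w ∈ strip)
    (hne : ∀ k : ℤ, w ≠ w₁ + k * m) : Db w = 0 := by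
  have hpi := Real.pi_pos
  have hSp : ∀ w : ℂ, w + m ∈ strip ↔ w ∈ strip := fun w => by simp [strip]
  have hRb : ∀ w : ℂ, 0 ≤ w.im → w.im < Real.pi → RemovableAt Db w := by
    intro w h0 h1
    by_cases hne : ∀ k : ℤ, w ≠ w₁ + k * m
    · exact (hDba w h0 h1 hne).removableAt
    · push Not at hne
      obtain ⟨k, rfl⟩ := hne
      exact (RemovableAt.add_int_mul (neg_ne_zero.mpr (Complex.exp_ne_zero (a : ℂ))) isOpen_strip hSp
        (fun w hw => hDbm w hw.1.le hw.2) hw₁ hR₁ k).2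
  have hDeq' : ∀ w ∈ strip, Db =ᶠ[𝓝 w] Dt := fun w hw => by
    filter_upwards [isOpen_strip.mem_nhds hw] with w' hw' using hDeq w' hw'
  have hreg : ∀ w ∈ strip, regularize Db w = regularize Dt w := by
    intro w hw
    have h1 := hRb w hw.1.le hw.2
    have h2 : RemovableAt Dt w := h1.congr ((hDeq' w hw).filter_mono nhdsWithin_le_nhds)
    exact tendsto_nhds_unique (h1.tendsto_regularize.congr'
      ((hDeq' w hw).filter_mono nhdsWithin_le_nhds)) h2.tendsto_regularize
  have ne_top : ∀ w : ℂ, w.im = Real.pi → ∀ k : ℤ, w ≠ w₁ + k * m := by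
    rintro w h1 k rfl
    simp at h1
    exact hw₁.2.ne h1
  have hRt : ∀ w : ℂ, 0 < w.im → w.im ≤ Real.pi → RemovableAt Dt w := by
    intro w h0 h1
    rcases h1.lt_or_eq with h1 | h1
    · exact (hRb w h0.le h1).congr ((hDeq' w ⟨h0, h1⟩).filter_mono nhdsWithin_le_nhds)
    · exact (hDta w h0 h1.le (ne_top w h1)).removableAt
  -- The two regularized expressions agree inside the strip and glue to one function continuous on
  -- the closed strip.
  set D : ℂ → ℂ := fun w => if w.im < Real.pi then regularize Db w else regularize Dt w with hD
  have hDb' : ∀ w : ℂ, w.im < Real.pi → D w = regularize Db w := fun w hw => if_pos hw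
  have hDt' : ∀ w : ℂ, 0 < w.im → w.im ≤ Real.pi → D w = regularize Dt w := by
    intro w h0 h1
    rcases h1.lt_or_eq with h1 | h1
    · rw [hDb' w h1, hreg w ⟨h0, h1⟩]
    · exact if_neg (by rw [h1]; exact lt_irrefl _)
  clear_value D
  have hDan : ∀ w : ℂ, 0 ≤ w.im → w.im < Real.pi → AnalyticAt ℂ D w := by
    intro w h0 h1
    refine (hRb w h0 h1).analyticAt_regularize.congr ?_
    filter_upwards [(isOpen_lt continuous_im continuous_const).mem_nhds h1] with w' hw'
    exact (hDb' w' hw').symm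
  have hD0 : D w = 0 := by
    refine eq_zero_of_mixed_boundary hm a ?_ (fun z h0 h1 => (hDan z h0.le h1).differentiableAt) ?_
      ?_ ?_ w hw.1.le hw.2.le
    · rintro z ⟨h0, h1⟩
      rcases h1.lt_or_eq with h1 | h1
      · exact (hDan z h0 h1).continuousAt.continuousWithinAt
      · have hz : 0 < z.im := by rw [h1]; exact hpi
        have hc := (hRt z hz h1.le).analyticAt_regularize.continuousAt
        refine hc.continuousWithinAt.congr_of_eventuallyEq ?_ (hDt' z hz h1.le)
        filter_upwards [self_mem_nhdsWithin, mem_nhdsWithin_of_mem_nhds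
          ((isOpen_lt continuous_const continuous_im).mem_nhds hz)] with z' h2 h3
        exact hDt' z' h3 h2.2
    · intro z h0 h1
      rcases h1.lt_or_eq with h1 | h1
      · rw [hDb' z h1, hDb' _ (by simpa using h1)]
        rcases h0.lt_or_eq with h0 | h0
        · refine regularize_add_eq (e := fun _ => -cexp a) (hRb z h0.le h1)
            (hRb _ (by simpa using h0.le) (by simpa using h1)) continuousAt_const ?_
          filter_upwards [isOpen_strip.mem_nhds (show z ∈ strip from ⟨h0, h1⟩)] with z' hz'
          exact hDbm z' hz'.1.le hz'.2
        · have ne_bot : ∀ w : ℂ, w.im = 0 → ∀ k : ℤ, w ≠ w₁ + k * m := by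
            rintro w h1 k rfl
            simp at h1
            exact hw₁.1.ne' h1
          have hz : z.im = 0 := h0.symm
          have hz' : (z + m).im = 0 := by simpa using hz
          rw [regularize_eq_of_analyticAt (hDba z hz.ge h1 (ne_bot z hz)),
            regularize_eq_of_analyticAt (hDba _ hz'.ge (by simpa using h1) (ne_bot _ hz')),
            hDbm z hz.ge h1]
      · have h0' : 0 < z.im := by rw [h1]; exact hpi
        have hz' : (z + m).im = Real.pi := by simpa using h1
        rw [hDt' z h0' h1.le, hDt' _ (by rw [hz']; exact hpi) hz'.le,
          regularize_eq_of_analyticAt (hDta z h0' h1.le (ne_top z h1)),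
          regularize_eq_of_analyticAt (hDta _ (by rw [hz']; exact hpi) hz'.le (ne_top _ hz')),
          hDtm z h0' h1.le]
    · intro x
      have h0 : (x : ℂ).im = 0 := ofReal_im x
      rw [hDb' _ (by rwa [h0]), regularize_eq_of_analyticAt (hDba x h0.ge (by rwa [h0]) fun k hk => by
        have := congrArg Complex.im hk
        simp at this
        exact hw₁.1.ne this)]
      exact hbot x
    · intro x
      have h0 : (x + Real.pi * I : ℂ).im = Real.pi := by simp
      rw [hDt' _ (by rwa [h0]) h0.le,
        regularize_eq_of_analyticAt (hDta _ (by rwa [h0]) h0.le (ne_top _ h0))]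
      exact htop x
  rwa [hDb' w hw.2, regularize_eq_of_analyticAt (hDba w hw.1.le hw.2 hne)] at hD0

/-- Inside the strip `b / κ = t / κ'`, as `φ'` cancels. This function is imaginary at the bottom,
real at the top and has multiplier `-e^a`; the kernel shares these properties and the residue at
`w₁`, so uniqueness applies to the difference. -/
theorem BVPExtension.eq_bvpKernel (hm : 0 < m) (hw₁ : w₁ ∈ strip)
    (hφ : ∀ w ∈ strip, deriv φ w ≠ 0) (h : BVPExtension m φ F η w₁ δ b t)
    (hκ : AnalyticPair m δ' (cexp (-a : ℝ)) (deriv φ) κ κ')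
    (hκr : ∀ x : ℝ, (κ x).im = 0) (hκr' : ∀ x : ℝ, (κ' (x + Real.pi * I)).im = 0)
    (hκ0 : ∀ w : ℂ, 0 ≤ w.im → w.im < Real.pi → κ w ≠ 0)
    (hκ0' : ∀ w : ℂ, 0 < w.im → w.im ≤ Real.pi → κ' w ≠ 0) {w : ℂ} (hw : w ∈ strip)
    (hne : ∀ k : ℤ, w ≠ w₁ + k * m) :
    F (φ w) = κ w * bvpKernel m ((a - m / 2 : ℝ) + Real.pi * I) ((κ w₁)⁻¹ / deriv φ w₁) η w₁ w := by
  have hpi := Real.pi_pos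
  -- With this parameter `e^{m/2+s} = -e^a`.
  set s : ℂ := (a - m / 2 : ℝ) + Real.pi * I with hs
  have hsn : s ∉ (periods m hm).lattice := notMem_of_real_add_pi hm _
  set k₁ : ℂ := (κ w₁)⁻¹ / deriv φ w₁ with hk₁
  set G := bvpKernel m s k₁ η w₁ with hG
  have hGm : ∀ w, G (w + m) = -cexp a * G w := by
    intro w
    rw [hG, bvpKernel_add_period hm, hs, show (m / 2 + ((a - m / 2 : ℝ) + Real.pi * I) : ℂ) =
      a + Real.pi * I by push_cast; ring, Complex.exp_add, Complex.exp_pi_mul_I, mul_neg_one]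
  set Db : ℂ → ℂ := fun w => (κ w)⁻¹ * b w - G w with hDb
  set Dt : ℂ → ℂ := fun w => (κ' w)⁻¹ * t w - G w with hDt
  have hDm : ∀ K B C : ℂ, (cexp (-a : ℝ) * K)⁻¹ * -B - -cexp a * C = -cexp a * (K⁻¹ * B - C) := by
    intro K B C
    rw [mul_inv, ofReal_neg, Complex.exp_neg, inv_inv]
    ring
  have hDbm : ∀ w : ℂ, 0 ≤ w.im → w.im < Real.pi → Db (w + m) = -cexp a * Db w := by
    intro w h0 h1
    simp only [hDb]
    rw [hGm, hκ.multiplier_bottom w (by linarith [hκ.pos]) h1,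
      h.multiplier_bottom w (by linarith [h.pos]) h1, hDm]
  have hDtm : ∀ w : ℂ, 0 < w.im → w.im ≤ Real.pi → Dt (w + m) = -cexp a * Dt w := by
    intro w h0 h1
    simp only [hDt]
    rw [hGm, hκ.multiplier_top w h0 (by linarith [hκ.pos]),
      h.multiplier_top w h0 (by linarith [h.pos]), hDm]
  have hDeq : ∀ w ∈ strip, Db w = Dt w := by
    intro w hw
    simp only [hDb, hDt]
    rw [hκ.rel w hw, h.eq_top w hw, h.eq_bottom w hw]
    have := hφ w hw
    field_simp
  have hDba : ∀ w : ℂ, 0 ≤ w.im → w.im < Real.pi → (∀ k : ℤ, w ≠ w₁ + k * m) →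
      AnalyticAt ℂ Db w := fun w h0 h1 hne =>
    (((hκ.analytic_bottom w (by linarith [hκ.pos]) h1).fun_inv (hκ0 w h0 h1)).fun_mul
      (h.analytic_bottom w (by linarith [h.pos]) h1 hne)).fun_sub
      (analyticAt_bvpKernel hm hsn hw₁ h0 h1.le hne)
  have hDta : ∀ w : ℂ, 0 < w.im → w.im ≤ Real.pi → (∀ k : ℤ, w ≠ w₁ + k * m) →
      AnalyticAt ℂ Dt w := fun w h0 h1 hne =>
    (((hκ.analytic_top w h0 (by linarith [hκ.pos])).fun_inv (hκ0' w h0 h1)).fun_mul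
      (h.analytic_top w h0 (by linarith [h.pos]) hne)).fun_sub
      (analyticAt_bvpKernel hm hsn hw₁ h0.le h1 hne)
  have hR₁ : RemovableAt Db w₁ := removableAt_bvpKernel hm hsn hw₁ (h := fun w => (κ w)⁻¹)
    ((hκ.analytic_bottom w₁ (by linarith [hκ.pos, hw₁.1]) hw₁.2).fun_inv (hκ0 w₁ hw₁.1.le hw₁.2))
    (hφ w₁ hw₁) hk₁ h.singularity
  have hbot : ∀ x : ℝ, (Db x).re = 0 := by
    intro x
    simp only [hDb, hG]
    rw [sub_re, bvpKernel_re_bottom hm, mul_re, inv_im, hκr, h.real_bottom]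
    simp
  have htop : ∀ x : ℝ, (Dt (x + Real.pi * I)).im = 0 := by
    intro x
    simp only [hDt, hG]
    rw [sub_im, bvpKernel_im_top hm, mul_im, inv_im, hκr', h.real_top]
    simp
  have hD0 := eq_zero_of_mixed_boundary_of_removableAt hm hw₁ hDbm hDtm hDeq hDba hDta hR₁ hbot htop
    hw hne
  simp only [hDb] at hD0
  rw [← h.eq_bottom w hw, ← sub_eq_zero.mp hD0, mul_inv_cancel_left₀ (hκ0 w hw.1.le hw.2)]

end BVP

/-! ### The kernels and the forms in the straight strip -/

lemma twist_mul (s : Bool) (z w : ℂ) : twist s (z * w) = twist s z * twist s w := by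
  cases s <;> simp [twist]

lemma conj_twist_not (s : Bool) (z : ℂ) : conj (twist (!s) z) = twist s z := by
  cases s <;> simp [twist]

lemma sum_sgn_mul_twist (v : ℂ) : ∑ s : Bool, sgn s * twist s v = 2 * I * v.im := by
  have := Complex.sub_conj v
  simp only [Fintype.sum_bool, sgn, twist]
  simp only [if_true, Bool.false_eq_true, if_false]
  push_cast at this
  linear_combination this

/-- The kernels `f^[s₁, s₂]` of the domain, expressed in the coordinates of the strip. -/
def IsStripKernel (m : ℝ) (s : ℂ) (φ κ : ℂ → ℂ) (f : ℂ → ℂ → ℂ → ℂ) : Prop :=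
  ∀ (s₁ s₂ : Bool) (w₁ w₂ : ℂ), w₁ ∈ strip → w₂ ∈ strip → (∀ k : ℤ, w₂ ≠ w₁ + k * m) →
    fpm f s₁ s₂ (φ w₁) (φ w₂) = sgn s₂ * (2 / (Real.pi * I)) * twist s₂ (κ w₂) *
      twist s₁ ((κ w₁)⁻¹ / deriv φ w₁) * kron m s (twist s₂ w₂ - twist s₁ w₁)

/-- One factor `κ`, from the solution at `πi/2`, serves all `η` and `z₁`. The combinations `f^[1] ±
i f^[i]` keep exactly one of the two terms of `bvpKernel`, and for the conjugated kernels the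
conjugation passes to the argument of `kron`, as `s ∈ ℝ + πi`. -/
lemma exists_isStripKernel {m : ℝ} (hm : 0 < m) {U : Set ℂ} {φ : ℂ → ℂ} {f : ℂ → ℂ → ℂ → ℂ}
    (hU : IsCylindricalDomain U) (hφ : IsUniformization m U φ)
    (hf : ∀ η : ℂ, ∀ z₁ ∈ U, SolvesBVP U η z₁ (f η z₁)) :
    ∃ (x : ℝ) (κ : ℂ → ℂ), (∀ w ∈ strip, κ w ≠ 0) ∧
      IsStripKernel m (x + Real.pi * I) φ κ f := by
  obtain ⟨a, δ, κ, κ', hκ, hκr, hκr', hκ0, hκ0'⟩ :=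
    (hf 1 _ (hφ.bijective.mapsTo midPoint_mem_strip)).exists_zeroFree hU hm hφ
  have key : ∀ η, ∀ w₁ ∈ strip, ∀ w ∈ strip, (∀ k : ℤ, w ≠ w₁ + k * m) → f η (φ w₁) (φ w) =
      κ w * bvpKernel m ((a - m / 2 : ℝ) + Real.pi * I) ((κ w₁)⁻¹ / deriv φ w₁) η w₁ w := by
    intro η w₁ hw₁ w hw hne
    obtain ⟨δ', b, t, h⟩ := (hf η _ (hφ.bijective.mapsTo hw₁)).exists_extension hU hm hφ hw₁
    exact h.eq_bvpKernel hm hw₁ (fun w hw => hφ.deriv_ne_zero hw) hκ hκr hκr' hκ0 hκ0' hw hne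
  refine ⟨a - m / 2, κ, fun w hw => hκ0 w hw.1.le hw.2, ?_⟩
  intro s₁ s₂ w₁ w₂ hw₁ hw₂ hne
  have h1 := key 1 w₁ hw₁ w₂ hw₂ hne
  have h2 := key I w₁ hw₁ w₂ hw₂ hne
  set k := (κ w₁)⁻¹ / deriv φ w₁ with hk
  have hplus : ∀ s₁ : Bool, f 1 (φ w₁) (φ w₂) + sgn s₁ * I * f I (φ w₁) (φ w₂) =
      2 / (Real.pi * I) * κ w₂ * twist s₁ k *
        kron m ((a - m / 2 : ℝ) + Real.pi * I) (w₂ - twist s₁ w₁) := by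
    intro s₁
    rw [h1, h2, bvpKernel, bvpKernel, map_one, conj_I]
    cases s₁
    · simp only [sgn, twist, Bool.false_eq_true, if_false]
      linear_combination (-(κ w₂ * (1 / (Real.pi * I)) * (-k * kron m ((a - m / 2 : ℝ) + Real.pi * I)
        (w₂ - w₁) + conj k * kron m ((a - m / 2 : ℝ) + Real.pi * I) (w₂ - conj w₁)))) * I_sq
    · simp only [sgn, twist, if_true]
      linear_combination ((κ w₂ * (1 / (Real.pi * I)) * (-k * kron m ((a - m / 2 : ℝ) + Real.pi * I)
        (w₂ - w₁) + conj k * kron m ((a - m / 2 : ℝ) + Real.pi * I) (w₂ - conj w₁)))) * I_sq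
  cases s₂
  · simp only [fpm]
    rw [hplus, map_mul, map_mul, map_mul, conj_twist_not, ← kron_conj hm, map_sub, conj_twist_not]
    simp only [sgn, twist, Bool.false_eq_true, if_false, map_div₀, map_mul, conj_ofReal, conj_I,
      map_ofNat]
    push_cast
    ring
  · simp only [fpm]
    rw [hplus]
    simp only [sgn, twist, if_true]
    push_cast
    ring

section Forms

variable {m : ℝ} {s : ℂ} {φ κ : ℂ → ℂ} {f : ℂ → ℂ → ℂ → ℂ}

/-- The imaginary part lies in `[-2π, 2π]`, and any lattice value forces `w₁` and `w₂` to the same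
height; then real parts decide. -/
lemma twist_sub_notMem (hm : 0 < m) (s₁ s₂ : Bool) {w₁ w₂ : ℂ} (h₁ : 0 ≤ w₁.im ∧ w₁.im ≤ Real.pi)
    (h₂ : 0 ≤ w₂.im ∧ w₂.im ≤ Real.pi) (hne : ∀ k : ℤ, w₂ ≠ w₁ + k * m) :
    twist s₂ w₂ - twist s₁ w₁ ∉ (periods m hm).lattice := by
  have hpi := Real.pi_pos
  have aux : ∀ j : ℤ, w₂.im = w₁.im → w₂.re - w₁.re ≠ j * m := by
    intro j h h'
    refine hne j (Complex.ext ?_ ?_)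
    · simp
      linarith
    · simpa using h
  rw [mem_periods_lattice]
  rintro ⟨j, k, h⟩
  have hre := congrArg Complex.re h
  have him := congrArg Complex.im h
  have hb : (-1 : ℤ) ≤ k ∧ k ≤ 1 := by
    have h3 : (twist s₂ w₂ - twist s₁ w₁).im ≤ 2 * Real.pi ∧
        -(2 * Real.pi) ≤ (twist s₂ w₂ - twist s₁ w₁).im := by
      cases s₁ <;> cases s₂ <;> simp [twist] <;> constructor <;> linarith
    rw [him] at h3
    simp at h3
    constructor
    · by_contra! h4
      have : (k : ℝ) ≤ -2 := by exact_mod_cast (by omega : k ≤ -2)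
      nlinarith
    · by_contra! h4
      have : (2 : ℝ) ≤ k := by exact_mod_cast (by omega : 2 ≤ k)
      nlinarith
  have hre' : w₂.re - w₁.re = j * m := by
    cases s₁ <;> cases s₂ <;> simpa [twist] using hre
  refine aux j ?_ hre'
  have hk : k = -1 ∨ k = 0 ∨ k = 1 := by omega
  rcases hk with rfl | rfl | rfl <;> cases s₁ <;> cases s₂ <;> simp [twist] at him <;> linarith

/-- A permutation product uses each index once as row and once as column, so its one-point factors
meet here with the differential and cancel. -/
lemma twist_cancel {w v : ℂ} (hκ : κ w ≠ 0) (hφ : deriv φ w ≠ 0) (σ : Bool) :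
    twist σ (κ w) * twist σ ((κ w)⁻¹ / deriv φ w) * twist σ (deriv φ w * v) = twist σ v := by
  rw [← twist_mul, ← twist_mul]
  congr 1
  field_simp

/-- The determinant reduces to `kron_mul_kron_neg`. Adding and subtracting `c` separates a term that
factorizes over the points, where `∑ sgn s * twist s v = 2i Im v`, from the second derivatives of
the Green's function. -/
lemma formA_two (hm : 0 < m) (hs : s ∉ (periods m hm).lattice) (hκ : ∀ w ∈ strip, κ w ≠ 0)
    (hφ : ∀ w ∈ strip, deriv φ w ≠ 0) (hf : IsStripKernel m s φ κ f) (c : ℂ) {w v : Fin 2 → ℂ}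
    (hw : ∀ k, w k ∈ strip) (hne : ∀ j k, j ≠ k → ∀ l : ℤ, w k ≠ w j + l * m) :
    formA f 2 (fun k => φ (w k)) (fun k => deriv φ (w k) * v k) =
      -((periods m hm).weierstrassP s + c) / Real.pi ^ 2 * ∏ k, ((v k).im : ℂ) -
      1 / (4 * Real.pi ^ 2) * ∑ s₁ : Bool, ∑ s₂ : Bool, sgn s₁ * sgn s₂ *
        ((periods m hm).weierstrassP (twist s₂ (w 1) - twist s₁ (w 0)) + c) *
          (twist s₁ (v 0) * twist s₂ (v 1)) := by
  have hpi : (Real.pi : ℂ) ≠ 0 := by exact_mod_cast Real.pi_ne_zero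
  have hsum : ∀ F : (Fin 2 → Bool) → ℂ, ∑ σ, F σ = ∑ s₁ : Bool, ∑ s₂ : Bool, F ![s₁, s₂] := by
    intro F
    rw [← (finTwoArrowEquiv Bool).symm.sum_comp, Fintype.sum_prod_type]
    rfl
  have hterm : ∀ s₁ s₂ : Bool,
      (Matrix.of fun j k : Fin 2 => if j = k then 0 else
        fpm f (![s₁, s₂] j) (![s₁, s₂] k) (φ (w j)) (φ (w k))).det *
        ∏ k, twist (![s₁, s₂] k) (deriv φ (w k) * v k) =
      4 / Real.pi ^ 2 * (((periods m hm).weierstrassP s + c) *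
        ((sgn s₁ * twist s₁ (v 0)) * (sgn s₂ * twist s₂ (v 1))) -
        sgn s₁ * sgn s₂ * ((periods m hm).weierstrassP (twist s₂ (w 1) - twist s₁ (w 0)) + c) *
          (twist s₁ (v 0) * twist s₂ (v 1))) := by
    intro s₁ s₂
    have h0 := twist_cancel (v := v 0) (hκ _ (hw 0)) (hφ _ (hw 0)) s₁
    have h1 := twist_cancel (v := v 1) (hκ _ (hw 1)) (hφ _ (hw 1)) s₂
    have hk := kron_mul_kron_neg hm hs (twist_sub_notMem hm s₁ s₂ ⟨(hw 0).1.le, (hw 0).2.le⟩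
      ⟨(hw 1).1.le, (hw 1).2.le⟩ (hne 0 1 (by simp)))
    rw [neg_sub] at hk
    rw [Matrix.det_fin_two]
    simp only [Matrix.of_apply, Fin.prod_univ_two, if_true, zero_ne_one, one_ne_zero, if_false,
      Matrix.cons_val_zero, Matrix.cons_val_one]
    rw [hf s₁ s₂ _ _ (hw 0) (hw 1) (hne 0 1 (by simp)),
      hf s₂ s₁ _ _ (hw 1) (hw 0) (hne 1 0 (by simp)), ← h0, ← h1]
    have hI : (2 / (Real.pi * I) : ℂ) * (2 / (Real.pi * I)) = -(4 / Real.pi ^ 2) := by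
      field_simp
      rw [I_sq]
      norm_num
    set Φ₁ := kron m s (twist s₂ (w 1) - twist s₁ (w 0))
    set Φ₂ := kron m s (twist s₁ (w 0) - twist s₂ (w 1))
    set A := 2 / (Real.pi * I : ℂ)
    linear_combination (-(sgn s₁ * sgn s₂) * twist s₁ (κ (w 0)) * twist s₂ (κ (w 1)) *
      twist s₁ ((κ (w 0))⁻¹ / deriv φ (w 0)) * twist s₂ ((κ (w 1))⁻¹ / deriv φ (w 1)) *
      twist s₁ (deriv φ (w 0) * v 0) * twist s₂ (deriv φ (w 1) * v 1)) *
      (Φ₁ * Φ₂ * hI - (4 / Real.pi ^ 2) * hk)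
  rw [formA, hsum]
  simp only [hterm]
  simp only [← Finset.mul_sum, Finset.sum_sub_distrib]
  rw [← Finset.sum_mul, sum_sgn_mul_twist, sum_sgn_mul_twist, Fin.prod_univ_two]
  linear_combination (((periods m hm).weierstrassP s + c) / Real.pi ^ 2 * (v 0).im * (v 1).im) * I_sq

/-- With zero diagonal only the two 3-cycles contribute, and their sum is `kron_triple` for
consecutive differences. It does not depend on the points or on the signs, so the sum over signs
factorizes. -/
lemma formA_three (hm : 0 < m) (hs : s ∉ (periods m hm).lattice) (hκ : ∀ w ∈ strip, κ w ≠ 0)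
    (hφ : ∀ w ∈ strip, deriv φ w ≠ 0) (hf : IsStripKernel m s φ κ f) {w v : Fin 3 → ℂ}
    (hw : ∀ k, w k ∈ strip) (hne : ∀ j k, j ≠ k → ∀ l : ℤ, w k ≠ w j + l * m) :
    formA f 3 (fun k => φ (w k)) (fun k => deriv φ (w k) * v k) =
      -(periods m hm).derivWeierstrassP s / Real.pi ^ 3 * ∏ k, ((v k).im : ℂ) := by
  have hpi : (Real.pi : ℂ) ≠ 0 := by exact_mod_cast Real.pi_ne_zero
  have hterm : ∀ σ : Fin 3 → Bool,
      (Matrix.of fun j k : Fin 3 => if j = k then 0 else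
        fpm f (σ j) (σ k) (φ (w j)) (φ (w k))).det * ∏ k, twist (σ k) (deriv φ (w k) * v k) =
      8 * I / Real.pi ^ 3 * -(periods m hm).derivWeierstrassP s *
        ∏ k, (sgn (σ k) * twist (σ k) (v k)) := by
    intro σ
    have hc := fun k => twist_cancel (v := v k) (hκ _ (hw k)) (hφ _ (hw k)) (σ k)
    have hmem : ∀ j k, j ≠ k → twist (σ k) (w k) - twist (σ j) (w j) ∉ (periods m hm).lattice :=
      fun j k hjk => twist_sub_notMem hm _ _ ⟨(hw j).1.le, (hw j).2.le⟩ ⟨(hw k).1.le, (hw k).2.le⟩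
        (hne j k hjk)
    have hk := kron_triple hm hs (hmem 0 1 (by decide)) (hmem 1 2 (by decide))
      (by simpa using hmem 0 2 (by decide))
    have hK : ∀ j k, j ≠ k → fpm f (σ j) (σ k) (φ (w j)) (φ (w k)) = _ := fun j k hjk =>
      hf (σ j) (σ k) _ _ (hw j) (hw k) (hne j k hjk)
    rw [Matrix.det_fin_three]
    simp only [Matrix.of_apply, Fin.prod_univ_three, if_true]
    simp only [show (0 : Fin 3) ≠ 1 by decide, show (0 : Fin 3) ≠ 2 by decide,
      show (1 : Fin 3) ≠ 0 by decide, show (1 : Fin 3) ≠ 2 by decide,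
      show (2 : Fin 3) ≠ 0 by decide, show (2 : Fin 3) ≠ 1 by decide, if_false]
    rw [hK 0 1 (by decide), hK 1 2 (by decide), hK 2 0 (by decide), hK 0 2 (by decide),
      hK 2 1 (by decide), hK 1 0 (by decide), ← hc 0, ← hc 1, ← hc 2]
    have hI : (2 / (Real.pi * I) : ℂ) * (2 / (Real.pi * I)) * (2 / (Real.pi * I)) =
        8 * I / Real.pi ^ 3 := by
      field_simp
      linear_combination (-8 * (I ^ 2 - 1)) * I_sq
    rw [neg_sub, neg_sub, show twist (σ 0) (w 0) - twist (σ 1) (w 1) - (twist (σ 2) (w 2) -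
      twist (σ 1) (w 1)) = twist (σ 0) (w 0) - twist (σ 2) (w 2) by ring, show twist (σ 1) (w 1) -
      twist (σ 0) (w 0) + (twist (σ 2) (w 2) - twist (σ 1) (w 1)) = twist (σ 2) (w 2) -
      twist (σ 0) (w 0) by ring] at hk
    rw [← hk, ← hI]
    ring
  rw [formA]
  simp only [hterm]
  rw [← Finset.mul_sum]
  have hsum : ∑ σ : Fin 3 → Bool, ∏ k, (sgn (σ k) * twist (σ k) (v k)) =
      ∏ k, ∑ b : Bool, sgn b * twist b (v k) := by
    rw [Finset.prod_univ_sum, Fintype.piFinset_univ]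
  rw [hsum]
  simp only [sum_sgn_mul_twist, Finset.prod_mul_distrib, Finset.prod_const, Finset.card_univ,
    Fintype.card_fin]
  linear_combination (-(periods m hm).derivWeierstrassP s / Real.pi ^ 3 * (∏ k, ((v k).im : ℂ)) *
    (I ^ 2 - 1)) * I_sq

end Forms

/-! ### Integration along families of paths -/

lemma integral_Icc_prod {n : ℕ} (g : Fin n → ℝ → ℂ) :
    ∫ t in Icc (0 : Fin n → ℝ) 1, ∏ k, g k (t k) = ∏ k, ∫ t in Icc (0 : ℝ) 1, g k t := by
  rw [← pi_univ_Icc, volume_pi, Measure.restrict_pi_pi, integral_fintype_prod_eq_prod]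
  rfl

lemma integral_Icc_fin_two {H : (Fin 2 → ℝ) → ℂ} (hH : ContinuousOn H (Icc 0 1)) :
    ∫ t in Icc (0 : Fin 2 → ℝ) 1, H t =
      ∫ t in Icc (0 : ℝ) 1, ∫ u in Icc (0 : ℝ) 1, H ![t, u] := by
  have h1 := (volume_preserving_finTwoArrow ℝ).symm
  have hpre : (MeasurableEquiv.finTwoArrow (α := ℝ)).symm ⁻¹' Icc (0 : Fin 2 → ℝ) 1 =
      Icc (0 : ℝ) 1 ×ˢ Icc (0 : ℝ) 1 := by
    ext p
    simp [MeasurableEquiv.finTwoArrow, MeasurableEquiv.piFinTwo, Pi.le_def, Fin.forall_fin_two, Prod.le_def]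
  rw [← h1.setIntegral_preimage_emb (MeasurableEquiv.measurableEmbedding _), hpre,
    Measure.volume_eq_prod, setIntegral_prod]
  · rfl
  · rw [← Measure.volume_eq_prod, ← hpre]
    exact (h1.integrableOn_comp_preimage (MeasurableEquiv.measurableEmbedding _)).mpr
      (hH.integrableOn_compact isCompact_Icc)

/-- The form is evaluated only where all points are interior; path ends form a null set, and a
continuous extension to the closed cube gives absolute convergence. -/
lemma integrableOn_and_integral_of_eqOn {n : ℕ} {F K : (Fin n → ℝ) → ℂ}
    (hK : ContinuousOn K (Icc 0 1)) (h : ∀ t : Fin n → ℝ, (∀ k, t k ∈ Ioo (0 : ℝ) 1) → F t = K t) :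
    IntegrableOn F (Icc 0 1) ∧ ∫ t in Icc (0 : Fin n → ℝ) 1, F t = ∫ t in Icc 0 1, K t := by
  have hae : F =ᵐ[volume.restrict (Icc (0 : Fin n → ℝ) 1)] K := by
    have h1 : (univ.pi fun k : Fin n => Ioo ((0 : Fin n → ℝ) k) ((1 : Fin n → ℝ) k)) =ᵐ[volume]
      Icc (0 : Fin n → ℝ) 1 := Measure.univ_pi_Ioo_ae_eq_Icc
    rw [← Measure.restrict_congr_set h1]
    refine (ae_restrict_iff' (MeasurableSet.univ_pi fun k => measurableSet_Ioo)).mpr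
      (.of_forall fun t ht => h t fun k => ht k (mem_univ k))
  exact ⟨(hK.integrableOn_compact isCompact_Icc).congr hae.symm, integral_congr_ae hae⟩

section Paths

variable {m : ℝ} {n : ℕ} {γ : Fin n → ℝ → ℂ}

lemma IsPathFamily.continuousOn (h : IsPathFamily m n γ) (k : Fin n) :
    ContinuousOn (γ k) (Icc 0 1) := (h.smooth k).continuousOn

lemma IsPathFamily.continuousOn_deriv (h : IsPathFamily m n γ) (k : Fin n) :
    ContinuousOn (derivWithin (γ k) (Icc 0 1)) (Icc 0 1) :=
  (h.smooth k).continuousOn_derivWithin (uniqueDiffOn_Icc zero_lt_one) le_rfl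

lemma IsPathFamily.hasDerivAt (h : IsPathFamily m n γ) (k : Fin n) {t : ℝ} (ht : t ∈ Ioo (0 : ℝ) 1) :
    HasDerivAt (γ k) (derivWithin (γ k) (Icc 0 1) t) t :=
  (((h.smooth k).differentiableOn one_ne_zero t (Ioo_subset_Icc_self ht)).hasDerivWithinAt).hasDerivAt
    (Icc_mem_nhds ht.1 ht.2)

lemma IsPathFamily.im_mem (h : IsPathFamily m n γ) (k : Fin n) {t : ℝ} (ht : t ∈ Icc (0 : ℝ) 1) :
    0 ≤ (γ k t).im ∧ (γ k t).im ≤ Real.pi := by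
  have hpi := Real.pi_pos
  rcases ht.1.eq_or_lt with h0 | h0
  · rw [← h0, h.start]
    exact ⟨le_rfl, hpi.le⟩
  rcases ht.2.eq_or_lt with h1 | h1
  · rw [h1, h.finish]
    exact ⟨hpi.le, le_rfl⟩
  · have := h.inside k t ⟨h0, h1⟩
    exact ⟨this.1.le, this.2.le⟩

lemma IsPathFamily.integral_im (h : IsPathFamily m n γ) (k : Fin n) :
    ∫ t in Icc (0 : ℝ) 1, ((derivWithin (γ k) (Icc 0 1) t).im : ℂ) = Real.pi := by
  rw [integral_Icc_eq_integral_Ioc, ← intervalIntegral.integral_of_le zero_le_one,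
    intervalIntegral.integral_eq_sub_of_hasDerivAt_of_le (f := fun t => ((γ k t).im : ℂ)) zero_le_one]
  · simp [h.start, h.finish]
  · exact Complex.continuous_ofReal.comp_continuousOn
      (Complex.continuous_im.comp_continuousOn (h.continuousOn k))
  · intro t ht
    exact (Complex.imCLM.hasFDerivAt.comp_hasDerivAt t (h.hasDerivAt k ht)).ofReal_comp
  · refine ContinuousOn.intervalIntegrable ?_
    rw [uIcc_of_le zero_le_one]
    exact Complex.continuous_ofReal.comp_continuousOn
      (Complex.continuous_im.comp_continuousOn (h.continuousOn_deriv k))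

lemma continuous_twist (s : Bool) : Continuous (twist s) := by
  cases s
  · exact Complex.continuous_conj
  · exact continuous_id

lemma HasDerivAt.twist {g : ℝ → ℂ} {g' : ℂ} {t : ℝ} (h : HasDerivAt g g' t) (s : Bool) :
    HasDerivAt (fun t => twist s (g t)) (twist s g') t := by
  cases s
  · exact Complex.conjCLE.toContinuousLinearMap.hasFDerivAt.comp_hasDerivAt t h
  · exact h

variable (hm : 0 < m) {c : ℂ}
include hm

lemma IsPathFamily.integral_weierstrassP (h : IsPathFamily m n γ)
    (hc : ∀ u, u ∉ (periods m hm).lattice →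
      deriv (zetaFn m) u = -((periods m hm).weierstrassP u + c)) (k : Fin n) (s : Bool) {z : ℂ}
    (hz : ∀ t ∈ Icc (0 : ℝ) 1, twist s (γ k t) - z ∉ (periods m hm).lattice) :
    ContinuousOn (fun t => ((periods m hm).weierstrassP (twist s (γ k t) - z) + c) *
      twist s (derivWithin (γ k) (Icc 0 1) t)) (Icc 0 1) ∧
    ∫ t in Icc (0 : ℝ) 1, ((periods m hm).weierstrassP (twist s (γ k t) - z) + c) *
      twist s (derivWithin (γ k) (Icc 0 1) t) =
      zetaFn m (twist s (γ k 0) - z) - zetaFn m (twist s (γ k 1) - z) := by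
  have h1 : ContinuousOn (fun t => twist s (γ k t) - z) (Icc 0 1) :=
    ((continuous_twist s).comp_continuousOn (h.continuousOn k)).sub continuousOn_const
  have hcont : ContinuousOn (fun t => ((periods m hm).weierstrassP (twist s (γ k t) - z) + c) *
      twist s (derivWithin (γ k) (Icc 0 1) t)) (Icc 0 1) := by
    refine ContinuousOn.mul (ContinuousOn.add ?_ continuousOn_const)
      ((continuous_twist s).comp_continuousOn (h.continuousOn_deriv k))
    intro t ht
    exact ContinuousAt.comp_continuousWithinAt (f := fun t => twist s (γ k t) - z)
      (analyticAt_weierstrassP hm (hz t ht)).continuousAt (h1 t ht)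
  refine ⟨hcont, ?_⟩
  rw [integral_Icc_eq_integral_Ioc, ← intervalIntegral.integral_of_le zero_le_one,
    intervalIntegral.integral_eq_sub_of_hasDerivAt_of_le
      (f := fun t => -zetaFn m (twist s (γ k t) - z)) zero_le_one]
  · ring
  · intro t ht
    exact (ContinuousAt.comp_continuousWithinAt (f := fun t => twist s (γ k t) - z)
      (analyticAt_zetaFn hm (theta_ne_zero hm (hz t ht))).continuousAt (h1 t ht)).neg
  · intro t ht
    have hz' := hz t (Ioo_subset_Icc_self ht)
    have h2 := (analyticAt_zetaFn hm (theta_ne_zero hm hz')).differentiableAt.hasDerivAt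
    rw [hc _ hz'] at h2
    refine (HasDerivAt.comp t h2
      ((HasDerivAt.twist (h.hasDerivAt k ht) s).sub_const z)).neg.congr_deriv ?_
    ring
  · refine ContinuousOn.intervalIntegrable ?_
    rwa [uIcc_of_le zero_le_one]

lemma IsPathFamily.twist_sub_notMem (h : IsPathFamily m n γ) {j k : Fin n} (hjk : j ≠ k)
    (s₁ s₂ : Bool) {t u : ℝ} (ht : t ∈ Icc (0 : ℝ) 1) (hu : u ∈ Icc (0 : ℝ) 1) :
    twist s₂ (γ k u) - twist s₁ (γ j t) ∉ (periods m hm).lattice :=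
  DimerCylinder.twist_sub_notMem hm s₁ s₂ (h.im_mem j ht) (h.im_mem k hu)
    fun l => h.disjoint k j hjk.symm u hu t ht l

end Paths

section Two

variable {m : ℝ} {γ : Fin 2 → ℝ → ℂ} (hm : 0 < m) {c : ℂ}
include hm

lemma IsPathFamily.continuousOn_sum (h : IsPathFamily m 2 γ) (c : ℂ) :
    ContinuousOn (fun t : Fin 2 → ℝ => ∑ s₁ : Bool, ∑ s₂ : Bool, sgn s₁ * sgn s₂ *
      ((periods m hm).weierstrassP (twist s₂ (γ 1 (t 1)) - twist s₁ (γ 0 (t 0))) + c) *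
        (twist s₁ (derivWithin (γ 0) (Icc 0 1) (t 0)) *
          twist s₂ (derivWithin (γ 1) (Icc 0 1) (t 1)))) (Icc 0 1) := by
  have hmaps : ∀ k : Fin 2, MapsTo (fun t : Fin 2 → ℝ => t k) (Icc 0 1) (Icc 0 1) :=
    fun k t ht => ⟨ht.1 k, ht.2 k⟩
  have hev : ∀ k : Fin 2, ContinuousOn (fun t : Fin 2 → ℝ => t k) (Icc 0 1) :=
    fun k => (continuous_apply k).continuousOn
  refine continuousOn_finsetSum _ fun s₁ _ => continuousOn_finsetSum _ fun s₂ _ => ?_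
  refine ContinuousOn.mul (ContinuousOn.mul continuousOn_const
    (ContinuousOn.add ?_ continuousOn_const)) (ContinuousOn.mul
    ((continuous_twist s₁).comp_continuousOn ((h.continuousOn_deriv 0).comp (hev 0) (hmaps 0)))
    ((continuous_twist s₂).comp_continuousOn ((h.continuousOn_deriv 1).comp (hev 1) (hmaps 1))))
  intro t ht
  refine ContinuousAt.comp_continuousWithinAt
    (f := fun t : Fin 2 → ℝ => twist s₂ (γ 1 (t 1)) - twist s₁ (γ 0 (t 0)))
    (analyticAt_weierstrassP hm (h.twist_sub_notMem hm (by decide) s₁ s₂ (hmaps 0 ht)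
      (hmaps 1 ht))).continuousAt ?_
  exact (((continuous_twist s₂).comp_continuousOn ((h.continuousOn 1).comp (hev 1) (hmaps 1))).sub
    ((continuous_twist s₁).comp_continuousOn ((h.continuousOn 0).comp (hev 0) (hmaps 0)))) t ht

/-- The mixed second derivatives of the Green's function integrate to zero. -/
lemma IsPathFamily.integral_sum_eq_zero (h : IsPathFamily m 2 γ)
    (hc : ∀ u, u ∉ (periods m hm).lattice →
      deriv (zetaFn m) u = -((periods m hm).weierstrassP u + c)) :
    ∫ t in Icc (0 : Fin 2 → ℝ) 1, ∑ s₁ : Bool, ∑ s₂ : Bool, sgn s₁ * sgn s₂ *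
      ((periods m hm).weierstrassP (twist s₂ (γ 1 (t 1)) - twist s₁ (γ 0 (t 0))) + c) *
        (twist s₁ (derivWithin (γ 0) (Icc 0 1) (t 0)) *
          twist s₂ (derivWithin (γ 1) (Icc 0 1) (t 1))) = 0 := by
  rw [integral_Icc_fin_two (h.continuousOn_sum hm c)]
  refine setIntegral_eq_zero_of_forall_eq_zero fun t ht => ?_
  simp only [Matrix.cons_val_zero, Matrix.cons_val_one]
  have hJ := fun s₁ s₂ => h.integral_weierstrassP hm hc 1 s₂ (z := twist s₁ (γ 0 t))
    fun u hu => h.twist_sub_notMem hm (by decide) s₁ s₂ ht hu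
  have hI : ∀ s₁ s₂, IntegrableOn (fun u => sgn s₁ * sgn s₂ *
      ((periods m hm).weierstrassP (twist s₂ (γ 1 u) - twist s₁ (γ 0 t)) + c) *
        (twist s₁ (derivWithin (γ 0) (Icc 0 1) t) *
          twist s₂ (derivWithin (γ 1) (Icc 0 1) u))) (Icc 0 1) := by
    intro s₁ s₂
    refine ContinuousOn.integrableOn_compact isCompact_Icc ?_
    refine ((hJ s₁ s₂).1.const_smul (sgn s₁ * sgn s₂ *
      twist s₁ (derivWithin (γ 0) (Icc 0 1) t))).congr fun u _ => ?_
    rw [Pi.smul_apply, smul_eq_mul]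
    ring
  rw [integral_finsetSum _ fun s₁ _ => integrable_finsetSum _ fun s₂ _ => hI s₁ s₂]
  refine Finset.sum_eq_zero fun s₁ _ => ?_
  rw [integral_finsetSum _ fun s₂ _ => hI s₁ s₂]
  have hval : ∀ s₂, ∫ u in Icc (0 : ℝ) 1, sgn s₁ * sgn s₂ *
      ((periods m hm).weierstrassP (twist s₂ (γ 1 u) - twist s₁ (γ 0 t)) + c) *
        (twist s₁ (derivWithin (γ 0) (Icc 0 1) t) *
          twist s₂ (derivWithin (γ 1) (Icc 0 1) u)) =
      sgn s₁ * twist s₁ (derivWithin (γ 0) (Icc 0 1) t) * (sgn s₂ *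
        (zetaFn m (twist s₂ (γ 1 0) - twist s₁ (γ 0 t)) -
          zetaFn m (twist s₂ (γ 1 1) - twist s₁ (γ 0 t)))) := by
    intro s₂
    rw [← (hJ s₁ s₂).2, ← mul_assoc, ← integral_const_mul]
    congr 1
    ext u
    ring
  simp only [hval]
  rw [← Finset.mul_sum, Fintype.sum_bool]
  -- A bottom endpoint equals its conjugate and a top endpoint differs from it by `2πi`, a period of
  -- `ζ`. Hence the sum over `s₂` with signs cancels at both ends.
  have h0 : twist false (γ 1 0) = twist true (γ 1 0) := by
    simpa [twist] using Complex.conj_eq_iff_im.mpr (h.start 1)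
  have h1 : twist true (γ 1 1) - twist s₁ (γ 0 t) =
      twist false (γ 1 1) - twist s₁ (γ 0 t) + 2 * Real.pi * I := by
    have : γ 1 1 = conj (γ 1 1) + 2 * Real.pi * I := by
      apply Complex.ext
      · simp
      · simp [h.finish 1]
        ring
    simp only [twist, if_true, Bool.false_eq_true, if_false]
    linear_combination this
  rw [h0, h1, zetaFn_add_two_pi hm]
  simp [sgn]

end Two

/-! ### The top-boundary moments -/

section Moments

variable {m : ℝ} {s : ℂ} {φ κ : ℂ → ℂ} {f : ℂ → ℂ → ℂ → ℂ}

lemma IsPathFamily.continuousOn_prod_im {n : ℕ} {γ : Fin n → ℝ → ℂ} (h : IsPathFamily m n γ) :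
    ContinuousOn (fun t : Fin n → ℝ => ∏ k, ((derivWithin (γ k) (Icc 0 1) (t k)).im : ℂ))
      (Icc 0 1) := by
  refine continuousOn_finsetProd _ fun k _ => ?_
  exact Complex.continuous_ofReal.comp_continuousOn (Complex.continuous_im.comp_continuousOn
    ((h.continuousOn_deriv k).comp (continuous_apply k).continuousOn
      fun t ht => ⟨ht.1 k, ht.2 k⟩))

lemma IsPathFamily.integral_prod_im {n : ℕ} {γ : Fin n → ℝ → ℂ} (h : IsPathFamily m n γ) :
    ∫ t in Icc (0 : Fin n → ℝ) 1, ∏ k, ((derivWithin (γ k) (Icc 0 1) (t k)).im : ℂ) =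
      Real.pi ^ n := by
  rw [integral_Icc_prod (fun k t => ((derivWithin (γ k) (Icc 0 1) t).im : ℂ))]
  simp [h.integral_im]

/-- The Green's function part integrates to zero. Each path rises by `π`, so the product part gives
`π²`, cancelling the normalization for every choice of paths. -/
lemma isTopMoment_two (hm : 0 < m) (hs : s ∉ (periods m hm).lattice) (hκ : ∀ w ∈ strip, κ w ≠ 0)
    (hφ : ∀ w ∈ strip, deriv φ w ≠ 0) (hf : IsStripKernel m s φ κ f) {c r : ℝ}
    (hc : ∀ u, u ∉ (periods m hm).lattice →
      deriv (zetaFn m) u = -((periods m hm).weierstrassP u + c))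
    (hr : (periods m hm).weierstrassP s = r) : IsTopMoment m φ f 2 (-r - c) := by
  intro γ h
  have hpi : (Real.pi : ℂ) ≠ 0 := by exact_mod_cast Real.pi_ne_zero
  have h1 := h.continuousOn_prod_im.const_smul (-((periods m hm).weierstrassP s + c) / Real.pi ^ 2)
  have h2 := (h.continuousOn_sum hm c).const_smul (1 / (4 * Real.pi ^ 2) : ℂ)
  obtain ⟨hint, hval⟩ := integrableOn_and_integral_of_eqOn (h1.sub h2) (F := fun t =>
    formA f 2 (fun k => φ (γ k (t k)))
      (fun k => deriv φ (γ k (t k)) * derivWithin (γ k) (Icc 0 1) (t k))) fun t ht =>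
    formA_two hm hs hκ hφ hf c (w := fun k => γ k (t k)) (fun k => h.inside k _ (ht k))
      fun j k hjk l => h.disjoint k j hjk.symm _ (Ioo_subset_Icc_self (ht k)) _
        (Ioo_subset_Icc_self (ht j)) l
  refine ⟨hint, hval.trans ?_⟩
  rw [integral_sub' (h1.integrableOn_compact isCompact_Icc) (h2.integrableOn_compact isCompact_Icc)]
  simp only [Pi.smul_apply]
  rw [integral_smul, integral_smul, h.integral_prod_im, h.integral_sum_eq_zero hm hc, hr]
  push_cast
  simp only [smul_eq_mul]
  field_simp
  ring

lemma isTopMoment_three (hm : 0 < m) (hs : s ∉ (periods m hm).lattice)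
    (hκ : ∀ w ∈ strip, κ w ≠ 0) (hφ : ∀ w ∈ strip, deriv φ w ≠ 0)
    (hf : IsStripKernel m s φ κ f) {r : ℝ} (hr : (periods m hm).derivWeierstrassP s = r) :
    IsTopMoment m φ f 3 (-r) := by
  intro γ h
  have hpi : (Real.pi : ℂ) ≠ 0 := by exact_mod_cast Real.pi_ne_zero
  have h1 := h.continuousOn_prod_im.const_smul (-(periods m hm).derivWeierstrassP s / Real.pi ^ 3)
  obtain ⟨hint, hval⟩ := integrableOn_and_integral_of_eqOn h1 (F := fun t =>
    formA f 3 (fun k => φ (γ k (t k)))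
      (fun k => deriv φ (γ k (t k)) * derivWithin (γ k) (Icc 0 1) (t k))) fun t ht =>
    formA_three hm hs hκ hφ hf (w := fun k => γ k (t k)) (fun k => h.inside k _ (ht k))
      fun j k hjk l => h.disjoint k j hjk.symm _ (Ioo_subset_Icc_self (ht k)) _
        (Ioo_subset_Icc_self (ht j)) l
  refine ⟨hint, hval.trans ?_⟩
  simp only [Pi.smul_apply]
  rw [integral_smul, h.integral_prod_im, hr]
  push_cast
  simp only [smul_eq_mul]
  field_simp

lemma two_pi_mem_lattice (hm : 0 < m) : 2 * Real.pi * I ∈ (periods m hm).lattice :=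
  (mem_periods_lattice hm).mpr ⟨0, 1, by simp⟩

lemma derivWeierstrassP_add_lattice (hm : 0 < m) {l : ℂ} (hl : l ∈ (periods m hm).lattice) (u : ℂ) :
    (periods m hm).derivWeierstrassP (u + l) = (periods m hm).derivWeierstrassP u :=
  (periods m hm).derivWeierstrassP_add_coe u ⟨l, hl⟩

/-- `x + πi` and its conjugate differ by the period `2πi`. -/
lemma exists_weierstrassP_eq_ofReal (hm : 0 < m) (x : ℝ) :
    ∃ r : ℝ, (periods m hm).weierstrassP (x + Real.pi * I) = r := by
  refine Complex.conj_eq_iff_real.mp ?_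
  rw [← weierstrassP_conj hm, ← weierstrassP_add_lattice hm (two_pi_mem_lattice hm)]
  congr 1
  simp only [map_add, map_mul, conj_ofReal, conj_I]
  ring

lemma exists_derivWeierstrassP_eq_ofReal (hm : 0 < m) (x : ℝ) :
    ∃ r : ℝ, (periods m hm).derivWeierstrassP (x + Real.pi * I) = r := by
  refine Complex.conj_eq_iff_real.mp ?_
  rw [← derivWeierstrassP_conj hm, ← derivWeierstrassP_add_lattice hm (two_pi_mem_lattice hm)]
  congr 1
  simp only [map_add, map_mul, conj_ofReal, conj_I]
  ring

end Moments

end DimerCylinder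
end

theorem theorem3p6 (𝔪 : ℝ) (h𝔪 : 0 < 𝔪) :
    ∃ c : ℝ, DimerCylinder.IsGreenConstant 𝔪 h𝔪 c ∧
      ∀ (U : Set ℂ) (φ : ℂ → ℂ) (f : ℂ → ℂ → ℂ → ℂ),
        DimerCylinder.IsCylindricalDomain U →
        DimerCylinder.IsUniformization 𝔪 U φ →
        (∀ η : ℂ, ∀ z₁ ∈ U, DimerCylinder.SolvesBVP U η z₁ (f η z₁)) →
        ∃ M₂ M₃ : ℝ,
          DimerCylinder.IsTopMoment 𝔪 φ f 2 M₂ ∧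
          DimerCylinder.IsTopMoment 𝔪 φ f 3 M₃ ∧
          (M₃ : ℂ) ^ 2 =
            -4 * (M₂ + (DimerCylinder.periods 𝔪 h𝔪).weierstrassP ((𝔪 : ℂ) / 2) + c) *
              (M₂ + (DimerCylinder.periods 𝔪 h𝔪).weierstrassP (2 * (Real.pi : ℂ) * Complex.I / 2)
                + c) *
              (M₂ + (DimerCylinder.periods 𝔪 h𝔪).weierstrassP
                (((𝔪 : ℂ) + 2 * (Real.pi : ℂ) * Complex.I) / 2) + c) ∧
          ∃ μ : ℝ,
            (M₂ : ℂ) = -(DimerCylinder.periods 𝔪 h𝔪).weierstrassP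
              ((1 / 2 - (μ : ℂ)) * 𝔪 + (Real.pi : ℂ) * Complex.I) - c ∧
            (M₃ : ℂ) = (DimerCylinder.periods 𝔪 h𝔪).derivWeierstrassP
              ((1 / 2 - (μ : ℂ)) * 𝔪 + (Real.pi : ℂ) * Complex.I) := by
  obtain ⟨c, hc⟩ := DimerCylinder.exists_deriv_zetaFn_eq h𝔪
  refine ⟨c, DimerCylinder.isGreenConstant_of_deriv_zetaFn h𝔪 hc, fun U φ f hU hφ hf => ?_⟩
  obtain ⟨x, κ, hκ, hker⟩ := DimerCylinder.exists_isStripKernel h𝔪 hU hφ hf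
  have hs := DimerCylinder.notMem_of_real_add_pi h𝔪 x
  obtain ⟨r, hr⟩ := DimerCylinder.exists_weierstrassP_eq_ofReal h𝔪 x
  obtain ⟨r', hr'⟩ := DimerCylinder.exists_derivWeierstrassP_eq_ofReal h𝔪 x
  have hφ' : ∀ w ∈ DimerCylinder.strip, deriv φ w ≠ 0 := fun w hw => hφ.deriv_ne_zero hw
  -- With `μ = 1/2 + x/𝔪` the point `z_μ` is `-s + 2πi`, where `s = x + πi`; `℘` is even and `℘'`
  -- odd, hence `M₃ = -℘'(s) = ℘'(z_μ)`.
  refine ⟨-r - c, -r', DimerCylinder.isTopMoment_two h𝔪 hs hκ hφ' hker hc hr,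
    DimerCylinder.isTopMoment_three h𝔪 hs hκ hφ' hker hr', ?_, 1 / 2 + x / 𝔪, ?_, ?_⟩
  · have h := DimerCylinder.derivWeierstrassP_sq_eq_prod h𝔪 hs
    rw [hr, hr'] at h
    push_cast
    linear_combination h
  all_goals
    have h𝔪' : (𝔪 : ℂ) ≠ 0 := by exact_mod_cast h𝔪.ne'
    have hz : ((1 / 2 - ((1 / 2 + x / 𝔪 : ℝ) : ℂ)) * 𝔪 + (Real.pi : ℂ) * Complex.I) =
        -(x + Real.pi * Complex.I) + 2 * Real.pi * Complex.I := by
      push_cast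
      field_simp
      ring
    rw [hz]
  · rw [DimerCylinder.weierstrassP_add_lattice h𝔪 (DimerCylinder.two_pi_mem_lattice h𝔪),
      PeriodPair.weierstrassP_neg, hr]
    push_cast
    ring
  · rw [DimerCylinder.derivWeierstrassP_add_lattice h𝔪 (DimerCylinder.two_pi_mem_lattice h𝔪),
      PeriodPair.derivWeierstrassP_neg, hr']
    push_cast
    ring
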